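/- **Theorem.** Let $n\ge 1$ and let $\mathcal S\subset\mathbb R^{n+1}$ be a smooth embedded hypersurface, $p\in\mathcal S$, and $\boldsymbol N$ a smooth unit normal vector field of $\mathcal S$ around $p$. Let $\boldsymbol e_1,\dots,\boldsymbol e_n$ be an orthonormal basis of $T_p\mathcal S$ consisting of principal directions, i.e. of eigenvectors of the Weingarten map $\boldsymbol x\mapsto-\overline\nabla_{\boldsymbol x}\boldsymbol N$ at $p$, with principal curvatures (eigenvalues) $\kappa_1,\dots,\kappa_n$, and put $$H=\sum_{\mu=1}^n\kappa_\mu,\qquad \mathcal R=2\sum_{\mu<\nu}\kappa_\mu\kappa_\nu$$ (the mean and the scalar curvature of $\mathcal S$ at $p$). For $\varepsilon>0$ let $D_p(\varepsilon)=\mathcal S\cap B_p(\varepsilon)$ be the hypersurface patch cut out by the ball $B_p(\varepsilon)\subset\mathbb R^{n+1}$ of radius $\varepsilon$ centred at $p$; with $\mathrm{dVol}$ the $n$-dimensional area on $\mathcal S$, let $$V=\int_{D_p(\varepsilon)}\mathrm{dVol},\qquad \boldsymbol s=\frac1V\int_{D_p(\varepsilon)}\boldsymbol X\,\mathrm{dVol},\qquad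 C(D_p(\varepsilon))=\int_{D_p(\varepsilon)}(\boldsymbol X-\boldsymbol s)\otimes(\boldsymbol X-\boldsymbol s)^T\,\mathrm{dVol},$$ and let $V_n(\varepsilon)$ be the volume of a ball of radius $\varepsilon$ in $\mathbb R^n$. Then, for all small $\varepsilon>0$, $0<V<\infty$, and the $n+1$ eigenvalues (with multiplicity) of the symmetric matrix $C(D_p(\varepsilon))$ can be labelled $\lambda_1(\varepsilon),\dots,\lambda_{n+1}(\varepsilon)$ so that, as $\varepsilon\to0^+$, $$\lambda_\mu(\varepsilon)=V_n(\varepsilon)\left[\frac{\varepsilon^2}{n+2}+\frac{\varepsilon^4}{8(n+2)(n+4)}\bigl(H^2-2\mathcal R-4H\kappa_\mu\bigr)\right]+\mathcal O(\varepsilon^{n+5}),\qquad \mu=1,\dots,n,$$ $$\lambda_{n+1}(\varepsilon)=V_n(\varepsilon)\,\frac{\varepsilon^4}{2(n+2)(n+4)}\left(\frac{n+1}{n+2}H^2-\mathcal R\right)+\mathcal O(\varepsilon^{n+5}).$$ Moreover, if $\kappa_1,\dots,\kappa_n$ are pairwise distinct, then any unit eigenvectors of $C(D_p(\varepsilon))$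 for $\lambda_{n+1}(\varepsilon)$ converge, up to sign, to the normal $\boldsymbol N(p)$ as $\varepsilon\to0^+$; and if in addition $H\ne0$ or $n=1$, then for each $\mu=1,\dots,n$ any unit eigenvectors for $\lambda_\mu(\varepsilon)$ converge, up to sign, to the principal direction $\boldsymbol e_\mu$. -/

import Mathlib

open MeasureTheory Filter Topology
open scoped ContDiff

noncomputable section

/-- Euclidean space `ℝᵈ`. -/
abbrev Euc (d : ℕ) : Type := EuclideanSpace ℝ (Fin d)

/-- A smooth embedded hypersurface of `ℝᵈ`: around each of its points, `S` is the zero set of a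
smooth function without critical points. -/
def IsSmoothHypersurface {d : ℕ} (S : Set (Euc d)) : Prop :=
  ∀ p ∈ S, ∃ (U : Set (Euc d)) (F : Euc d → ℝ), IsOpen U ∧ p ∈ U ∧ ContDiffOn ℝ ∞ F U ∧
    (∀ x ∈ U, fderiv ℝ F x ≠ 0) ∧ S ∩ U = {x ∈ U | F x = 0}

/-- The tangent space of `S` at `p`, spanned by the velocities at `p` of the smooth curves in `S`
through `p` (for a hypersurface these velocities already form a linear subspace). -/
def tangentSpaceAt {d : ℕ} (S : Set (Euc d)) (p : Euc d) : Submodule ℝ (Euc d) :=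
  Submodule.span ℝ {v | ∃ γ : ℝ → Euc d, ContDiffAt ℝ ∞ γ 0 ∧ (∀ᶠ t in 𝓝 (0 : ℝ), γ t ∈ S) ∧
    γ 0 = p ∧ deriv γ 0 = v}

/-- `N` is a smooth unit normal vector field of `S` around `p`. It is given by a smooth vector field
on an open subset of the ambient space; only its values at points of `S` are restricted. -/
def IsUnitNormalFieldAround {d : ℕ} (S : Set (Euc d)) (p : Euc d) (N : Euc d → Euc d) : Prop :=
  ∃ U : Set (Euc d), IsOpen U ∧ p ∈ U ∧ ContDiffOn ℝ ∞ N U ∧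
    ∀ q ∈ S ∩ U, ‖N q‖ = 1 ∧ ∀ v ∈ tangentSpaceAt S q, inner ℝ (N q) v = 0

/-- The Weingarten map `x ↦ -∇ₓ N` at `p`, to be applied to vectors `x` tangent to `S` at `p`. -/
def weingartenMap {d : ℕ} (N : Euc d → Euc d) (p : Euc d) : Euc d →L[ℝ] Euc d :=
  -(fderiv ℝ N p)

/-- The orthonormal basis `e` of the tangent space consists of principal directions of `S` at `p`,
with respective principal curvatures `κ`: it diagonalizes the Weingarten map. -/
def IsPrincipalFrame {n : ℕ} (S : Set (Euc (n + 1))) (p : Euc (n + 1))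
    (N : Euc (n + 1) → Euc (n + 1)) (κ : Fin n → ℝ)
    (e : OrthonormalBasis (Fin n) ℝ (tangentSpaceAt S p)) : Prop :=
  ∀ μ, weingartenMap N p (e μ : Euc (n + 1)) = κ μ • (e μ : Euc (n + 1))

/-- The mean curvature `H`, the sum (not the average) of the principal curvatures. -/
def meanCurvature {n : ℕ} (κ : Fin n → ℝ) : ℝ := ∑ μ, κ μ

/-- The scalar curvature `𝓡 = 2 ∑_{μ < ν} κ_μ κ_ν` of a hypersurface. -/
def scalarCurvature {n : ℕ} (κ : Fin n → ℝ) : ℝ := 2 * ∑ μ, ∑ ν ∈ Finset.Ioi μ, κ μ * κ ν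

/-- The hypersurface patch `D_p(ε) = S ∩ B_p(ε)`. -/
def patch {d : ℕ} (S : Set (Euc d)) (p : Euc d) (ε : ℝ) : Set (Euc d) :=
  S ∩ Metric.closedBall p ε

/-- The barycenter of an `n`-dimensional domain `D`; `μHE[n]` is the `n`-dimensional area. -/
def barycenter {d : ℕ} (n : ℕ) (D : Set (Euc d)) : Euc d :=
  ((μHE[n] D).toReal)⁻¹ • ∫ x in D, x ∂(μHE[n] : Measure (Euc d))

/-- The (non-normalized) covariance matrix `∫_D (X - s) ⊗ (X - s) dVol` of an `n`-dimensional
domain `D` with barycenter `s`. -/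
def covarianceMatrix {d : ℕ} (n : ℕ) (D : Set (Euc d)) : Matrix (Fin d) (Fin d) ℝ :=
  Matrix.of fun i j =>
    ∫ x in D, (x i - barycenter n D i) * (x j - barycenter n D j) ∂(μHE[n] : Measure (Euc d))

/-- The volume `V_n(ε)` of an `n`-dimensional Euclidean ball of radius `ε`. -/
def ballVolume (n : ℕ) (ε : ℝ) : ℝ := (volume (Metric.ball (0 : Euc n) ε)).toReal

/-- As `ε → 0⁺`, the family `v ε` converges, up to sign, to `w`. -/
def ConvergesUpToSign {d : ℕ} (v : ℝ → Euc d) (w : Euc d) : Prop :=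
  Tendsto (fun ε => min ‖v ε - w‖ ‖v ε + w‖) (𝓝[>] 0) (𝓝 0)

/-- `v ε` is, for all small `ε > 0`, a unit eigenvector of `A ε` with eigenvalue `l ε`. -/
def IsUnitEigenvectorFamily {d : ℕ} (A : ℝ → Matrix (Fin d) (Fin d) ℝ) (l : ℝ → ℝ)
    (v : ℝ → Euc d) : Prop :=
  ∀ᶠ ε in 𝓝[>] (0 : ℝ), ‖v ε‖ = 1 ∧ Matrix.toEuclideanLin (A ε) (v ε) = l ε • v ε

end

/-!
Near `p` the hypersurface is the graph of a function `f` over its tangent space, in the orthonormal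
frame made of the principal directions and of the normal `N p`. Since `N` is orthogonal to the
graph, `f` vanishes to first order at `0`, and differentiating this orthogonality shows that its
Hessian is diagonal with the principal curvatures as entries (`fderiv_graph_eq_zero_and_hessian`). So
`f = q + O(|x|³)` with `q = ½ ∑ κᵢ xᵢ²`, the area density is
`√(1 + |∇f|²) = 1 + ½ ∑ κᵢ² xᵢ² + O(|x|³)`, and the patch is the image of
`{x | |x|² + f² ≤ ε²}`. In polar coordinates `x = r θ` this domain is `r ≤ ε - ½ ε³ q(θ)² + O(ε⁴)`,
which reduces every integral over the patch to moments of the unit sphere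
(`exists_patchDomain_expansion`). These moments come from Gaussian integrals
(`sphereIntegral_monomial`).

Surface integrals are taken with respect to the Hausdorff measure; they are pulled back to the
tangent space by the area formula `comap_euclideanHausdorffMeasure`, whose density is found by
differentiating the pulled back measure along small balls.

In the frame, the covariance matrix is therefore diagonal with the asserted eigenvalues as entries,
up to errors `O(ε ^ (n + 5))`, except that the entries mixing tangential and normal directions are
only `O(ε ^ (n + 4))` (`exists_frame_entry_bounds`). The gap between the tangential and the normal
eigenvalues is of order `ε ^ (n + 2)`, so by the min-max principle the mixed entries move the
eigenvalues only by `ε ^ (2 (n + 4)) / ε ^ (n + 2) = ε ^ (n + 6)`. The same gap forces the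
eigenvectors of the last eigenvalue towards the normal. The tangential eigenvalues differ from each
other by multiples of `H (κ_ν - κ_μ) ε ^ (n + 4)`; where these do not vanish, they dominate the
errors and the eigenvectors converge to the principal directions (`exists_eigenvalue_asymptotics`).
-/

noncomputable section

/-! ### The area formula for injective immersions -/

section AreaFormula

open scoped ENNReal NNReal

/-- If `Φ` expands distances at most `K` times as much as `Ψ` does, then it expands Hausdorff
measures at most `K ^ n` times as much: `Φ ∘ Ψ⁻¹` is `K`-Lipschitz. -/
lemma euclideanHausdorffMeasure_image_le_of_dist_le {α : Type*} [Nonempty α] {K : ℝ≥0}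
    {V W : Type*} [MetricSpace V] [MeasurableSpace V] [BorelSpace V] [MetricSpace W]
    [MeasurableSpace W] [BorelSpace W] {Φ : α → V} {Ψ : α → W}
    {s : Set α} (n : ℕ) (h : ∀ y ∈ s, ∀ z ∈ s, dist (Φ y) (Φ z) ≤ K * dist (Ψ y) (Ψ z)) :
    μHE[n] (Φ '' s) ≤ (K : ℝ≥0∞) ^ n * μHE[n] (Ψ '' s) := by
  have hinj : ∀ y ∈ s, Φ (Function.invFunOn Ψ s (Ψ y)) = Φ y := by
    intro y hy
    have hm : Function.invFunOn Ψ s (Ψ y) ∈ s := Function.invFunOn_mem ⟨y, hy, rfl⟩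
    have he : Ψ (Function.invFunOn Ψ s (Ψ y)) = Ψ y := Function.invFunOn_eq ⟨y, hy, rfl⟩
    have := h _ hm _ hy
    rw [he, dist_self, mul_zero] at this
    exact dist_le_zero.1 this
  have hL : LipschitzOnWith K (fun w => Φ (Function.invFunOn Ψ s w)) (Ψ '' s) := by
    refine LipschitzOnWith.of_dist_le_mul ?_
    rintro _ ⟨y, hy, rfl⟩ _ ⟨z, hz, rfl⟩
    simp only [hinj y hy, hinj z hz]
    exact h y hy z hz
  have himg : (fun w => Φ (Function.invFunOn Ψ s w)) '' (Ψ '' s) = Φ '' s := by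
    rw [Set.image_image]
    exact Set.image_congr hinj
  have := hL.hausdorffMeasure_image_le (d := (n : ℝ)) (by positivity)
  rw [himg] at this
  simp only [Measure.euclideanHausdorffMeasure_def, Measure.smul_apply, ENNReal.smul_def,
    smul_eq_mul]
  calc _ ≤ _ := mul_le_mul_right this _
    _ = _ := by rw [ENNReal.rpow_natCast]; ring

lemma exists_mul_norm_le_of_injective {n : ℕ} {V : Type*} [NormedAddCommGroup V]
    [NormedSpace ℝ V] {L : EuclideanSpace ℝ (Fin n) →L[ℝ] V}
    (hL : Function.Injective L) : ∃ c > 0, ∀ v, c * ‖v‖ ≤ ‖L v‖ := by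
  obtain ⟨K, hK, h⟩ := L.toLinearMap.exists_antilipschitzWith (LinearMap.ker_eq_bot.2 hL)
  refine ⟨(K : ℝ)⁻¹, by positivity, fun v => ?_⟩
  have := h.le_mul_dist v 0
  simp only [dist_zero_right, map_zero, ContinuousLinearMap.coe_coe] at this
  rw [inv_mul_le_iff₀ (by positivity)]
  exact this

/-- Near a point with injective strict derivative `L`, the map `Φ` and its linearization `L`
distort distances equally, up to a factor arbitrarily close to `1`. -/
lemma eventually_dist_image_le {n : ℕ} {V : Type*} [NormedAddCommGroup V]
    [NormedSpace ℝ V] {Φ : EuclideanSpace ℝ (Fin n) → V}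
    {L : EuclideanSpace ℝ (Fin n) →L[ℝ] V} {x : EuclideanSpace ℝ (Fin n)}
    (h : HasStrictFDerivAt Φ L x) (hL : Function.Injective L) {t : ℝ} (ht : 1 < t) :
    ∀ᶠ r in 𝓝[>] (0 : ℝ), ∀ y ∈ Metric.closedBall x r, ∀ z ∈ Metric.closedBall x r,
      dist (Φ y) (Φ z) ≤ t * dist (L y) (L z) ∧ dist (L y) (L z) ≤ t * dist (Φ y) (Φ z) := by
  obtain ⟨c, hc, hcL⟩ := exists_mul_norm_le_of_injective hL
  set η : ℝ := 1 - t⁻¹ with hη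
  have ht0 : 0 < t := by linarith
  have hη0 : 0 < η := by rw [hη]; have := inv_lt_one_of_one_lt₀ ht; linarith
  have hη1 : 1 + η ≤ t := by
    have : 2 ≤ t + t⁻¹ := by
      have h1 : t * t⁻¹ = 1 := mul_inv_cancel₀ ht0.ne'
      nlinarith [sq_nonneg (t - 1), inv_pos.2 ht0]
    rw [hη]; linarith
  have hev := h.isLittleO.def (mul_pos hη0 hc)
  rw [Metric.eventually_nhds_iff] at hev
  obtain ⟨δ, hδ, hev⟩ := hev
  filter_upwards [Ioo_mem_nhdsGT hδ] with r hr y hy z hz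
  have hd : dist (y, z) (x, x) < δ := by
    rw [Prod.dist_eq]
    exact max_lt ((Metric.mem_closedBall.1 hy).trans_lt hr.2)
      ((Metric.mem_closedBall.1 hz).trans_lt hr.2)
  have hb := hev hd
  simp only at hb
  have hb2 : ‖Φ y - Φ z - L (y - z)‖ ≤ η * ‖L (y - z)‖ := by
    calc _ ≤ _ := hb
      _ = η * (c * ‖y - z‖) := by ring
      _ ≤ _ := by gcongr; exact hcL _
  rw [dist_eq_norm, dist_eq_norm, ← map_sub]
  have h1 : ‖Φ y - Φ z‖ ≤ ‖Φ y - Φ z - L (y - z)‖ + ‖L (y - z)‖ := norm_le_norm_sub_add _ _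
  have h2 : ‖L (y - z)‖ ≤ ‖Φ y - Φ z - L (y - z)‖ + ‖Φ y - Φ z‖ := by
    rw [norm_sub_rev (Φ y - Φ z)]; exact norm_le_norm_sub_add _ _
  have h0 := norm_nonneg (L (y - z))
  constructor
  · nlinarith
  · have h3 : t⁻¹ * ‖L (y - z)‖ ≤ ‖Φ y - Φ z‖ := by
      have : t⁻¹ = 1 - η := by rw [hη]; ring
      rw [this]; nlinarith
    rwa [inv_mul_le_iff₀ ht0] at h3

variable {n : ℕ} {V : Type*} [NormedAddCommGroup V] [InnerProductSpace ℝ V]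
  [MeasurableSpace V] [BorelSpace V]

lemma euclideanHausdorffMeasure_linear_image (L : EuclideanSpace ℝ (Fin n) →L[ℝ] V)
    (s : Set (EuclideanSpace ℝ (Fin n))) :
    μHE[n] (L '' s) = ENNReal.ofReal L.toLinearMap.normDet * volume s := by
  have := L.toLinearMap.euclideanHausdorffMeasure_image_eq_normDet_mul_volume s
  simpa using this

variable {Φ : EuclideanSpace ℝ (Fin n) → V}
  {Φ' : EuclideanSpace ℝ (Fin n) → EuclideanSpace ℝ (Fin n) →L[ℝ] V}

/-- The area ratios of small balls tend to the Jacobian: by the two-sided distortion estimate the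
image of a small ball under `Φ` and its image under `L` have comparable areas, with constants
arbitrarily close to `1`. -/
lemma tendsto_hausdorffMeasure_image_closedBall_div {L : EuclideanSpace ℝ (Fin n) →L[ℝ] V}
    {x : EuclideanSpace ℝ (Fin n)}
    (h : HasStrictFDerivAt Φ L x) (hL : Function.Injective L) :
    Tendsto (fun r => μHE[n] (Φ '' Metric.closedBall x r) / volume (Metric.closedBall x r))
      (𝓝[>] 0) (𝓝 (ENNReal.ofReal L.toLinearMap.normDet)) := by
  set J := ENNReal.ofReal L.toLinearMap.normDet with hJ
  have key : ∀ t : ℝ≥0, 1 < t → ∀ᶠ r in 𝓝[>] (0 : ℝ),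
      μHE[n] (Φ '' Metric.closedBall x r) / volume (Metric.closedBall x r) ≤ (t : ℝ≥0∞) ^ n * J ∧
      J / (t : ℝ≥0∞) ^ n ≤
        μHE[n] (Φ '' Metric.closedBall x r) / volume (Metric.closedBall x r) := by
    intro t ht
    filter_upwards [eventually_dist_image_le h hL (t := t) (by exact_mod_cast ht),
      self_mem_nhdsWithin] with r hr hr0
    have hr0 : 0 < r := hr0
    have hv0 : volume (Metric.closedBall x r) ≠ 0 := (Metric.measure_closedBall_pos _ _ hr0).ne'
    have hv1 : volume (Metric.closedBall x r) ≠ ⊤ := measure_closedBall_lt_top.ne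
    have h1 := euclideanHausdorffMeasure_image_le_of_dist_le (K := t) (Φ := Φ) (Ψ := L) n
      (fun y hy z hz => (hr y hy z hz).1)
    have h2 := euclideanHausdorffMeasure_image_le_of_dist_le (K := t) (Φ := L) (Ψ := Φ) n
      (fun y hy z hz => (hr y hy z hz).2)
    rw [euclideanHausdorffMeasure_linear_image, ← hJ] at h1 h2
    have ht0 : (t : ℝ≥0∞) ^ n ≠ 0 := by
      have : t ≠ 0 := (zero_lt_one.trans ht).ne'
      simp [this]
    have ht1 : (t : ℝ≥0∞) ^ n ≠ ⊤ := by simp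
    constructor
    · rw [ENNReal.div_le_iff hv0 hv1, mul_assoc]; exact h1
    · rw [ENNReal.le_div_iff_mul_le (.inl hv0) (.inl hv1), ENNReal.mul_div_right_comm.symm,
        ENNReal.div_le_iff ht0 ht1, mul_comm _ ((t : ℝ≥0∞) ^ n)]
      exact h2
  have hJt : J ≠ ⊤ := ENNReal.ofReal_ne_top
  have hc1 : Tendsto (fun t : ℝ≥0 => (t : ℝ≥0∞) ^ n * J) (𝓝[>] 1) (𝓝 J) := by
    have : Tendsto (fun t : ℝ≥0 => (t : ℝ≥0∞) ^ n * J) (𝓝[>] 1)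
        (𝓝 (((1 : ℝ≥0) : ℝ≥0∞) ^ n * J)) := by
      refine ENNReal.Tendsto.mul_const (ENNReal.Tendsto.pow ?_) (.inr hJt)
      exact ENNReal.tendsto_coe.2 nhdsWithin_le_nhds
    simpa using this
  have hc2 : Tendsto (fun t : ℝ≥0 => J / (t : ℝ≥0∞) ^ n) (𝓝[>] 1) (𝓝 J) := by
    have : Tendsto (fun t : ℝ≥0 => J / (t : ℝ≥0∞) ^ n) (𝓝[>] 1)
        (𝓝 (J / ((1 : ℝ≥0) : ℝ≥0∞) ^ n)) := by
      refine ENNReal.Tendsto.const_div (ENNReal.Tendsto.pow ?_) (.inr hJt)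
      exact ENNReal.tendsto_coe.2 nhdsWithin_le_nhds
    simpa using this
  refine tendsto_order.2 ⟨fun a ha => ?_, fun a ha => ?_⟩
  · obtain ⟨t, ht, ht1⟩ := ((hc2.eventually (lt_mem_nhds ha)).and self_mem_nhdsWithin).exists
    filter_upwards [key t ht1] with r hr using ht.trans_le hr.2
  · obtain ⟨t, ht, ht1⟩ := ((hc1.eventually (gt_mem_nhds ha)).and self_mem_nhdsWithin).exists
    filter_upwards [key t ht1] with r hr using hr.1.trans_lt ht

/-- The area formula: the pull-back of the `n`-dimensional area under an injective immersion has the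
Jacobian `normDet` of the derivative as its density. The density is identified as the limit of the
area ratios of small balls. -/
theorem comap_euclideanHausdorffMeasure (hΦ : MeasurableEmbedding Φ)
    (h : ∀ x, HasStrictFDerivAt Φ (Φ' x) x) (hinj : ∀ x, Function.Injective (Φ' x)) :
    (μHE[n] : Measure V).comap Φ =
      volume.withDensity fun x => ENNReal.ofReal (Φ' x).toLinearMap.normDet := by
  set ρ := (μHE[n] : Measure V).comap Φ with hρ
  have hρa : ∀ s, ρ s = μHE[n] (Φ '' s) := fun s => hΦ.comap_apply _ _
  have hloc : ∀ x, ∃ u ∈ 𝓝 x, ∃ K : ℝ≥0, ∀ s ⊆ u, ρ s ≤ (K : ℝ≥0∞) ^ n * volume s := by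
    intro x
    obtain ⟨K, u, hu, hK⟩ := (h x).exists_lipschitzOnWith
    refine ⟨u, hu, K, fun s hs => ?_⟩
    have := euclideanHausdorffMeasure_image_le_of_dist_le (K := K) (Φ := Φ)
      (Ψ := (id : EuclideanSpace ℝ (Fin n) → _)) (s := s) n
      (fun y hy z hz => hK.dist_le_mul y (hs hy) z (hs hz))
    rw [Set.image_id, EuclideanSpace.euclideanHausdorffMeasure_eq_volume] at this
    rw [hρa]; exact this
  have hfin : IsLocallyFiniteMeasure ρ := by
    refine ⟨fun x => ?_⟩
    obtain ⟨u, hu, K, hK⟩ := hloc x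
    obtain ⟨r, hr, hru⟩ := Metric.nhds_basis_closedBall.mem_iff.1 hu
    refine ⟨_, Metric.closedBall_mem_nhds x hr, (hK _ hru).trans_lt ?_⟩
    exact ENNReal.mul_lt_top (by finiteness) measure_closedBall_lt_top
  have hac : ρ ≪ volume := by
    intro s hs
    refine measure_null_of_locally_null s fun x _ => ?_
    obtain ⟨u, hu, K, hK⟩ := hloc x
    refine ⟨u ∩ s, Filter.inter_mem (mem_nhdsWithin_of_mem_nhds hu) self_mem_nhdsWithin, ?_⟩
    have := hK (u ∩ s) Set.inter_subset_left
    rw [measure_mono_null Set.inter_subset_right hs, mul_zero] at this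
    exact le_antisymm this zero_le
  have hae : ρ.rnDeriv volume =ᵐ[volume] fun x => ENNReal.ofReal (Φ' x).toLinearMap.normDet := by
    filter_upwards [Besicovitch.ae_tendsto_rnDeriv ρ volume] with x hx
    refine tendsto_nhds_unique hx ?_
    simp only [hρa]
    exact tendsto_hausdorffMeasure_image_closedBall_div (h x) (hinj x)
  rw [← Measure.withDensity_rnDeriv_eq ρ volume hac]
  exact withDensity_congr_ae hae

/-- Change of variables in an integral over the image of an injective immersion. -/
theorem setIntegral_image_euclideanHausdorffMeasure {G : Type*} [NormedAddCommGroup G]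
    [NormedSpace ℝ G] (hΦ : MeasurableEmbedding Φ)
    (h : ∀ x, HasStrictFDerivAt Φ (Φ' x) x) (hinj : ∀ x, Function.Injective (Φ' x))
    (hm : Measurable fun x => (Φ' x).toLinearMap.normDet)
    {D : Set (EuclideanSpace ℝ (Fin n))} (hD : MeasurableSet D) (g : V → G) :
    ∫ y in Φ '' D, g y ∂(μHE[n] : Measure V) =
      ∫ x in D, (Φ' x).toLinearMap.normDet • g (Φ x) := by
  have h1 : (μHE[n] : Measure V).restrict (Φ '' D) =
      (((μHE[n] : Measure V).comap Φ).restrict D).map Φ := by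
    rw [hΦ.restrict_comap, hΦ.map_comap, Measure.restrict_restrict hΦ.measurableSet_range,
      Set.inter_eq_self_of_subset_right (Set.image_subset_range _ _)]
  rw [h1, hΦ.integral_map, comap_euclideanHausdorffMeasure hΦ h hinj,
    restrict_withDensity hD]
  simp only [ENNReal.ofReal]
  rw [integral_withDensity_eq_integral_smul hm.real_toNNReal]
  congr 1
  ext x
  rw [NNReal.smul_def, Real.coe_toNNReal _ (LinearMap.normDet_nonneg _)]

theorem euclideanHausdorffMeasure_image_eq_lintegral (hΦ : MeasurableEmbedding Φ)
    (h : ∀ x, HasStrictFDerivAt Φ (Φ' x) x) (hinj : ∀ x, Function.Injective (Φ' x))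
    {D : Set (EuclideanSpace ℝ (Fin n))} (hD : MeasurableSet D) :
    μHE[n] (Φ '' D) = ∫⁻ x in D, ENNReal.ofReal (Φ' x).toLinearMap.normDet := by
  rw [← hΦ.comap_apply, comap_euclideanHausdorffMeasure hΦ h hinj, withDensity_apply _ hD]

end AreaFormula

/-! ### Eigenvalues and eigenvectors of almost diagonal symmetric operators -/

section Perturbation

variable {E : Type*} [NormedAddCommGroup E] [InnerProductSpace ℝ E]

lemma exists_ne_zero_orthogonal {m : ℕ} [FiniteDimensional ℝ E] (hm : Module.finrank ℝ E = m)
    (k : Fin m) (u : Fin m → E) :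
    ∃ x : E, x ≠ 0 ∧ ∀ i, i ≠ k → inner ℝ (u i) x = 0 := by
  let L : E →ₗ[ℝ] (Fin m → ℝ) :=
    LinearMap.pi fun i => if i = k then 0 else (innerSL ℝ (u i)).toLinearMap
  have hns : ¬ Function.Surjective L := by
    intro h
    obtain ⟨x, hx⟩ := h (Pi.single k 1)
    have := congrFun hx k
    simp [L] at this
  have hni : ¬ Function.Injective L := by
    rwa [LinearMap.injective_iff_surjective_of_finrank_eq_finrank (by simpa using hm)]
  rw [← LinearMap.ker_eq_bot, Submodule.eq_bot_iff] at hni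
  push Not at hni
  obtain ⟨x, hx, hx0⟩ := hni
  refine ⟨x, hx0, fun i hi => ?_⟩
  have := congrFun (LinearMap.mem_ker.1 hx) i
  simpa [L, hi] using this

lemma sum_inner_sq {m : ℕ} (v : OrthonormalBasis (Fin m) ℝ E) (x : E) :
    ‖x‖ ^ 2 = ∑ i, inner ℝ (v i) x ^ 2 := by
  rw [← v.sum_sq_norm_inner_right x]
  simp

lemma inner_apply_eq_sum_eigenvalues {m : ℕ} [FiniteDimensional ℝ E]
    (hm : Module.finrank ℝ E = m) {T : E →ₗ[ℝ] E} (hT : T.IsSymmetric) (x : E) :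
    inner ℝ x (T x) = ∑ i, hT.eigenvalues hm i * inner ℝ (hT.eigenvectorBasis hm i) x ^ 2 := by
  rw [← (hT.eigenvectorBasis hm).sum_inner_mul_inner x (T x)]
  refine Finset.sum_congr rfl fun i _ => ?_
  rw [← hT (hT.eigenvectorBasis hm i) x, hT.apply_eigenvectorBasis, inner_smul_left,
    real_inner_comm]
  simp; ring

/-- Two-sided eigenvalue estimate by the min-max principle. In the orthonormal basis `b`, the
quadratic form of `T` is at least `d k - δ` on the span of the `b j` with `d k ≤ d j`, and at most
`d k + δ` on the span of the `b j` with `d j ≤ d k`; then each `d k` is within `δ` of an eigenvalue,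
multiplicities included. -/
theorem exists_eigenvalues_abs_sub_le {m : ℕ} [FiniteDimensional ℝ E]
    (hm : Module.finrank ℝ E = m) {T : E →ₗ[ℝ] E} (hT : T.IsSymmetric)
    (b : OrthonormalBasis (Fin m) ℝ E) (d : Fin m → ℝ) (δ : ℝ)
    (hlow : ∀ k x, (∀ j, d j < d k → inner ℝ (b j) x = 0) →
      (d k - δ) * ‖x‖ ^ 2 ≤ inner ℝ x (T x))
    (hup : ∀ k x, (∀ j, d k < d j → inner ℝ (b j) x = 0) →
      inner ℝ x (T x) ≤ (d k + δ) * ‖x‖ ^ 2) :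
    ∃ l : Fin m → ℝ, T.charpoly = ∏ i, (Polynomial.X - Polynomial.C (l i)) ∧
      ∀ k, |l k - d k| ≤ δ := by
  -- `τ` enumerates the indices so that `d` decreases, as the eigenvalues do.
  set τ : Equiv.Perm (Fin m) := Tuple.sort (fun i => -d i) with hτ
  have hanti : Antitone (d ∘ τ) := by
    have := Tuple.monotone_sort (fun i => -d i)
    intro i j hij
    simpa using this hij
  set v := hT.eigenvectorBasis hm
  have hmain : ∀ k, |hT.eigenvalues hm k - d (τ k)| ≤ δ := by
    intro k
    have hev := hT.eigenvalues_antitone hm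
    rw [abs_le]
    constructor
    · obtain ⟨x, hx0, hx⟩ := exists_ne_zero_orthogonal hm k
        (fun i => if i < k then v i else b (τ i))
      have h1 := hlow (τ k) x (fun j hj => by
        have hlt : k < τ.symm j := by
          by_contra hc
          have := hanti (not_lt.1 hc)
          simp at this
          linarith
        have := hx _ hlt.ne'
        simpa [hlt.le.not_gt] using this)
      have h2 : inner ℝ x (T x) ≤ hT.eigenvalues hm k * ‖x‖ ^ 2 := by
        rw [inner_apply_eq_sum_eigenvalues hm hT, sum_inner_sq v x, Finset.mul_sum]
        refine Finset.sum_le_sum fun i _ => ?_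
        rcases lt_or_ge i k with hik | hik
        · have := hx i hik.ne
          rw [if_pos hik] at this
          simp [v, this]
        · exact mul_le_mul_of_nonneg_right (hev hik) (sq_nonneg _)
      have h3 : 0 < ‖x‖ ^ 2 := by positivity
      have := le_of_mul_le_mul_right (h1.trans h2) h3
      linarith
    · obtain ⟨x, hx0, hx⟩ := exists_ne_zero_orthogonal hm k
        (fun i => if k < i then v i else b (τ i))
      have h1 := hup (τ k) x (fun j hj => by
        have hlt : τ.symm j < k := by
          by_contra hc
          have := hanti (not_lt.1 hc)
          simp at this
          linarith
        have := hx _ hlt.ne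
        simpa [hlt.le.not_gt] using this)
      have h2 : hT.eigenvalues hm k * ‖x‖ ^ 2 ≤ inner ℝ x (T x) := by
        rw [inner_apply_eq_sum_eigenvalues hm hT, sum_inner_sq v x, Finset.mul_sum]
        refine Finset.sum_le_sum fun i _ => ?_
        rcases lt_or_ge k i with hik | hik
        · have := hx i hik.ne'
          rw [if_pos hik] at this
          simp [v, this]
        · exact mul_le_mul_of_nonneg_right (hev hik) (sq_nonneg _)
      have h3 : 0 < ‖x‖ ^ 2 := by positivity
      have := le_of_mul_le_mul_right (h2.trans h1) h3
      linarith
  refine ⟨fun j => hT.eigenvalues hm (τ.symm j), ?_, fun k => ?_⟩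
  · rw [hT.charpoly_eq hm]
    exact (τ.symm.prod_comp fun i : Fin m =>
      (Polynomial.X - Polynomial.C (hT.eigenvalues hm i) : Polynomial ℝ)).symm
  · simpa using hmain (τ.symm k)

lemma inner_apply_eq_sum_entries {m : ℕ} (b : OrthonormalBasis (Fin m) ℝ E) (T : E →ₗ[ℝ] E)
    (x y : E) :
    inner ℝ x (T y) =
      ∑ i, ∑ j, inner ℝ (b i) x * inner ℝ (b j) y * inner ℝ (b i) (T (b j)) := by
  rw [← b.sum_inner_mul_inner x (T y)]
  refine Finset.sum_congr rfl fun i _ => ?_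
  have hy : T y = ∑ j, inner ℝ (b j) y • T (b j) := by
    conv_lhs => rw [← b.sum_repr y]
    simp [b.repr_apply_apply]
  rw [hy, inner_sum, Finset.mul_sum]
  refine Finset.sum_congr rfl fun j _ => ?_
  rw [inner_smul_right, real_inner_comm]
  ring

lemma abs_quadratic_form_le {n : ℕ} {η : ℝ} (a : Fin n → Fin n → ℝ) (h : ∀ i j, |a i j| ≤ η)
    (t : Fin n → ℝ) : |∑ i, ∑ j, t i * t j * a i j| ≤ n * η * ∑ i, t i ^ 2 := by
  calc |∑ i, ∑ j, t i * t j * a i j| ≤ ∑ i, ∑ j, |t i * t j * a i j| :=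
        (Finset.abs_sum_le_sum_abs _ _).trans
          (Finset.sum_le_sum fun i _ => Finset.abs_sum_le_sum_abs _ _)
    _ ≤ ∑ i, ∑ j, η * ((t i ^ 2 + t j ^ 2) / 2) := by
        refine Finset.sum_le_sum fun i _ => Finset.sum_le_sum fun j _ => ?_
        rw [abs_mul, mul_comm]
        have h1 : |t i * t j| ≤ (t i ^ 2 + t j ^ 2) / 2 := by
          rw [abs_le]; constructor <;> nlinarith [sq_nonneg (t i + t j), sq_nonneg (t i - t j)]
        exact mul_le_mul (h i j) h1 (abs_nonneg _) ((abs_nonneg _).trans (h i j))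
    _ = n * η * ∑ i, t i ^ 2 := by
        simp only [← Finset.mul_sum, add_div, Finset.sum_add_distrib, Finset.sum_const,
          Finset.card_univ, Fintype.card_fin, nsmul_eq_mul, ← Finset.sum_div]
        ring

/-- Cauchy–Schwarz and Young's inequality for the mixed term of a quadratic form. -/
lemma abs_two_mul_sum_mul_le {n : ℕ} {ξ g : ℝ} (hg : 0 < g) (a : Fin n → ℝ) (h : ∀ i, |a i| ≤ ξ)
    (t : Fin n → ℝ) (s : ℝ) :
    |2 * ∑ i, t i * s * a i| ≤ g * ∑ i, t i ^ 2 + n * ξ ^ 2 / g * s ^ 2 ∧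
    |2 * ∑ i, t i * s * a i| ≤ n * ξ ^ 2 / g * ∑ i, t i ^ 2 + g * s ^ 2 := by
  have key : |∑ i, t i * a i| ^ 2 ≤ (∑ i, t i ^ 2) * (n * ξ ^ 2) := by
    rw [sq_abs]
    refine (Finset.sum_mul_sq_le_sq_mul_sq _ _ _).trans ?_
    refine mul_le_mul_of_nonneg_left ?_ (Finset.sum_nonneg fun i _ => sq_nonneg _)
    calc ∑ i, a i ^ 2 ≤ ∑ _i : Fin n, ξ ^ 2 := Finset.sum_le_sum fun i _ => by
          rw [← sq_abs]; exact pow_le_pow_left₀ (abs_nonneg _) (h i) 2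
      _ = _ := by simp
  have hrw : |2 * ∑ i, t i * s * a i| = 2 * |s| * |∑ i, t i * a i| := by
    rw [abs_mul, ← abs_two (α := ℝ), abs_abs, mul_assoc, ← abs_mul s, Finset.mul_sum]
    congr 2; refine Finset.sum_congr rfl fun i _ => by ring
  set P := ∑ i, t i ^ 2
  have hP : 0 ≤ P := Finset.sum_nonneg fun i _ => sq_nonneg _
  set Y := |∑ i, t i * a i|
  have hY : 0 ≤ Y := abs_nonneg _
  rw [hrw]
  have young : ∀ A B : ℝ, 0 ≤ A → 0 ≤ B → (|s| * Y) ^ 2 ≤ A * B → 2 * |s| * Y ≤ A + B := by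
    intro A B hA hB hAB
    have : (2 * |s| * Y) ^ 2 ≤ (A + B) ^ 2 := by nlinarith [sq_nonneg (A - B)]
    exact abs_le_of_sq_le_sq' this (by positivity) |>.2
  have hk : (|s| * Y) ^ 2 ≤ s ^ 2 * (P * (n * ξ ^ 2)) := by
    rw [mul_pow, sq_abs]; gcongr
  constructor
  · refine young _ _ (by positivity) (by positivity) (hk.trans_eq ?_)
    field_simp
  · refine young _ _ (by positivity) (by positivity) (hk.trans_eq ?_)
    field_simp

/-- Eigenvalues of a symmetric operator whose matrix in the basis `b` is diagonal up to errors `η`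
in the first `n` rows and columns and in the last diagonal entry, and up to errors `ξ` in the
remaining entries. If the last diagonal entry is smaller than the other ones by at least `g`, the
latter errors matter only to second order. -/
theorem exists_eigenvalues_of_almost_diagonal {n : ℕ} (hn : 1 ≤ n) [FiniteDimensional ℝ E]
    (hm : Module.finrank ℝ E = n + 1) {T : E →ₗ[ℝ] E} (hT : T.IsSymmetric)
    (b : OrthonormalBasis (Fin (n + 1)) ℝ E) (d : Fin (n + 1) → ℝ) {η ξ g : ℝ} (hg : 0 < g)
    (htt : ∀ i j : Fin n, |inner ℝ (b i.castSucc) (T (b j.castSucc)) -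
      if i = j then d i.castSucc else 0| ≤ η)
    (hnn : |inner ℝ (b (Fin.last n)) (T (b (Fin.last n))) - d (Fin.last n)| ≤ η)
    (htn : ∀ i : Fin n, |inner ℝ (b i.castSucc) (T (b (Fin.last n)))| ≤ ξ)
    (hgap : ∀ i : Fin n, d (Fin.last n) + g ≤ d i.castSucc) :
    ∃ l : Fin (n + 1) → ℝ, T.charpoly = ∏ i, (Polynomial.X - Polynomial.C (l i)) ∧
      ∀ k, |l k - d k| ≤ n * η + n * ξ ^ 2 / g := by
  have hη : 0 ≤ η := (abs_nonneg _).trans hnn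
  have hn1 : (1 : ℝ) ≤ n := by exact_mod_cast hn
  -- The quadratic form is its diagonal part plus errors `A` (tangential), `B` (mixed), `C` (last).
  -- The mixed error is split in two ways by Young's inequality: the weight `g` is put on the
  -- coordinates which the gap compensates in the lower, respectively the upper, bound.
  have hform : ∀ x : E, ∃ A B C : ℝ,
      inner ℝ x (T x) = ∑ i : Fin n, d i.castSucc * inner ℝ (b i.castSucc) x ^ 2 +
        d (Fin.last n) * inner ℝ (b (Fin.last n)) x ^ 2 + A + B + C ∧
      |A| ≤ n * η * ∑ i : Fin n, inner ℝ (b i.castSucc) x ^ 2 ∧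
      (|B| ≤ g * ∑ i : Fin n, inner ℝ (b i.castSucc) x ^ 2 +
        n * ξ ^ 2 / g * inner ℝ (b (Fin.last n)) x ^ 2 ∧
       |B| ≤ n * ξ ^ 2 / g * ∑ i : Fin n, inner ℝ (b i.castSucc) x ^ 2 +
        g * inner ℝ (b (Fin.last n)) x ^ 2) ∧
      |C| ≤ η * inner ℝ (b (Fin.last n)) x ^ 2 ∧ (inner ℝ (b (Fin.last n)) x = 0 → B = 0) := by
    intro x
    set t : Fin n → ℝ := fun i => inner ℝ (b i.castSucc) x with ht
    set s : ℝ := inner ℝ (b (Fin.last n)) x with hs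
    refine ⟨_, _, _, ?_, abs_quadratic_form_le _ htt t, abs_two_mul_sum_mul_le hg _ htn t s,
      (?_ : |(inner ℝ (b (Fin.last n)) (T (b (Fin.last n))) - d (Fin.last n)) * s ^ 2| ≤ _),
      fun h0 => by simp [h0]⟩
    · rw [inner_apply_eq_sum_entries b]
      have hsymm : ∀ i : Fin n, inner ℝ (b (Fin.last n)) (T (b i.castSucc)) =
          inner ℝ (b i.castSucc) (T (b (Fin.last n))) := fun i => by
        rw [← hT, real_inner_comm]
      simp only [Fin.sum_univ_castSucc, hsymm, ← hs]
      have e1 : ∀ i : Fin n, inner ℝ (b i.castSucc) x = t i := fun i => rfl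
      simp only [e1, mul_sub, Finset.sum_sub_distrib, Finset.sum_add_distrib, mul_ite, mul_zero,
        Finset.sum_ite_eq, Finset.mem_univ, if_true]
      have e2 : ∑ i, s * t i * inner ℝ (b i.castSucc) (T (b (Fin.last n))) =
          ∑ i, t i * s * inner ℝ (b i.castSucc) (T (b (Fin.last n))) :=
        Finset.sum_congr rfl fun i _ => by ring
      have e3 : ∑ i, t i * t i * d i.castSucc = ∑ i, d i.castSucc * t i ^ 2 :=
        Finset.sum_congr rfl fun i _ => by ring
      rw [e2, e3]; ring
    · rw [abs_mul, abs_of_nonneg (sq_nonneg s)]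
      exact mul_le_mul_of_nonneg_right hnn (sq_nonneg _)
  have hδ0 : 0 ≤ (n : ℝ) * ξ ^ 2 / g := by positivity
  have hηn : η ≤ n * η := le_mul_of_one_le_left hη hn1
  refine exists_eigenvalues_abs_sub_le hm hT b d _ (fun k x hx => ?_) (fun k x hx => ?_)
  · obtain ⟨A, B, C, h, hA, ⟨hB1, -⟩, hC, hB0⟩ := hform x
    rw [h, sum_inner_sq b, Fin.sum_univ_castSucc]
    set P := ∑ i : Fin n, inner ℝ (b i.castSucc) x ^ 2 with hP
    have hP0 : 0 ≤ P := Finset.sum_nonneg fun i _ => sq_nonneg _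
    set s := inner ℝ (b (Fin.last n)) x
    have hs0 := sq_nonneg s
    have hA' := (abs_le.1 hA).1
    have hB' := (abs_le.1 hB1).1
    have hC' := (abs_le.1 hC).1
    induction k using Fin.lastCases with
    | last =>
      have hsum : (d (Fin.last n) + g) * P ≤
          ∑ i : Fin n, d i.castSucc * inner ℝ (b i.castSucc) x ^ 2 := by
        rw [hP, Finset.mul_sum]
        exact Finset.sum_le_sum fun i _ => mul_le_mul_of_nonneg_right (hgap i) (sq_nonneg _)
      nlinarith [mul_nonneg hδ0 hP0, mul_nonneg hδ0 hs0, mul_le_mul_of_nonneg_right hηn hs0]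
    | cast k =>
      have hs : s = 0 := hx _ (by linarith [hgap k])
      have hsum : d k.castSucc * P ≤
          ∑ i : Fin n, d i.castSucc * inner ℝ (b i.castSucc) x ^ 2 := by
        rw [hP, Finset.mul_sum]
        refine Finset.sum_le_sum fun i _ => ?_
        rcases lt_or_ge (d i.castSucc) (d k.castSucc) with hik | hik
        · simp [hx _ hik]
        · exact mul_le_mul_of_nonneg_right hik (sq_nonneg _)
      rw [hs] at hC' ⊢
      have := hB0 hs
      nlinarith [mul_nonneg hδ0 hP0]
  · obtain ⟨A, B, C, h, hA, ⟨hB2, hB1⟩, hC, hB0⟩ := hform x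
    rw [h, sum_inner_sq b, Fin.sum_univ_castSucc]
    set P := ∑ i : Fin n, inner ℝ (b i.castSucc) x ^ 2 with hP
    have hP0 : 0 ≤ P := Finset.sum_nonneg fun i _ => sq_nonneg _
    set s := inner ℝ (b (Fin.last n)) x
    have hs0 := sq_nonneg s
    have hA' := (abs_le.1 hA).2
    have hB' := (abs_le.1 hB1).2
    have hC' := (abs_le.1 hC).2
    induction k using Fin.lastCases with
    | last =>
      have hz : ∀ i : Fin n, inner ℝ (b i.castSucc) x = 0 := fun i =>
        hx _ (by linarith [hgap i])
      have hPz : P = 0 := by simp [hP, hz]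
      have hsum : ∑ i : Fin n, d i.castSucc * inner ℝ (b i.castSucc) x ^ 2 = 0 := by simp [hz]
      have hB'' := (abs_le.1 hB2).2
      rw [hPz] at hA' hB'' ⊢
      nlinarith [mul_nonneg hδ0 hs0, mul_le_mul_of_nonneg_right hηn hs0]
    | cast k =>
      have hsum : ∑ i : Fin n, d i.castSucc * inner ℝ (b i.castSucc) x ^ 2 ≤
          d k.castSucc * P := by
        rw [hP, Finset.mul_sum]
        refine Finset.sum_le_sum fun i _ => ?_
        rcases lt_or_ge (d k.castSucc) (d i.castSucc) with hik | hik
        · simp [hx _ hik]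
        · exact mul_le_mul_of_nonneg_right hik (sq_nonneg _)
      have hgk := mul_le_mul_of_nonneg_right (hgap k) hs0
      nlinarith [mul_nonneg hδ0 hP0, mul_nonneg hδ0 hs0, mul_le_mul_of_nonneg_right hηn hs0]

end Perturbation

section Eigenvectors

variable {E : Type*} [NormedAddCommGroup E] [InnerProductSpace ℝ E]

lemma eigenvector_coord_eq {m : ℕ} (b : OrthonormalBasis (Fin m) ℝ E) {T : E →ₗ[ℝ] E} {v : E}
    {r : ℝ} (hv : T v = r • v) (j : Fin m) :
    (r - inner ℝ (b j) (T (b j))) * inner ℝ (b j) v =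
      ∑ k ∈ Finset.univ.erase j, inner ℝ (b j) (T (b k)) * inner ℝ (b k) v := by
  have h1 : inner ℝ (b j) (T v) = ∑ k, inner ℝ (b j) (T (b k)) * inner ℝ (b k) v := by
    conv_lhs => rw [← b.sum_repr v]
    simp only [b.repr_apply_apply, map_sum, map_smul, inner_sum, inner_smul_right]
    exact Finset.sum_congr rfl fun k _ => mul_comm _ _
  rw [hv, inner_smul_right, ← Finset.add_sum_erase _ _ (Finset.mem_univ j)] at h1
  linarith

/-- A coordinate of a unit eigenvector is small if the eigenvalue is far from the corresponding
diagonal entry, compared with the other entries of that row. -/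
lemma abs_eigenvector_coord_le {m : ℕ} (b : OrthonormalBasis (Fin m) ℝ E) {T : E →ₗ[ℝ] E} {v : E}
    {r g ξ : ℝ} (hg : 0 < g) (hv : T v = r • v) (j : Fin m)
    (hgap : g ≤ |r - inner ℝ (b j) (T (b j))|)
    (hξ : ∀ k, k ≠ j → |inner ℝ (b j) (T (b k)) * inner ℝ (b k) v| ≤ ξ) (hξ0 : 0 ≤ ξ) :
    |inner ℝ (b j) v| ≤ m * ξ / g := by
  rw [le_div_iff₀ hg]
  calc |inner ℝ (b j) v| * g ≤ |inner ℝ (b j) v| * |r - inner ℝ (b j) (T (b j))| := by gcongr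
    _ = |∑ k ∈ Finset.univ.erase j, inner ℝ (b j) (T (b k)) * inner ℝ (b k) v| := by
        rw [← eigenvector_coord_eq b hv j, abs_mul, mul_comm]
    _ ≤ ∑ k ∈ Finset.univ.erase j, |inner ℝ (b j) (T (b k)) * inner ℝ (b k) v| :=
        Finset.abs_sum_le_sum_abs _ _
    _ ≤ ∑ _k ∈ Finset.univ.erase j, ξ :=
        Finset.sum_le_sum fun k hk => hξ k (Finset.ne_of_mem_erase hk)
    _ ≤ ∑ _k : Fin m, ξ := Finset.sum_le_sum_of_subset_of_nonneg (Finset.erase_subset _ _)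
        fun _ _ _ => hξ0
    _ = m * ξ := by simp

lemma min_norm_sub_add_sq_le {m : ℕ} (b : OrthonormalBasis (Fin m) ℝ E) {v : E} (hv : ‖v‖ = 1)
    (i : Fin m) :
    min ‖v - b i‖ ‖v + b i‖ ^ 2 ≤ 2 * ∑ j ∈ Finset.univ.erase i, inner ℝ (b j) v ^ 2 := by
  have hs := sum_inner_sq b v
  rw [hv, ← Finset.add_sum_erase _ _ (Finset.mem_univ i)] at hs
  have hb : ‖b i‖ = 1 := b.norm_eq_one i
  have h1 : ‖v - b i‖ ^ 2 = 2 - 2 * inner ℝ (b i) v := by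
    rw [norm_sub_sq_real, hv, hb, real_inner_comm]; ring
  have h2 : ‖v + b i‖ ^ 2 = 2 + 2 * inner ℝ (b i) v := by
    rw [norm_add_sq_real, hv, hb, real_inner_comm]; ring
  set c := inner ℝ (b i) v
  set P := ∑ j ∈ Finset.univ.erase i, inner ℝ (b j) v ^ 2
  have hP : 0 ≤ P := Finset.sum_nonneg fun _ _ => sq_nonneg _
  have hc1 : -1 ≤ c ∧ c ≤ 1 := by constructor <;> nlinarith
  rcases le_total 0 c with hc | hc
  · calc min ‖v - b i‖ ‖v + b i‖ ^ 2 ≤ ‖v - b i‖ ^ 2 := by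
          gcongr; exact min_le_left _ _
      _ ≤ _ := by rw [h1]; nlinarith
  · calc min ‖v - b i‖ ‖v + b i‖ ^ 2 ≤ ‖v + b i‖ ^ 2 := by
          gcongr; exact min_le_right _ _
      _ ≤ _ := by rw [h2]; nlinarith

lemma convergesUpToSign_of_coords {m : ℕ} (b : OrthonormalBasis (Fin m) ℝ (Euc m))
    {v : ℝ → Euc m} (hv : ∀ᶠ ε in 𝓝[>] (0 : ℝ), ‖v ε‖ = 1) (i : Fin m)
    (h : ∀ j, j ≠ i → Tendsto (fun ε => inner ℝ (b j) (v ε)) (𝓝[>] 0) (𝓝 0)) :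
    ConvergesUpToSign v (b i) := by
  have h1 : Tendsto (fun ε => 2 * ∑ j ∈ Finset.univ.erase i, inner ℝ (b j) (v ε) ^ 2)
      (𝓝[>] 0) (𝓝 0) := by
    have : Tendsto (fun ε => 2 * ∑ j ∈ Finset.univ.erase i, inner ℝ (b j) (v ε) ^ 2)
        (𝓝[>] 0) (𝓝 (2 * ∑ j ∈ Finset.univ.erase i, (0 : ℝ) ^ 2)) :=
      (tendsto_finsetSum _ fun j hj => (h j (Finset.ne_of_mem_erase hj)).pow 2).const_mul 2
    simpa using this
  have h2 : Tendsto (fun ε => min ‖v ε - b i‖ ‖v ε + b i‖ ^ 2) (𝓝[>] 0) (𝓝 0) := by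
    refine tendsto_of_tendsto_of_tendsto_of_le_of_le' tendsto_const_nhds h1
      (Eventually.of_forall fun ε => sq_nonneg _) ?_
    filter_upwards [hv] with ε hε using min_norm_sub_add_sq_le b hε i
  have h3 := h2.sqrt
  simp only [Real.sqrt_zero] at h3
  refine h3.congr fun ε => ?_
  rw [Real.sqrt_sq (le_min (norm_nonneg _) (norm_nonneg _))]

end Eigenvectors

section Family

variable {n : ℕ}

lemma tendsto_zero_of_abs_le_const_mul {u : ℝ → ℝ} {K : ℝ}
    (h : ∀ᶠ ε in 𝓝[>] (0 : ℝ), |u ε| ≤ K * ε) : Tendsto u (𝓝[>] 0) (𝓝 0) := by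
  refine squeeze_zero_norm' (a := fun ε => K * ε) (by simpa using h) ?_
  have : Tendsto (fun ε : ℝ => K * ε) (𝓝 0) (𝓝 (K * 0)) := by
    exact tendsto_id.const_mul K
  simpa using this.mono_left nhdsWithin_le_nhds

lemma matrix_charpoly_toEuclideanLin {m : ℕ} (A : Matrix (Fin m) (Fin m) ℝ) :
    (Matrix.toEuclideanLin A).charpoly = A.charpoly := by
  rw [← LinearMap.charpoly_toMatrix _ (EuclideanSpace.basisFun (Fin m) ℝ).toBasis]
  congr 1
  rw [Matrix.toEuclideanLin_eq_toLin_orthonormal, LinearMap.toMatrix_toLin]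

/-- Eigenvalue asymptotics of a family of symmetric matrices which in the orthonormal basis `b` have
the diagonal entries `d i ε` up to `O(ε ^ (n + 5))`, mixed entries of order `ε ^ (n + 4)`, other
off-diagonal entries of order `ε ^ (n + 5)`, and whose last diagonal entry is smaller than the
others by a multiple of `ε ^ (n + 2)`. The mixed entries move the eigenvalues only by
`(ε ^ (n + 4)) ^ 2 / ε ^ (n + 2) = ε ^ (n + 6)`. -/
theorem exists_eigenvalue_asymptotics (hn : 1 ≤ n)
    (A : ℝ → Matrix (Fin (n + 1)) (Fin (n + 1)) ℝ) (hA : ∀ ε, (A ε).IsSymm)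
    (b : OrthonormalBasis (Fin (n + 1)) ℝ (Euc (n + 1))) (d : Fin (n + 1) → ℝ → ℝ) {K c : ℝ}
    (hc : 0 < c)
    (htt : ∀ i j : Fin n, ∀ᶠ ε in 𝓝[>] (0 : ℝ),
      |inner ℝ (b i.castSucc) (Matrix.toEuclideanLin (A ε) (b j.castSucc)) -
        if i = j then d i.castSucc ε else 0| ≤ K * ε ^ (n + 5))
    (hnn : ∀ᶠ ε in 𝓝[>] (0 : ℝ),
      |inner ℝ (b (Fin.last n)) (Matrix.toEuclideanLin (A ε) (b (Fin.last n))) -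
        d (Fin.last n) ε| ≤ K * ε ^ (n + 5))
    (htn : ∀ i : Fin n, ∀ᶠ ε in 𝓝[>] (0 : ℝ),
      |inner ℝ (b i.castSucc) (Matrix.toEuclideanLin (A ε) (b (Fin.last n)))| ≤ K * ε ^ (n + 4))
    (hgap : ∀ i : Fin n, ∀ᶠ ε in 𝓝[>] (0 : ℝ),
      d (Fin.last n) ε + c * ε ^ (n + 2) ≤ d i.castSucc ε) :
    ∃ l : Fin (n + 1) → ℝ → ℝ,
      (∀ᶠ ε in 𝓝[>] (0 : ℝ),
        (A ε).charpoly = ∏ i, (Polynomial.X - Polynomial.C (l i ε))) ∧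
      (∃ K', ∀ᶠ ε in 𝓝[>] (0 : ℝ), ∀ i, |l i ε - d i ε| ≤ K' * ε ^ (n + 5)) ∧
      (∀ v : ℝ → Euc (n + 1), IsUnitEigenvectorFamily A (l (Fin.last n)) v →
        ConvergesUpToSign v (b (Fin.last n))) ∧
      (∀ μ : Fin n, (∀ ν, ν ≠ μ → ∃ c' > 0, ∀ᶠ ε in 𝓝[>] (0 : ℝ),
          c' * ε ^ (n + 4) ≤ |d μ.castSucc ε - d ν.castSucc ε|) →
        ∀ v : ℝ → Euc (n + 1), IsUnitEigenvectorFamily A (l μ.castSucc) v →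
          ConvergesUpToSign v (b μ.castSucc)) := by
  have hsymm : ∀ ε, (Matrix.toEuclideanLin (A ε)).IsSymmetric := fun ε =>
    Matrix.isSymmetric_toEuclideanLin_iff.2 (by
      rw [Matrix.IsHermitian, Matrix.conjTranspose_eq_transpose_of_trivial]; exact hA ε)
  have hfin : Module.finrank ℝ (Euc (n + 1)) = n + 1 := by simp
  set δ : ℝ → ℝ := fun ε => n * (K * ε ^ (n + 5)) + n * (K * ε ^ (n + 4)) ^ 2 / (c * ε ^ (n + 2))
  have hex : ∀ ε, ∃ l : Fin (n + 1) → ℝ,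
      (0 < ε → (∀ i j : Fin n,
        |inner ℝ (b i.castSucc) (Matrix.toEuclideanLin (A ε) (b j.castSucc)) -
          if i = j then d i.castSucc ε else 0| ≤ K * ε ^ (n + 5)) →
        (|inner ℝ (b (Fin.last n)) (Matrix.toEuclideanLin (A ε) (b (Fin.last n))) -
          d (Fin.last n) ε| ≤ K * ε ^ (n + 5)) →
        (∀ i : Fin n,
          |inner ℝ (b i.castSucc) (Matrix.toEuclideanLin (A ε) (b (Fin.last n)))| ≤
            K * ε ^ (n + 4)) →
        (∀ i : Fin n, d (Fin.last n) ε + c * ε ^ (n + 2) ≤ d i.castSucc ε) →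
        (A ε).charpoly = ∏ i, (Polynomial.X - Polynomial.C (l i)) ∧
          ∀ k, |l k - d k ε| ≤ δ ε) := by
    intro ε
    by_cases hyp : 0 < ε ∧ (∀ i j : Fin n,
        |inner ℝ (b i.castSucc) (Matrix.toEuclideanLin (A ε) (b j.castSucc)) -
          if i = j then d i.castSucc ε else 0| ≤ K * ε ^ (n + 5)) ∧
        (|inner ℝ (b (Fin.last n)) (Matrix.toEuclideanLin (A ε) (b (Fin.last n))) -
          d (Fin.last n) ε| ≤ K * ε ^ (n + 5)) ∧
        (∀ i : Fin n,
          |inner ℝ (b i.castSucc) (Matrix.toEuclideanLin (A ε) (b (Fin.last n)))| ≤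
            K * ε ^ (n + 4)) ∧
        (∀ i : Fin n, d (Fin.last n) ε + c * ε ^ (n + 2) ≤ d i.castSucc ε)
    · obtain ⟨h0, h1, h2, h3, h4⟩ := hyp
      obtain ⟨l, hl, hl'⟩ := exists_eigenvalues_of_almost_diagonal hn hfin (hsymm ε) b
        (fun i => d i ε) (g := c * ε ^ (n + 2)) (by positivity) h1 h2 h3 h4
      rw [matrix_charpoly_toEuclideanLin] at hl
      exact ⟨l, fun _ _ _ _ _ => ⟨hl, hl'⟩⟩
    · exact ⟨0, fun h0 h1 h2 h3 h4 => (hyp ⟨h0, h1, h2, h3, h4⟩).elim⟩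
  choose l hl using hex
  have hpos : ∀ᶠ ε in 𝓝[>] (0 : ℝ), 0 < ε ∧ ε < 1 := Ioo_mem_nhdsGT one_pos
  have htt' := eventually_all.2 fun i => eventually_all.2 (htt i)
  have htn' := eventually_all.2 htn
  have hgap' := eventually_all.2 hgap
  have hall : ∀ᶠ ε in 𝓝[>] (0 : ℝ),
      (A ε).charpoly = ∏ i, (Polynomial.X - Polynomial.C (l ε i)) ∧
        ∀ k, |l ε k - d k ε| ≤ δ ε := by
    filter_upwards [hpos, htt', hnn, htn', hgap'] with ε h0 h1 h2 h3 h4 using hl ε h0.1 h1 h2 h3 h4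
  set K' : ℝ := n * |K| + n * K ^ 2 / c with hK'
  have hK'0 : 0 ≤ K' := by positivity
  have hKK : K ≤ |K| := le_abs_self K
  have hl' : ∀ᶠ ε in 𝓝[>] (0 : ℝ), ∀ i, |l ε i - d i ε| ≤ K' * ε ^ (n + 5) := by
    filter_upwards [hall, hpos] with ε h h0 i
    refine (h.2 i).trans ?_
    have h0' := h0.1
    have e1 : n * (K * ε ^ (n + 4)) ^ 2 / (c * ε ^ (n + 2)) = n * K ^ 2 / c * ε ^ (n + 6) := by
      field_simp
      ring
    have e2 : ε ^ (n + 6) ≤ ε ^ (n + 5) := pow_le_pow_of_le_one h0'.le h0.2.le (by lia)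
    have e3 : n * (K * ε ^ (n + 5)) ≤ n * |K| * ε ^ (n + 5) := by
      rw [mul_assoc]; gcongr
    simp only [δ]
    rw [e1, hK', add_mul]
    gcongr
  have hK0 : 0 ≤ |K| := abs_nonneg K
  -- A gap of order `ε ^ (n + 4)` dominates the errors of the eigenvalue and of a diagonal entry.
  have hsmall : ∀ c' > 0, ∃ r > 0, ∀ ε, 0 < ε → ε < r →
      K' * ε ^ (n + 5) + |K| * ε ^ (n + 5) ≤ c' / 2 * ε ^ (n + 4) := by
    intro c' hc'
    refine ⟨c' / (2 * (K' + |K| + 1)), by positivity, fun ε h0 h1 => ?_⟩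
    rw [lt_div_iff₀ (by positivity)] at h1
    have : ε ^ (n + 5) = ε ^ (n + 4) * ε := by ring
    rw [this]
    have hp : 0 < ε ^ (n + 4) := by positivity
    nlinarith
  refine ⟨fun i ε => l ε i, hall.mono fun ε h => h.1, ⟨K', hl'⟩, fun v hv => ?_,
    fun μ hμ v hv => ?_⟩
  · refine convergesUpToSign_of_coords b (hv.mono fun ε h => h.1) _ fun j hj => ?_
    induction j using Fin.lastCases with
    | last => exact absurd rfl hj
    | cast j =>
    obtain ⟨r, hr, hr'⟩ := hsmall c hc
    refine tendsto_zero_of_abs_le_const_mul (K := (n + 1 : ℕ) * |K| / (c / 2)) ?_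
    filter_upwards [hpos, Ioo_mem_nhdsGT hr, hv, hl', htt', htn', hgap'] with
      ε h0 h0' hv hl htt htn hgap
    have hε := h0.1
    have hp2 : ε ^ (n + 4) ≤ ε ^ (n + 2) := pow_le_pow_of_le_one hε.le h0.2.le (by lia)
    have hp4 : ε ^ (n + 5) ≤ ε ^ (n + 4) := pow_le_pow_of_le_one hε.le h0.2.le (by lia)
    have hp3 : ε ^ (n + 4) ≤ ε ^ (n + 3) := pow_le_pow_of_le_one hε.le h0.2.le (by lia)
    have hs := hr' ε h0'.1 h0'.2
    have hj1 := abs_le.1 (htt j j)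
    rw [if_pos rfl] at hj1
    have hKe : K * ε ^ (n + 5) ≤ |K| * ε ^ (n + 5) := by gcongr
    have hl1 := abs_le.1 (hl (Fin.last n))
    have hcoef : ∀ k, k ≠ j.castSucc →
        |inner ℝ (b j.castSucc) (Matrix.toEuclideanLin (A ε) (b k))| ≤ |K| * ε ^ (n + 3) := by
      intro k hk
      induction k using Fin.lastCases with
      | last => calc _ ≤ _ := htn j
                  _ ≤ |K| * ε ^ (n + 3) := by gcongr
      | cast k =>
        have hne : j ≠ k := fun h => hk (by rw [h])
        have := htt j k
        rw [if_neg hne, sub_zero] at this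
        calc _ ≤ _ := this
          _ ≤ |K| * ε ^ (n + 3) := by
            have := hp4.trans hp3
            gcongr
    have := abs_eigenvector_coord_le b (g := c / 2 * ε ^ (n + 2)) (ξ := |K| * ε ^ (n + 3))
      (by positivity) hv.2 j.castSucc ?_ ?_ (by positivity)
    · refine this.trans_eq ?_
      field_simp
      ring
    · rw [abs_sub_comm]
      refine le_trans ?_ (le_abs_self _)
      have hg := hgap j
      have : c / 2 * ε ^ (n + 4) ≤ c / 2 * ε ^ (n + 2) := by gcongr
      linarith [hl1.2, hj1.1]
    · intro k hk
      rw [abs_mul]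
      have hle : |inner ℝ (b k) (v ε)| ≤ 1 := by
        have := abs_real_inner_le_norm (b k) (v ε)
        rwa [b.norm_eq_one, hv.1, one_mul] at this
      calc _ ≤ (|K| * ε ^ (n + 3)) * 1 :=
            mul_le_mul (hcoef k hk) hle (abs_nonneg _) (by positivity)
        _ = _ := mul_one _
  · have hunit : ∀ᶠ ε in 𝓝[>] (0 : ℝ), ‖v ε‖ = 1 := hv.mono fun ε h => h.1
    have hle1 : ∀ᶠ ε in 𝓝[>] (0 : ℝ), ∀ k, |inner ℝ (b k) (v ε)| ≤ 1 := by
      filter_upwards [hunit] with ε hε k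
      have := abs_real_inner_le_norm (b k) (v ε)
      rwa [b.norm_eq_one, hε, one_mul] at this
    -- The last coordinate is of order `ε ^ 2`, so in the row of a tangential direction the mixed
    -- entry contributes only `ε ^ (n + 4) * ε ^ 2`, which is below the gap `ε ^ (n + 4)`.
    have hlast : ∀ᶠ ε in 𝓝[>] (0 : ℝ),
        |inner ℝ (b (Fin.last n)) (v ε)| ≤ (n + 1 : ℕ) * |K| / (c / 2) * ε ^ 2 := by
      obtain ⟨r, hr, hr'⟩ := hsmall c hc
      filter_upwards [hpos, Ioo_mem_nhdsGT hr, hv, hl', hnn, htn', hgap', hle1] with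
        ε h0 h0' hv hl hnn htn hgap hle
      have hε := h0.1
      have hp2 : ε ^ (n + 4) ≤ ε ^ (n + 2) := pow_le_pow_of_le_one hε.le h0.2.le (by lia)
      have hs := hr' ε h0'.1 h0'.2
      have hj1 := abs_le.1 hnn
      have hKe : K * ε ^ (n + 5) ≤ |K| * ε ^ (n + 5) := by gcongr
      have hl1 := abs_le.1 (hl μ.castSucc)
      have := abs_eigenvector_coord_le b (g := c / 2 * ε ^ (n + 2)) (ξ := |K| * ε ^ (n + 4))
        (by positivity) hv.2 (Fin.last n) ?_ ?_ (by positivity)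
      · refine this.trans_eq ?_
        field_simp
        ring
      · refine le_trans ?_ (le_abs_self _)
        have hg := hgap μ
        have : c / 2 * ε ^ (n + 4) ≤ c / 2 * ε ^ (n + 2) := by gcongr
        linarith [hl1.1, hj1.2]
      · intro k hk
        induction k using Fin.lastCases with
        | last => exact absurd rfl hk
        | cast k =>
        rw [abs_mul, ← hsymm ε, real_inner_comm]
        calc _ ≤ (|K| * ε ^ (n + 4)) * 1 := by
              refine mul_le_mul ((htn k).trans ?_) (hle _) (abs_nonneg _) (by positivity)
              gcongr
          _ = _ := mul_one _
    refine convergesUpToSign_of_coords b hunit _ fun j hj => ?_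
    induction j using Fin.lastCases with
    | last =>
      refine tendsto_zero_of_abs_le_const_mul (K := (n + 1 : ℕ) * |K| / (c / 2)) ?_
      filter_upwards [hlast, hpos] with ε h h0
      refine h.trans ?_
      have : ε ^ 2 ≤ ε := by nlinarith [h0.1, h0.2]
      gcongr
    | cast j =>
      have hjμ : j ≠ μ := fun h => hj (by rw [h])
      obtain ⟨c', hc', hc''⟩ := hμ j hjμ
      obtain ⟨r, hr, hr'⟩ := hsmall c' hc'
      set L : ℝ := (n + 1 : ℕ) * |K| / (c / 2) with hL
      have hL0 : 0 ≤ L := by positivity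
      refine tendsto_zero_of_abs_le_const_mul
        (K := (n + 1 : ℕ) * (|K| + |K| * L) / (c' / 2)) ?_
      filter_upwards [hpos, Ioo_mem_nhdsGT hr, hv, hl', htt', htn', hc'', hle1, hlast] with
        ε h0 h0' hv hl htt htn hc'' hle hlast
      have hε := h0.1
      have hp6 : ε ^ (n + 6) ≤ ε ^ (n + 5) := pow_le_pow_of_le_one hε.le h0.2.le (by lia)
      have hs := hr' ε h0'.1 h0'.2
      have hj1 := htt j j
      rw [if_pos rfl] at hj1
      have hKe : K * ε ^ (n + 5) ≤ |K| * ε ^ (n + 5) := by gcongr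
      have := abs_eigenvector_coord_le b (g := c' / 2 * ε ^ (n + 4))
        (ξ := (|K| + |K| * L) * ε ^ (n + 5)) (by positivity) hv.2 j.castSucc ?_ ?_ (by positivity)
      · refine this.trans_eq ?_
        field_simp
        ring
      · set x := inner ℝ (b j.castSucc) (Matrix.toEuclideanLin (A ε) (b j.castSucc))
        have h3 := hl μ.castSucc
        have h4 : |d μ.castSucc ε - d j.castSucc ε| ≤
            |l ε μ.castSucc - x| + |l ε μ.castSucc - d μ.castSucc ε| + |x - d j.castSucc ε| := by
          have := abs_sub_le (d μ.castSucc ε) (l ε μ.castSucc) (d j.castSucc ε)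
          have h5 := abs_sub_le (l ε μ.castSucc) x (d j.castSucc ε)
          rw [abs_sub_comm _ (l ε μ.castSucc)] at this
          linarith
        linarith
      · intro k hk
        rw [abs_mul]
        induction k using Fin.lastCases with
        | last =>
          calc _ ≤ (|K| * ε ^ (n + 4)) * (L * ε ^ 2) := by
                refine mul_le_mul ((htn j).trans ?_) hlast (abs_nonneg _) (by positivity)
                gcongr
            _ = |K| * L * ε ^ (n + 6) := by ring
            _ ≤ |K| * L * ε ^ (n + 5) := by gcongr
            _ ≤ _ := by
              have : 0 ≤ |K| * ε ^ (n + 5) := by positivity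
              nlinarith
        | cast k =>
          have hne : j ≠ k := fun h => hk (by rw [h])
          have := htt j k
          rw [if_neg hne, sub_zero] at this
          calc _ ≤ (|K| * ε ^ (n + 5)) * 1 := by
                exact mul_le_mul (this.trans hKe) (hle _) (abs_nonneg _) (by positivity)
            _ ≤ _ := by
              have : 0 ≤ |K| * L * ε ^ (n + 5) := by positivity
              nlinarith

end Family

/-! ### Polar coordinates and moments of the unit sphere -/

section Sphere

open Set Metric

variable {n : ℕ}

/-- The surface measure of the unit sphere of `ℝⁿ`. -/
abbrev sphereMeasure (n : ℕ) : Measure (sphere (0 : Euc n) 1) := (volume : Measure (Euc n)).toSphere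

/-- The integral of a function on `ℝⁿ` over the unit sphere. -/
def sphereIntegral (g : Euc n → ℝ) : ℝ := ∫ θ : sphere (0 : Euc n) 1, g θ ∂(sphereMeasure n)

lemma integral_volumeIoiPow (k : ℕ) (g : ℝ → ℝ) :
    ∫ r : Ioi (0 : ℝ), g r ∂(Measure.volumeIoiPow k) = ∫ r in Ioi (0 : ℝ), r ^ k * g r := by
  simp only [Measure.volumeIoiPow, ENNReal.ofReal]
  rw [integral_withDensity_eq_integral_smul,
    integral_subtype_comap measurableSet_Ioi fun a ↦ Real.toNNReal (a ^ k) • g a,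
    setIntegral_congr_fun measurableSet_Ioi fun x hx ↦ ?_]
  · rw [NNReal.smul_def, Real.coe_toNNReal _ (pow_nonneg hx.out.le _), smul_eq_mul]
  · exact (measurable_subtype_coe.pow_const _).real_toNNReal

/-- Integration in polar coordinates. -/
theorem integral_polar (hn : 1 ≤ n) {F : Euc n → ℝ} (hF : Integrable F) :
    Integrable (fun θ : sphere (0 : Euc n) 1 =>
      ∫ r in Ioi (0 : ℝ), r ^ (n - 1) * F (r • (θ : Euc n))) (sphereMeasure n) ∧
    ∫ x, F x = ∫ θ : sphere (0 : Euc n) 1,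
      (∫ r in Ioi (0 : ℝ), r ^ (n - 1) * F (r • (θ : Euc n))) ∂(sphereMeasure n) := by
  have hnt : Nonempty (Fin n) := ⟨⟨0, hn⟩⟩
  have hmp := (volume : Measure (Euc n)).measurePreserving_homeomorphUnitSphereProd
  have hemb := (homeomorphUnitSphereProd (Euc n)).measurableEmbedding
  rw [show Module.finrank ℝ (Euc n) = n by simp] at hmp
  set G : sphere (0 : Euc n) 1 × Ioi (0 : ℝ) → ℝ := fun q => F ((q.2 : ℝ) • (q.1 : Euc n)) with hG
  have hGF : ∀ x : ({0}ᶜ : Set (Euc n)), G (homeomorphUnitSphereProd (Euc n) x) = F x := by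
    intro x
    have : (((homeomorphUnitSphereProd (Euc n)).symm
      (homeomorphUnitSphereProd (Euc n) x) : ({0}ᶜ : Set (Euc n))) : Euc n) = x := by simp
    rw [homeomorphUnitSphereProd_symm_apply_coe] at this
    simp only [hG]; rw [this]
  have hGi : Integrable G ((sphereMeasure n).prod (Measure.volumeIoiPow (n - 1))) := by
    rw [← hmp.integrable_comp_emb hemb]
    have h1 : IntegrableOn F ({0}ᶜ : Set (Euc n)) := hF.integrableOn
    rw [integrableOn_iff_comap_subtypeVal (measurableSet_singleton _).compl] at h1
    refine h1.congr (Eventually.of_forall fun x => ?_)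
    exact (hGF x).symm
  have hin : ∀ θ : sphere (0 : Euc n) 1, ∫ r : Ioi (0 : ℝ), G (θ, r) ∂(Measure.volumeIoiPow (n - 1))
      = ∫ r in Ioi (0 : ℝ), r ^ (n - 1) * F (r • (θ : Euc n)) := fun θ =>
    integral_volumeIoiPow (n - 1) fun r => F (r • (θ : Euc n))
  constructor
  · refine hGi.integral_prod_left.congr (Eventually.of_forall fun θ => hin θ)
  · calc ∫ x, F x = ∫ x : ({0}ᶜ : Set (Euc n)), F x ∂((volume : Measure (Euc n)).comap (↑)) := by
          rw [integral_subtype_comap (measurableSet_singleton _).compl F,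
            restrict_compl_singleton]
      _ = ∫ q, G q ∂((sphereMeasure n).prod (Measure.volumeIoiPow (n - 1))) := by
          rw [← hmp.integral_comp hemb]
          exact integral_congr_ae (Eventually.of_forall fun x => (hGF x).symm)
      _ = _ := by
          rw [integral_prod _ hGi]
          exact integral_congr_ae (Eventually.of_forall fun θ => hin θ)

/-- The half-line Gaussian moment `∫₀^∞ r^k e^{-r²} dr`. -/
def halfGaussianMoment (k : ℕ) : ℝ := ∫ r in Ioi (0 : ℝ), r ^ k * Real.exp (-r ^ 2)

lemma halfGaussianMoment_eq (k : ℕ) :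
    halfGaussianMoment k = 1 / 2 * Real.Gamma (((k : ℝ) + 1) / 2) := by
  rw [← integral_rpow_mul_exp_neg_rpow (p := 2) (q := k) (by norm_num)
    (by have : (0 : ℝ) ≤ k := by positivity
        linarith)]
  simp [halfGaussianMoment]

lemma halfGaussianMoment_pos (k : ℕ) : 0 < halfGaussianMoment k := by
  rw [halfGaussianMoment_eq]
  have := Real.Gamma_pos_of_pos (show 0 < ((k : ℝ) + 1) / 2 by positivity)
  positivity

lemma halfGaussianMoment_add_two (k : ℕ) :
    halfGaussianMoment (k + 2) = ((k : ℝ) + 1) / 2 * halfGaussianMoment k := by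
  rw [halfGaussianMoment_eq, halfGaussianMoment_eq,
    show (((k + 2 : ℕ) : ℝ) + 1) / 2 = ((k : ℝ) + 1) / 2 + 1 by push_cast; ring,
    Real.Gamma_add_one (by positivity)]
  ring

/-- The Gaussian moment `∫ t^k e^{-t²} dt` of the real line. -/
def gaussianMoment (k : ℕ) : ℝ := ∫ t : ℝ, t ^ k * Real.exp (-t ^ 2)

lemma integrable_pow_mul_exp_neg_sq (k : ℕ) :
    Integrable fun t : ℝ => t ^ k * Real.exp (-t ^ 2) := by
  have := integrable_rpow_mul_exp_neg_mul_sq (b := 1) one_pos (s := k)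
    (by have : (0 : ℝ) ≤ k := by positivity
        linarith)
  simpa using this

lemma gaussianMoment_odd {k : ℕ} (hk : Odd k) : gaussianMoment k = 0 := by
  have h := integral_neg_eq_self (fun t : ℝ => t ^ k * Real.exp (-t ^ 2)) volume
  simp only [hk.neg_pow, even_two.neg_pow, neg_mul, integral_neg] at h
  simp only [gaussianMoment]
  linarith

lemma gaussianMoment_even (k : ℕ) : gaussianMoment (2 * k) = 2 * halfGaussianMoment (2 * k) := by
  have := integral_comp_abs (f := fun t : ℝ => t ^ (2 * k) * Real.exp (-t ^ 2))
  simp only [sq_abs, (even_two_mul k).pow_abs] at this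
  exact this

/-- The moments of the sphere, by comparing the Gaussian moments of `ℝⁿ` in Cartesian and in polar
coordinates. -/
theorem sphereIntegral_monomial (hn : 1 ≤ n) (α : Fin n → ℕ) :
    sphereIntegral (fun x => ∏ m, x m ^ α m) * halfGaussianMoment (n - 1 + ∑ m, α m) =
      ∏ m, gaussianMoment (α m) := by
  set F : Euc n → ℝ := fun x => ∏ m, (x m ^ α m * Real.exp (-x m ^ 2)) with hF
  have hmp := PiLp.volume_preserving_ofLp (Fin n)
  have hemb : MeasurableEmbedding (@WithLp.ofLp 2 (Fin n → ℝ)) :=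
    (MeasurableEquiv.toLp 2 (Fin n → ℝ)).symm.measurableEmbedding
  have hFi : Integrable F := by
    have : Integrable (fun y : Fin n → ℝ => ∏ m, (y m ^ α m * Real.exp (-y m ^ 2))) :=
      Integrable.fintype_prod fun m => integrable_pow_mul_exp_neg_sq (α m)
    exact (hmp.integrable_comp_emb hemb).2 this
  have hFint : ∫ x, F x = ∏ m, gaussianMoment (α m) := by
    have h1 := hmp.integral_comp hemb
      (fun y : Fin n → ℝ => ∏ m, (y m ^ α m * Real.exp (-y m ^ 2)))
    have h2 := integral_fintype_prod_volume_eq_prod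
      (fun (m : Fin n) (t : ℝ) => t ^ α m * Real.exp (-t ^ 2))
    exact h1.trans h2
  rw [← hFint, (integral_polar hn hFi).2, sphereIntegral, ← integral_mul_const]
  refine integral_congr_ae (Eventually.of_forall fun θ => ?_)
  have hθ : ∑ m, (θ : Euc n) m ^ 2 = 1 := by
    have h := EuclideanSpace.norm_sq_eq (θ : Euc n)
    rw [norm_eq_of_mem_sphere θ] at h
    simpa using h.symm
  simp only [halfGaussianMoment]
  rw [← integral_const_mul]
  refine setIntegral_congr_fun measurableSet_Ioi fun r _ => ?_
  simp only [hF, PiLp.smul_apply, smul_eq_mul, mul_pow, Finset.prod_mul_distrib, ← Real.exp_sum,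
    Finset.prod_pow_eq_pow_sum, Finset.sum_neg_distrib, ← Finset.mul_sum, hθ, pow_add]
  ring_nf

end Sphere

section Moments

open Set Metric

variable {n : ℕ}

/-- The volume of the unit ball of `ℝⁿ`. -/
def unitBallVolume (n : ℕ) : ℝ := (volume (ball (0 : Euc n) 1)).toReal

lemma unitBallVolume_pos (n : ℕ) : 0 < unitBallVolume n :=
  ENNReal.toReal_pos (measure_ball_pos _ _ one_pos).ne' measure_ball_lt_top.ne

lemma ballVolume_eq {ε : ℝ} (hε : 0 < ε) : ballVolume n ε = unitBallVolume n * ε ^ n := by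
  rw [ballVolume, unitBallVolume, Measure.addHaar_ball_of_pos _ _ hε, ENNReal.toReal_mul,
    ENNReal.toReal_ofReal (by positivity), mul_comm]
  simp

lemma integrable_sphere {g : Euc n → ℝ} (hg : Continuous g) :
    Integrable (fun θ : sphere (0 : Euc n) 1 => g θ) (sphereMeasure n) :=
  (hg.comp continuous_subtype_val).integrable_of_hasCompactSupport
    (HasCompactSupport.of_compactSpace _)

lemma sphereIntegral_const_mul (c : ℝ) (g : Euc n → ℝ) :
    sphereIntegral (fun x => c * g x) = c * sphereIntegral g :=
  integral_const_mul _ _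

lemma sphereIntegral_sum {ι : Type*} (s : Finset ι) {g : ι → Euc n → ℝ}
    (hg : ∀ i, Continuous (g i)) :
    sphereIntegral (fun x => ∑ i ∈ s, g i x) = ∑ i ∈ s, sphereIntegral (g i) :=
  integral_finsetSum _ fun i _ => integrable_sphere (hg i)

lemma sphereIntegral_one : sphereIntegral (fun _ : Euc n => 1) = n * unitBallVolume n := by
  have := (volume : Measure (Euc n)).toSphere_real_apply_univ
  rw [sphereIntegral, integral_const, this]
  simp [unitBallVolume, Measure.real]

/-- The odd factorial `(2k - 1)!! = 1 · 3 ⋯ (2k - 1)`, the moment of order `2k` of a standard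
normal variable. -/
def oddFactorial : ℕ → ℝ
  | 0 => 1
  | k + 1 => (2 * k + 1) * oddFactorial k

lemma gaussianMoment_two_mul (k : ℕ) :
    gaussianMoment (2 * k) = oddFactorial k / 2 ^ k * gaussianMoment 0 := by
  induction k with
  | zero => simp [oddFactorial]
  | succ k ih =>
    rw [gaussianMoment_even] at ih ⊢
    rw [show 2 * (k + 1) = 2 * k + 2 by ring, halfGaussianMoment_add_two, oddFactorial, pow_succ]
    push_cast
    have : oddFactorial k / 2 ^ k * gaussianMoment 0 = 2 * halfGaussianMoment (2 * k) := ih.symm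
    calc _ = ((2 * k + 1) / 2) * (2 * halfGaussianMoment (2 * k)) := by ring
      _ = _ := by rw [ih]; ring

lemma halfGaussianMoment_add (hn : 1 ≤ n) (s : ℕ) :
    halfGaussianMoment (n - 1 + 2 * s) =
      (∏ j ∈ Finset.range s, ((n : ℝ) + 2 * j)) / 2 ^ s * halfGaussianMoment (n - 1) := by
  induction s with
  | zero => simp
  | succ s ih =>
    rw [show n - 1 + 2 * (s + 1) = n - 1 + 2 * s + 2 by ring, halfGaussianMoment_add_two, ih,
      Finset.prod_range_succ, pow_succ]
    push_cast [Nat.cast_sub hn]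
    ring

/-- The even moments of the sphere; the product on the left is the quotient of the radial Gaussian
moments, up to a power of `2`. -/
lemma sphereIntegral_even_monomial (hn : 1 ≤ n) (β : Fin n → ℕ) :
    sphereIntegral (fun x => ∏ m, x m ^ (2 * β m)) *
      ∏ j ∈ Finset.range (∑ m, β m), ((n : ℝ) + 2 * j) =
      n * unitBallVolume n * ∏ m, oddFactorial (β m) := by
  have h0 := sphereIntegral_monomial hn (fun _ : Fin n => 0)
  simp only [pow_zero, Finset.prod_const_one, Finset.sum_const_zero, add_zero,
    sphereIntegral_one, Finset.prod_const, Finset.card_univ, Fintype.card_fin] at h0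
  have h := sphereIntegral_monomial hn (fun m => 2 * β m)
  rw [← Finset.mul_sum, halfGaussianMoment_add hn] at h
  simp only [gaussianMoment_two_mul, Finset.prod_mul_distrib, Finset.prod_const, Finset.card_univ,
    Fintype.card_fin, Finset.prod_div_distrib, Finset.prod_pow_eq_pow_sum, ← h0] at h
  have hA := halfGaussianMoment_pos (n - 1)
  have h2 : (0 : ℝ) < 2 ^ ∑ m, β m := by positivity
  field_simp at h
  linear_combination h

lemma sphereIntegral_odd_monomial (hn : 1 ≤ n) (α : Fin n → ℕ) {m : Fin n} (hm : Odd (α m)) :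
    sphereIntegral (fun x => ∏ m, x m ^ α m) = 0 := by
  have h := sphereIntegral_monomial hn α
  rw [Finset.prod_eq_zero (Finset.mem_univ m) (gaussianMoment_odd hm)] at h
  exact (mul_eq_zero.1 h).resolve_right (halfGaussianMoment_pos _).ne'

lemma prod_pow_single (x : Euc n) (i : Fin n) (a : ℕ) :
    ∏ m, x m ^ (Pi.single i a : Fin n → ℕ) m = x i ^ a := by
  rw [Fintype.prod_eq_single i fun m hm => by simp [Pi.single_eq_of_ne hm]]
  simp

lemma sphereIntegral_coord (hn : 1 ≤ n) (i : Fin n) :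
    sphereIntegral (fun x : Euc n => x i) = 0 := by
  have := sphereIntegral_odd_monomial hn (Pi.single i 1) (m := i) (by simp)
  simpa [prod_pow_single] using this

lemma sphereIntegral_coord_mul_sq (hn : 1 ≤ n) (i k : Fin n) :
    sphereIntegral (fun x : Euc n => x i * x k ^ 2) = 0 := by
  have := sphereIntegral_odd_monomial hn (Pi.single i 1 + Pi.single k 2) (m := i) (by
    by_cases h : i = k
    · subst h; simp; decide
    · simp [Pi.single_eq_of_ne h])
  simpa [prod_pow_single, pow_add, Finset.prod_mul_distrib] using this

lemma sphereIntegral_sq (hn : 1 ≤ n) (i : Fin n) :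
    sphereIntegral (fun x : Euc n => x i ^ 2) = unitBallVolume n := by
  have h := sphereIntegral_even_monomial hn (Pi.single i 1)
  have hn0 : (n : ℝ) ≠ 0 := by positivity
  have e1 : ∏ m, oddFactorial ((Pi.single i 1 : Fin n → ℕ) m) = 1 := by
    refine Finset.prod_eq_one fun m _ => ?_
    by_cases h : m = i <;> simp [h, oddFactorial]
  simp only [e1, mul_comm 2, pow_mul, Finset.prod_pow, prod_pow_single] at h
  refine mul_left_cancel₀ hn0 ?_
  simpa [mul_comm] using h

lemma sphereIntegral_sq_mul_sq (hn : 1 ≤ n) (i k : Fin n) :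
    sphereIntegral (fun x : Euc n => x i ^ 2 * x k ^ 2) =
      unitBallVolume n * (1 + if i = k then 2 else 0) / (n + 2) := by
  have h := sphereIntegral_even_monomial hn (Pi.single i 1 + Pi.single k 1)
  have hn0 : (n : ℝ) ≠ 0 := by positivity
  have e1 : ∏ m, oddFactorial ((Pi.single i 1 + Pi.single k 1 : Fin n → ℕ) m) =
      1 + if i = k then 2 else 0 := by
    by_cases hik : i = k
    · subst hik
      rw [Fintype.prod_eq_single i fun m hm => by simp [Pi.single_eq_of_ne hm, oddFactorial]]
      simp [oddFactorial]; norm_num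
    · rw [if_neg hik, add_zero]
      refine Finset.prod_eq_one fun m _ => ?_
      by_cases h1 : m = i
      · subst h1; simp [Pi.single_eq_of_ne hik, oddFactorial]
      · by_cases h2 : m = k <;> simp [Pi.single_apply, h1, h2, oddFactorial]
        subst h2; simp [h1, oddFactorial]
  have e2 : ∑ m, (Pi.single i 1 + Pi.single k 1 : Fin n → ℕ) m = 2 := by
    simp [Finset.sum_add_distrib]
  rw [e1, e2] at h
  simp only [mul_comm 2, pow_mul, Finset.prod_pow, Pi.add_apply, pow_add, Finset.prod_mul_distrib,
    prod_pow_single, pow_one, mul_pow, Finset.prod_range_succ, Finset.prod_range_zero] at h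
  push_cast at h
  rw [eq_div_iff (by positivity)]
  refine mul_left_cancel₀ hn0 ?_
  linear_combination h

lemma sphereIntegral_sq_mul_sq_mul_sq (hn : 1 ≤ n) (i k l : Fin n) :
    sphereIntegral (fun x : Euc n => x i ^ 2 * x k ^ 2 * x l ^ 2) =
      unitBallVolume n * (1 + (if i = k then 2 else 0) + (if i = l then 2 else 0) +
        (if k = l then 2 else 0) + if i = k then if k = l then 8 else 0 else 0) /
        ((n + 2) * (n + 4)) := by
  have h := sphereIntegral_even_monomial hn (Pi.single i 1 + Pi.single k 1 + Pi.single l 1)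
  have hn0 : (n : ℝ) ≠ 0 := by positivity
  have e1 : ∏ m, oddFactorial ((Pi.single i 1 + Pi.single k 1 + Pi.single l 1 : Fin n → ℕ) m) =
      1 + (if i = k then 2 else 0) + (if i = l then 2 else 0) +
        (if k = l then 2 else 0) + if i = k then if k = l then 8 else 0 else 0 := by
    -- the factor of an index depends on how often it occurs among `i`, `k`, `l`
    have hval : ∀ m, oddFactorial ((Pi.single i 1 + Pi.single k 1 + Pi.single l 1 : Fin n → ℕ) m) =
        if m = i then oddFactorial (1 + (if i = k then 1 else 0) + if i = l then 1 else 0)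
        else if m = k then oddFactorial (1 + if k = l then 1 else 0)
        else 1 := by
      intro m
      simp only [Pi.add_apply, Pi.single_apply]
      by_cases h1 : m = i
      · subst h1; simp
      · by_cases h2 : m = k
        · subst h2; simp [h1]
        · rcases eq_or_ne m l with rfl | h3
          · simp [h1, h2, oddFactorial]
          · simp [h1, h2, h3, oddFactorial]
    simp only [hval]
    by_cases hik : i = k
    · subst hik
      rw [Fintype.prod_eq_single i fun m hm => by simp [hm]]
      by_cases hil : i = l <;> simp [hil, oddFactorial] <;> norm_num
    · rw [Fintype.prod_eq_mul i k hik fun m hm => by simp [hm.1, hm.2]]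
      by_cases hil : i = l
      · subst hil
        simp [hik, Ne.symm hik, oddFactorial]; norm_num
      · rcases eq_or_ne k l with rfl | hkl
        · simp [hik, Ne.symm hik, oddFactorial]; norm_num
        · simp [hik, Ne.symm hik, hil, hkl, oddFactorial]
  have e2 : ∑ m, (Pi.single i 1 + Pi.single k 1 + Pi.single l 1 : Fin n → ℕ) m = 3 := by
    simp [Finset.sum_add_distrib]
  rw [e1, e2] at h
  simp only [mul_comm 2, pow_mul, Finset.prod_pow, Pi.add_apply, pow_add, Finset.prod_mul_distrib,
    prod_pow_single, pow_one, mul_pow, Finset.prod_range_succ, Finset.prod_range_zero] at h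
  push_cast at h
  rw [eq_div_iff (by positivity)]
  refine mul_left_cancel₀ hn0 ?_
  linear_combination h

lemma sphereIntegral_coord_mul_coord_of_ne (hn : 1 ≤ n) {i j : Fin n} (hij : i ≠ j) :
    sphereIntegral (fun x : Euc n => x i * x j) = 0 := by
  have := sphereIntegral_odd_monomial hn (Pi.single i 1 + Pi.single j 1) (m := i) (by
    simp [Pi.single_eq_of_ne hij])
  simpa [prod_pow_single, pow_add, Finset.prod_mul_distrib] using this

lemma sphereIntegral_coord_mul_coord_mul_sq_of_ne (hn : 1 ≤ n) {i j : Fin n} (hij : i ≠ j)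
    (k : Fin n) : sphereIntegral (fun x : Euc n => x i * x j * x k ^ 2) = 0 := by
  have := sphereIntegral_odd_monomial hn (Pi.single i 1 + Pi.single j 1 + Pi.single k 2)
    (m := i) (by
    simp only [Pi.add_apply, Pi.single_apply, hij, if_true, if_false]
    split_ifs <;> decide)
  simpa [prod_pow_single, pow_add, Finset.prod_mul_distrib] using this

lemma sphereIntegral_coord_mul_coord_mul_sq_mul_sq_of_ne (hn : 1 ≤ n) {i j : Fin n} (hij : i ≠ j)
    (k l : Fin n) : sphereIntegral (fun x : Euc n => x i * x j * x k ^ 2 * x l ^ 2) = 0 := by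
  have := sphereIntegral_odd_monomial hn
    (Pi.single i 1 + Pi.single j 1 + Pi.single k 2 + Pi.single l 2) (m := i) (by
    simp only [Pi.add_apply, Pi.single_apply, hij, if_true, if_false]
    split_ifs <;> decide)
  simpa [prod_pow_single, pow_add, Finset.prod_mul_distrib] using this

end Moments

section QuadraticMoments

open Set Metric

variable {n : ℕ}

/-- The quadratic function `½ ∑ κ_k x_k²`, the second order Taylor polynomial of a hypersurface with
principal curvatures `κ` as a graph over its tangent space. -/
def osculatingQuadric (κ : Fin n → ℝ) (x : Euc n) : ℝ := (∑ k, κ k * x k ^ 2) / 2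

lemma continuous_osculatingQuadric (κ : Fin n → ℝ) : Continuous (osculatingQuadric κ) := by
  unfold osculatingQuadric; fun_prop

lemma osculatingQuadric_smul (κ : Fin n → ℝ) (r : ℝ) (x : Euc n) :
    osculatingQuadric κ (r • x) = r ^ 2 * osculatingQuadric κ x := by
  simp only [osculatingQuadric, PiLp.smul_apply, smul_eq_mul, mul_pow, mul_div_assoc',
    Finset.mul_sum]
  congr 1; exact Finset.sum_congr rfl fun k _ => by ring

lemma scalarCurvature_eq (κ : Fin n → ℝ) :
    scalarCurvature κ = meanCurvature κ ^ 2 - ∑ k, κ k ^ 2 := by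
  have h1 : ∀ μ : Fin n, ∑ ν, κ μ * κ ν =
      ∑ ν ∈ Finset.Iio μ, κ μ * κ ν + κ μ ^ 2 + ∑ ν ∈ Finset.Ioi μ, κ μ * κ ν := by
    intro μ
    rw [← Finset.sum_filter_add_sum_filter_not Finset.univ (fun ν => μ < ν),
      ← Finset.sum_filter_add_sum_filter_not (Finset.univ.filter fun ν => ¬ μ < ν) (fun ν => ν < μ)]
    have e1 : Finset.univ.filter (fun ν => μ < ν) = Finset.Ioi μ := by ext; simp
    have e2 : (Finset.univ.filter fun ν => ¬ μ < ν).filter (fun ν => ν < μ) = Finset.Iio μ := by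
      ext ν; simp; exact le_of_lt
    have e3 : (Finset.univ.filter fun ν => ¬ μ < ν).filter (fun ν => ¬ ν < μ) = {μ} := by
      ext ν; simp [le_antisymm_iff]
    rw [e1, e2, e3, Finset.sum_singleton]
    ring
  have h2 : ∑ μ, ∑ ν ∈ Finset.Iio μ, κ μ * κ ν = ∑ μ, ∑ ν ∈ Finset.Ioi μ, κ μ * κ ν := by
    rw [Finset.sum_comm' (t' := Finset.univ) (s' := fun ν => Finset.Ioi ν) (by simp)]
    exact Finset.sum_congr rfl fun μ _ => Finset.sum_congr rfl fun ν _ => mul_comm _ _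
  rw [scalarCurvature, meanCurvature, sq, Finset.sum_mul_sum]
  simp only [h1, Finset.sum_add_distrib, h2]
  ring

variable (κ : Fin n → ℝ)

lemma sphereIntegral_quadric (hn : 1 ≤ n) :
    sphereIntegral (osculatingQuadric κ) = unitBallVolume n * meanCurvature κ / 2 := by
  have : osculatingQuadric κ = fun x => ∑ k, (κ k / 2) * x k ^ 2 := by
    ext x; rw [osculatingQuadric, Finset.sum_div]; exact Finset.sum_congr rfl fun _ _ => by ring
  rw [this, sphereIntegral_sum _ fun k => by fun_prop]
  simp only [sphereIntegral_const_mul, sphereIntegral_sq hn, meanCurvature]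
  rw [← Finset.sum_mul, ← Finset.sum_div]; ring

lemma sphereIntegral_coord_mul_quadric (hn : 1 ≤ n) (i : Fin n) :
    sphereIntegral (fun x => x i * osculatingQuadric κ x) = 0 := by
  have : (fun x : Euc n => x i * osculatingQuadric κ x) =
      fun x => ∑ k, (κ k / 2) * (x i * x k ^ 2) := by
    ext x; rw [osculatingQuadric, Finset.sum_div, Finset.mul_sum]
    exact Finset.sum_congr rfl fun _ _ => by ring
  rw [this, sphereIntegral_sum _ fun k => by fun_prop]
  simp [sphereIntegral_const_mul, sphereIntegral_coord_mul_sq hn]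

lemma quadric_sq_eq (x : Euc n) :
    osculatingQuadric κ x ^ 2 = ∑ k, ∑ l, (κ k * κ l / 4) * (x k ^ 2 * x l ^ 2) := by
  rw [osculatingQuadric, div_pow, sq (∑ k, _), Finset.sum_mul_sum, Finset.sum_div]
  refine Finset.sum_congr rfl fun _ _ => ?_
  rw [Finset.sum_div]
  exact Finset.sum_congr rfl fun _ _ => by ring

lemma sphereIntegral_quadric_sq (hn : 1 ≤ n) :
    sphereIntegral (fun x => osculatingQuadric κ x ^ 2) =
      unitBallVolume n * (meanCurvature κ ^ 2 + 2 * ∑ k, κ k ^ 2) / (4 * (n + 2)) := by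
  simp only [quadric_sq_eq]
  rw [sphereIntegral_sum _ fun k => by fun_prop]
  have : ∀ k : Fin n, sphereIntegral (fun x : Euc n => ∑ l, (κ k * κ l / 4) * (x k ^ 2 * x l ^ 2)) =
      unitBallVolume n / (4 * (n + 2)) * (κ k * ∑ l, κ l + 2 * κ k ^ 2) := by
    intro k
    rw [sphereIntegral_sum _ fun k => by fun_prop]
    simp only [sphereIntegral_const_mul, sphereIntegral_sq_mul_sq hn, mul_add, add_div, mul_ite,
      mul_zero, mul_one, ite_div, zero_div, Finset.sum_add_distrib, Finset.sum_ite_eq,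
      Finset.mem_univ, if_true, Finset.mul_sum]
    congr 1
    · exact Finset.sum_congr rfl fun l _ => by field_simp
    · field_simp
  simp only [this, ← Finset.mul_sum, Finset.sum_add_distrib, ← Finset.sum_mul, meanCurvature]
  ring

lemma sphereIntegral_coord_mul_coord_mul_grad (hn : 1 ≤ n) (i j : Fin n) :
    sphereIntegral (fun x => x i * x j * ∑ k, κ k ^ 2 * x k ^ 2) =
      if i = j then unitBallVolume n * (∑ k, κ k ^ 2 + 2 * κ i ^ 2) / (n + 2) else 0 := by
  have : (fun x : Euc n => x i * x j * ∑ k, κ k ^ 2 * x k ^ 2) =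
      fun x => ∑ k, κ k ^ 2 * (x i * x j * x k ^ 2) := by
    ext x; rw [Finset.mul_sum]; exact Finset.sum_congr rfl fun _ _ => by ring
  rw [this, sphereIntegral_sum _ fun k => by fun_prop]
  simp only [sphereIntegral_const_mul]
  split_ifs with hij
  · subst hij
    simp only [← sq, sphereIntegral_sq_mul_sq hn, mul_add, add_div, mul_ite,
      mul_zero, mul_one, ite_div, zero_div, Finset.sum_add_distrib, Finset.sum_ite_eq,
      Finset.mem_univ, if_true, Finset.mul_sum, Finset.sum_div]
    congr 1
    · exact Finset.sum_congr rfl fun l _ => by ring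
    · ring
  · simp [sphereIntegral_coord_mul_coord_mul_sq_of_ne hn hij]

lemma sphereIntegral_coord_mul_coord_mul_quadric_sq (hn : 1 ≤ n) (i j : Fin n) :
    sphereIntegral (fun x => x i * x j * osculatingQuadric κ x ^ 2) =
      if i = j then unitBallVolume n * (meanCurvature κ ^ 2 + 4 * κ i * meanCurvature κ +
        2 * ∑ k, κ k ^ 2 + 8 * κ i ^ 2) / (4 * (n + 2) * (n + 4)) else 0 := by
  have : (fun x : Euc n => x i * x j * osculatingQuadric κ x ^ 2) =
      fun x => ∑ k, ∑ l, (κ k * κ l / 4) * (x i * x j * x k ^ 2 * x l ^ 2) := by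
    ext x
    rw [quadric_sq_eq, Finset.mul_sum]
    refine Finset.sum_congr rfl fun _ _ => ?_
    rw [Finset.mul_sum]
    exact Finset.sum_congr rfl fun _ _ => by ring
  rw [this, sphereIntegral_sum _ fun k => by fun_prop]
  have hs : ∀ k : Fin n, sphereIntegral (fun x : Euc n => ∑ l, (κ k * κ l / 4) *
      (x i * x j * x k ^ 2 * x l ^ 2)) =
      ∑ l, (κ k * κ l / 4) * sphereIntegral (fun x : Euc n => x i * x j * x k ^ 2 * x l ^ 2) := by
    intro k
    rw [sphereIntegral_sum _ fun k => by fun_prop]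
    simp only [sphereIntegral_const_mul]
  simp only [hs]
  split_ifs with hij
  · subst hij
    have hk : ∀ k : Fin n, ∑ l, (κ k * κ l / 4) *
        sphereIntegral (fun x : Euc n => x i * x i * x k ^ 2 * x l ^ 2) =
        unitBallVolume n / (4 * (n + 2) * (n + 4)) * (κ k * meanCurvature κ +
          (if i = k then 2 * κ k * meanCurvature κ else 0) + 2 * κ k * κ i + 2 * κ k ^ 2 +
          if i = k then 8 * κ i ^ 2 else 0) := by
      intro k
      simp only [← sq, sphereIntegral_sq_mul_sq_mul_sq hn, meanCurvature]
      have : ∀ l, κ k * κ l / 4 * (unitBallVolume n * (1 + (if i = k then 2 else 0) +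
          (if i = l then 2 else 0) + (if k = l then 2 else 0) +
          if i = k then if k = l then 8 else 0 else 0) / ((n + 2) * (n + 4))) =
          unitBallVolume n / (4 * (n + 2) * (n + 4)) * (κ k * (1 + if i = k then 2 else 0) * κ l +
            (if i = l then 2 * κ k * κ l else 0) + (if k = l then 2 * κ k * κ l else 0) +
            if k = l then (if i = k then 8 * κ k * κ l else 0) else 0) := by
        intro l
        split_ifs <;> field_simp <;> ring
      simp only [this, ← Finset.mul_sum, Finset.sum_add_distrib, Finset.sum_ite_eq,
        Finset.mem_univ, if_true]
      congr 1
      split_ifs with h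
      · subst h; ring
      · ring
    simp only [hk, ← Finset.mul_sum, Finset.sum_add_distrib, Finset.sum_ite_eq,
        Finset.mem_univ, if_true, ← Finset.sum_mul]
    simp only [meanCurvature]
    ring
  · simp [sphereIntegral_coord_mul_coord_mul_sq_mul_sq_of_ne hn hij]

end QuadraticMoments

/-! ### Integrals over the parameter domain of a patch -/

section Expansion

open Set Metric

variable {n : ℕ}

/-- Second order Bernoulli estimate. -/
lemma abs_one_sub_pow_sub_le {u : ℝ} (h0 : 0 ≤ u) (h1 : u ≤ 1) (m : ℕ) :
    |(1 - u) ^ m - (1 - m * u)| ≤ m ^ 2 * u ^ 2 := by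
  have hl : 1 - m * u ≤ (1 - u) ^ m := by
    have := one_add_mul_le_pow (show -2 ≤ -u by linarith) m
    rw [← sub_eq_add_neg] at this; linarith
  have hu : (1 - u) ^ m ≤ 1 - m * u + m ^ 2 * u ^ 2 := by
    induction m with
    | zero => simp
    | succ m ih =>
      have hlm : 1 - m * u ≤ (1 - u) ^ m := by
        have := one_add_mul_le_pow (show -2 ≤ -u by linarith) m
        rw [← sub_eq_add_neg] at this; linarith
      rw [pow_succ]
      push_cast
      have h3 := mul_le_mul_of_nonneg_right (ih hlm) (show 0 ≤ 1 - u by linarith)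
      have h4 : 0 ≤ (m : ℝ) ^ 2 * u ^ 3 := by positivity
      have h5 : 0 ≤ (m : ℝ) * u ^ 2 := by positivity
      nlinarith
  rw [abs_of_nonneg (by linarith)]; linarith

/-- In a given direction, the points of a patch are those at distance at most
`ε - ½ ε³ q₀² + O(ε⁴)` from the axis, if the height over the tangent space is `q₀ r² + O(r³)`. -/
lemma exists_slice_bound {M C : ℝ} (hM : 0 ≤ M) (hC : 0 ≤ C) :
    ∃ K > 0, ∃ e > 0, e ≤ 1 ∧ ∀ ε, 0 < ε → ε < e → ∀ q₀, |q₀| ≤ M →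
      0 ≤ ε ^ 2 * q₀ ^ 2 / 2 ∧ ε ^ 2 * q₀ ^ 2 / 2 ≤ 1 ∧
      ∀ r h, 0 < r → r ≤ ε → |h - r ^ 2 * q₀| ≤ C * r ^ 3 →
        (r ≤ ε - ε ^ 3 * q₀ ^ 2 / 2 - K * ε ^ 4 → r ^ 2 + h ^ 2 ≤ ε ^ 2) ∧
        (r ^ 2 + h ^ 2 ≤ ε ^ 2 → r ≤ ε - ε ^ 3 * q₀ ^ 2 / 2 + K * ε ^ 4) := by
  -- `W⁻¹` bounds `ε` so that the terms of order `ε⁶` and beyond are dominated by `ε⁵`.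
  set C₁ := C * (2 * M + C) with hC₁
  have hC₁0 : 0 ≤ C₁ := by positivity
  set K := C₁ + 1 with hK
  set W := (M ^ 2 / 2 + K) ^ 2 + M ^ 2 * K + 2 * M ^ 4 + M ^ 2 + 1 with hW
  have hK0 : 0 < K := by positivity
  have hW1 : 1 ≤ W := by
    have : 0 ≤ (M ^ 2 / 2 + K) ^ 2 + M ^ 2 * K + 2 * M ^ 4 + M ^ 2 := by positivity
    linarith
  refine ⟨K, hK0, W⁻¹, by positivity, inv_le_one_of_one_le₀ hW1, fun ε h0 h1 q₀ hq => ?_⟩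
  have hεW : ε * W < 1 := by
    calc ε * W < W⁻¹ * W := by gcongr
      _ = 1 := inv_mul_cancel₀ (by positivity)
  have hε1 : ε ≤ 1 := by nlinarith
  set Q := q₀ ^ 2 with hQ
  have hQ0 : 0 ≤ Q := sq_nonneg _
  have hQM : Q ≤ M ^ 2 := by rw [hQ, ← sq_abs]; gcongr
  have hK1 : 1 ≤ K := by linarith
  have hb1 : ε * (M ^ 2 / 2 + K) ^ 2 ≤ K := by
    have : (M ^ 2 / 2 + K) ^ 2 ≤ W := by
      have : 0 ≤ M ^ 2 * K + 2 * M ^ 4 + M ^ 2 + 1 := by positivity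
      linarith
    nlinarith
  have hb2 : ε * (Q * K + 2 * Q ^ 2) ≤ 1 := by
    have e1 : Q * K ≤ M ^ 2 * K := by gcongr
    have e2 : Q ^ 2 ≤ M ^ 4 := by
      calc Q ^ 2 ≤ (M ^ 2) ^ 2 := by gcongr
        _ = M ^ 4 := by ring
    have : Q * K + 2 * Q ^ 2 ≤ W := by
      have : 0 ≤ (M ^ 2 / 2 + K) ^ 2 + M ^ 2 + 1 := by positivity
      linarith
    nlinarith
  have hb3 : ε * Q ≤ 1 := by
    have : Q ≤ W := by
      have : 0 ≤ (M ^ 2 / 2 + K) ^ 2 + M ^ 2 * K + 2 * M ^ 4 + 1 := by positivity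
      linarith
    nlinarith
  have hb4 : ε ^ 2 * Q ≤ 1 := by nlinarith
  refine ⟨by positivity, by linarith, fun r h hr hrε hh => ?_⟩
  have hr1 : r ≤ 1 := hrε.trans hε1
  -- `h²` equals `r⁴ Q` up to `C₁ r⁵`
  have hsq : |h ^ 2 - r ^ 4 * Q| ≤ C₁ * ε ^ 5 := by
    have e1 : h ^ 2 - r ^ 4 * Q = (h - r ^ 2 * q₀) * (h - r ^ 2 * q₀ + 2 * (r ^ 2 * q₀)) := by
      rw [hQ]; ring
    have e2 : |h - r ^ 2 * q₀ + 2 * (r ^ 2 * q₀)| ≤ (2 * M + C) * r ^ 2 := by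
      calc _ ≤ |h - r ^ 2 * q₀| + |2 * (r ^ 2 * q₀)| := abs_add_le _ _
        _ ≤ C * r ^ 3 + 2 * (r ^ 2 * M) := by
            gcongr
            rw [abs_mul, abs_two, abs_mul, abs_of_nonneg (sq_nonneg r)]
            gcongr
        _ ≤ C * r ^ 2 + 2 * (r ^ 2 * M) := by
            have : r ^ 3 ≤ r ^ 2 := pow_le_pow_of_le_one hr.le hr1 (by norm_num)
            gcongr
        _ = _ := by ring
    calc |h ^ 2 - r ^ 4 * Q| ≤ (C * r ^ 3) * ((2 * M + C) * r ^ 2) := by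
          rw [e1, abs_mul]; gcongr
      _ = C₁ * r ^ 5 := by rw [hC₁]; ring
      _ ≤ C₁ * ε ^ 5 := by gcongr
  obtain ⟨hs1, hs2⟩ := abs_le.1 hsq
  have hp5 : 0 < ε ^ 5 := by positivity
  constructor
  · intro hle
    set w := ε ^ 3 * Q / 2 + K * ε ^ 4 with hw
    have hw0 : 0 ≤ w := by positivity
    have hrw : r ≤ ε - w := by rw [hw]; linarith
    have hr2 : r ^ 2 ≤ (ε - w) ^ 2 := by gcongr
    have hr4 : r ^ 4 * Q ≤ ε ^ 4 * Q := by gcongr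
    have hww : w ≤ ε ^ 3 * (M ^ 2 / 2 + K) := by
      have : K * ε ^ 4 ≤ K * ε ^ 3 := by
        have : ε ^ 4 ≤ ε ^ 3 := pow_le_pow_of_le_one h0.le hε1 (by norm_num)
        gcongr
      have : ε ^ 3 * Q ≤ ε ^ 3 * M ^ 2 := by gcongr
      rw [hw]; linarith
    have hw2 : w ^ 2 ≤ K * ε ^ 5 := by
      calc w ^ 2 ≤ (ε ^ 3 * (M ^ 2 / 2 + K)) ^ 2 := by gcongr
        _ = (ε * (M ^ 2 / 2 + K) ^ 2) * ε ^ 5 := by ring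
        _ ≤ K * ε ^ 5 := by gcongr
    have e3 : (ε - w) ^ 2 = ε ^ 2 - ε ^ 4 * Q - 2 * K * ε ^ 5 + w ^ 2 := by rw [hw]; ring
    have e4 : C₁ * ε ^ 5 = K * ε ^ 5 - ε ^ 5 := by rw [hK]; ring
    linarith
  · intro hle
    by_contra hlt
    push Not at hlt
    set v := ε ^ 3 * Q / 2 with hv
    have hv0 : 0 ≤ v := by positivity
    have hvε : 0 ≤ ε - v := by
      have : v ≤ ε := by
        calc v = ε * (ε ^ 2 * Q / 2) := by rw [hv]; ring
          _ ≤ ε * 1 := by gcongr; linarith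
          _ = ε := mul_one _
      linarith
    have hr2 : (ε - v + K * ε ^ 4) ^ 2 < r ^ 2 := by
      have : 0 ≤ ε - v + K * ε ^ 4 := add_nonneg hvε (by positivity)
      gcongr
    have hr4 : (ε - v) ^ 4 * Q ≤ r ^ 4 * Q := by
      have : ε - v ≤ r := by
        have : 0 ≤ K * ε ^ 4 := by positivity
        linarith
      gcongr
    have hbern : ε ^ 4 - 4 * ε ^ 3 * v ≤ (ε - v) ^ 4 := by
      have e : (ε - v) ^ 4 = ε ^ 4 - 4 * ε ^ 3 * v + v ^ 2 * (2 * ε ^ 2 + (2 * ε - v) ^ 2) := by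
        ring
      have : 0 ≤ v ^ 2 * (2 * ε ^ 2 + (2 * ε - v) ^ 2) := by positivity
      linarith
    have hbQ : (ε ^ 4 - 4 * ε ^ 3 * v) * Q ≤ r ^ 4 * Q :=
      (mul_le_mul_of_nonneg_right hbern hQ0).trans hr4
    have e3 : (ε ^ 4 - 4 * ε ^ 3 * v) * Q = ε ^ 4 * Q - 2 * Q ^ 2 * ε ^ 6 := by rw [hv]; ring
    have e4 : ε ^ 2 - ε ^ 4 * Q + 2 * K * ε ^ 5 - Q * K * ε ^ 7 ≤ (ε - v + K * ε ^ 4) ^ 2 := by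
      have : (ε - v + K * ε ^ 4) ^ 2 = ε ^ 2 - ε ^ 4 * Q + 2 * K * ε ^ 5 - Q * K * ε ^ 7 +
          (v ^ 2 + (K * ε ^ 4) ^ 2) := by rw [hv]; ring
      have : 0 ≤ v ^ 2 + (K * ε ^ 4) ^ 2 := by positivity
      linarith
    have e5 : Q * K * ε ^ 7 + 2 * Q ^ 2 * ε ^ 6 ≤ ε ^ 5 := by
      have : Q * K * ε ^ 7 ≤ Q * K * ε ^ 6 := by
        have : ε ^ 7 ≤ ε ^ 6 := pow_le_pow_of_le_one h0.le hε1 (by norm_num)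
        gcongr
      calc _ ≤ (ε * (Q * K + 2 * Q ^ 2)) * ε ^ 5 := by linarith
        _ ≤ 1 * ε ^ 5 := by gcongr
        _ = _ := one_mul _
    have e6 : C₁ * ε ^ 5 = K * ε ^ 5 - ε ^ 5 := by rw [hK]; ring
    have e7 : 0 < K * ε ^ 5 := by positivity
    linarith

/-- Integrals over two subsets of `(0, ε]` which differ only near `ρ`, of integrands which are close
to each other on the first one. -/
lemma abs_setIntegral_sub_le {A : Set ℝ} (hA : MeasurableSet A) {ε ρ δ B₁ B₂ : ℝ} {h h₀ : ℝ → ℝ}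
    (hAε : A ⊆ Ioc 0 ε) (hρε : ρ ≤ ε) (hε : 0 ≤ ε) (hδ : 0 ≤ δ)
    (hin : ∀ r ∈ A, r ≤ ρ + δ) (hout : ∀ r, 0 < r → r ≤ ρ - δ → r ∈ A)
    (hhi : IntegrableOn h A) (hh₀i : IntegrableOn h₀ (Ioc 0 ε))
    (hB₁ : ∀ r ∈ A, |h r - h₀ r| ≤ B₁) (hB₂ : ∀ r ∈ Ioc 0 ε, |h₀ r| ≤ B₂)
    (hB₁0 : 0 ≤ B₁) (hB₂0 : 0 ≤ B₂) :
    |(∫ r in A, h r) - ∫ r in Ioc 0 ρ, h₀ r| ≤ B₁ * ε + 4 * δ * B₂ := by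
  have hρsub : Ioc 0 ρ ⊆ Ioc 0 ε := Ioc_subset_Ioc_right hρε
  have hh₀A := hh₀i.mono_set hAε
  have hh₀ρ := hh₀i.mono_set hρsub
  have h1 : |(∫ r in A, h r) - ∫ r in A, h₀ r| ≤ B₁ * ε := by
    rw [← integral_sub hhi hh₀A]
    have hv : volume A < ⊤ := (measure_mono hAε).trans_lt (by simp)
    have := norm_setIntegral_le_of_norm_le_const (μ := volume) hv (f := fun r => h r - h₀ r)
      (C := B₁) (fun r hr => hB₁ r hr)
    refine this.trans ?_
    gcongr
    calc volume.real A ≤ volume.real (Ioc 0 ε) := measureReal_mono hAε (by simp)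
      _ = ε := by simp [hε]
  have hdiff : ∀ s : Set ℝ, s ⊆ Icc (ρ - δ) (ρ + δ) → s ⊆ Ioc 0 ε →
      |∫ r in s, h₀ r| ≤ 2 * δ * B₂ := by
    intro s hs hs'
    have hv : volume s < ⊤ := (measure_mono hs).trans_lt (by simp)
    have := norm_setIntegral_le_of_norm_le_const (μ := volume) hv (f := h₀)
      (C := B₂) (fun r hr => hB₂ r (hs' hr))
    refine this.trans ?_
    rw [mul_comm]
    gcongr
    calc volume.real s ≤ volume.real (Icc (ρ - δ) (ρ + δ)) := measureReal_mono hs (by simp)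
      _ = 2 * δ := by
        rw [Real.volume_real_Icc_of_le (by linarith)]; ring
  have h2 : |(∫ r in A, h₀ r) - ∫ r in Ioc 0 ρ, h₀ r| ≤ 4 * δ * B₂ := by
    rw [← integral_inter_add_sdiff measurableSet_Ioc hh₀A (t := Ioc 0 ρ),
      ← integral_inter_add_sdiff hA hh₀ρ, inter_comm]
    have d1 := hdiff (A \ Ioc 0 ρ) (fun r hr => by
      have hp := (hAε hr.1).1
      have h' : ρ < r := by
        by_contra hc; exact hr.2 ⟨hp, not_lt.1 hc⟩
      exact ⟨by linarith, hin r hr.1⟩) (sdiff_subset.trans hAε)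
    have d2 := hdiff (Ioc 0 ρ \ A) (fun r hr => by
      have h' : ρ - δ < r := by
        by_contra hc; exact hr.2 (hout r hr.1.1 (not_lt.1 hc))
      exact ⟨h'.le, by linarith [hr.1.2]⟩) (sdiff_subset.trans hρsub)
    rw [add_sub_add_left_eq_sub]
    refine (abs_sub _ _).trans ?_
    linarith
  calc _ ≤ |(∫ r in A, h r) - ∫ r in A, h₀ r| + |(∫ r in A, h₀ r) - ∫ r in Ioc 0 ρ, h₀ r| :=
        abs_sub_le _ _ _
    _ ≤ _ := add_le_add h1 h2

end Expansion

section DomainExpansion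

open Set Metric

variable {n : ℕ}

/-- The parameter domain of the patch of radius `ε` of the graph of `f`: the points `x` for which
`(x, f x)` lies in the ball of radius `ε`. -/
def patchDomain (f : Euc n → ℝ) (ε : ℝ) : Set (Euc n) := {x | ‖x‖ ^ 2 + f x ^ 2 ≤ ε ^ 2}

lemma isClosed_patchDomain {f : Euc n → ℝ} (hf : Continuous f) (ε : ℝ) :
    IsClosed (patchDomain f ε) :=
  isClosed_le (by fun_prop) continuous_const

lemma patchDomain_subset (f : Euc n → ℝ) {ε : ℝ} (hε : 0 ≤ ε) :
    patchDomain f ε ⊆ closedBall 0 ε := by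
  intro x hx
  rw [mem_closedBall_zero_iff]
  have hx : ‖x‖ ^ 2 + f x ^ 2 ≤ ε ^ 2 := hx
  exact (sq_le_sq₀ (norm_nonneg _) hε).1 (by nlinarith [sq_nonneg (f x)])

lemma isCompact_patchDomain {f : Euc n → ℝ} (hf : Continuous f) {ε : ℝ} (hε : 0 ≤ ε) :
    IsCompact (patchDomain f ε) :=
  (isCompact_closedBall 0 ε).of_isClosed_subset (isClosed_patchDomain hf ε)
    (patchDomain_subset f hε)

lemma exists_bound_on_sphere {g : Euc n → ℝ} (hg : Continuous g) :
    ∃ B, 0 ≤ B ∧ ∀ θ : Euc n, ‖θ‖ = 1 → |g θ| ≤ B := by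
  obtain ⟨B, hB⟩ := (isCompact_sphere (0 : Euc n) 1).exists_bound_of_continuousOn hg.continuousOn
  exact ⟨max B 0, le_max_right _ _, fun θ hθ =>
    (hB θ (by simpa using hθ)).trans (le_max_left _ _)⟩

lemma integral_Ioc_pow_add_pow {m : ℕ} (hm : 1 ≤ m) {ρ : ℝ} (hρ : 0 ≤ ρ) (a c : ℝ) :
    ∫ r in Ioc 0 ρ, (a * r ^ (m - 1) + c * r ^ (m + 1)) =
      a * ρ ^ m / m + c * ρ ^ (m + 2) / (m + 2) := by
  have hi : ∀ (b : ℝ) (k : ℕ), IntervalIntegrable (fun r : ℝ => b * r ^ k) volume 0 ρ := fun b k =>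
    Continuous.intervalIntegrable (by fun_prop) _ _
  rw [← intervalIntegral.integral_of_le hρ, intervalIntegral.integral_add (hi _ _) (hi _ _),
    intervalIntegral.integral_const_mul, intervalIntegral.integral_const_mul, integral_pow,
    integral_pow]
  obtain ⟨m, rfl⟩ : ∃ k, m = k + 1 := ⟨m - 1, by lia⟩
  simp only [Nat.add_sub_cancel]
  push_cast
  ring_nf

/-- Expansion of one radial integral, with constants which do not depend on the direction. -/
lemma exists_radial_expansion {m j : ℕ} (hm : 1 ≤ m) (hj : j ≤ 3) {M C B C' r₀ : ℝ} (hM : 0 ≤ M)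
    (hC : 0 ≤ C) (hB : 0 ≤ B) (hC' : 0 ≤ C') (hr₀ : 0 < r₀) :
    ∃ K, ∀ᶠ ε in 𝓝[>] (0 : ℝ), ∀ (q₀ a c : ℝ) (A : Set ℝ) (φ h : ℝ → ℝ), |q₀| ≤ M → |a| ≤ B →
      |c| ≤ B → MeasurableSet A → IntegrableOn h A →
      (∀ r, r ∈ A ↔ 0 < r ∧ r ^ 2 + φ r ^ 2 ≤ ε ^ 2) →
      (∀ r, 0 < r → r ≤ r₀ → |φ r - r ^ 2 * q₀| ≤ C * r ^ 3) →
      (∀ r, 0 < r → r ≤ r₀ → |h r - (a * r ^ (m - 1) + c * r ^ (m + 1))| ≤ C' * r ^ (m - 1 + j)) →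
      |(∫ r in A, h r) - (ε ^ m * (a / m) + ε ^ (m + 2) * (c / (m + 2) - a * q₀ ^ 2 / 2))| ≤
        K * ε ^ (m + j) := by
  obtain ⟨K, hK, e, he, he1, hslice⟩ := exists_slice_bound hM hC
  have hm0 : (0 : ℝ) < m := by exact_mod_cast hm
  refine ⟨C' + 8 * K * B + B * m ^ 2 * M ^ 4 / m +
    B * (((m : ℝ) + 2) ^ 2 * M ^ 4 + (m + 2) * M ^ 2),
    ?_⟩
  filter_upwards [Ioo_mem_nhdsGT he, Ioo_mem_nhdsGT hr₀] with ε h1 h2 q₀ a c A φ h hq ha hc hA hhi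
    hmem hφ hh
  have hε := h1.1
  have hε1 : ε ≤ 1 := h1.2.le.trans he1
  obtain ⟨hu0, hu1, hsl⟩ := hslice ε hε h1.2 q₀ hq
  set u := ε ^ 2 * q₀ ^ 2 / 2 with hu
  set ρ := ε * (1 - u) with hρ
  have hρ' : ρ = ε - ε ^ 3 * q₀ ^ 2 / 2 := by rw [hρ, hu]; ring
  have hρ0 : 0 ≤ ρ := mul_nonneg hε.le (by linarith)
  have hρε : ρ ≤ ε := by rw [hρ]; nlinarith
  rw [← hρ'] at hsl
  have hAε : A ⊆ Ioc 0 ε := fun r hr => by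
    obtain ⟨hr0, hr⟩ := (hmem r).1 hr
    refine ⟨hr0, ?_⟩
    have : r ^ 2 ≤ ε ^ 2 := by nlinarith [sq_nonneg (φ r)]
    exact (sq_le_sq₀ hr0.le hε.le).1 this
  set h₀ : ℝ → ℝ := fun r => a * r ^ (m - 1) + c * r ^ (m + 1) with hh₀
  have hh₀c : Continuous h₀ := by fun_prop
  have hpm : ε ^ (m - 1) * ε = ε ^ m := by rw [← pow_succ]; congr 1; lia
  have key := abs_setIntegral_sub_le hA (δ := K * ε ^ 4) (B₁ := C' * ε ^ (m - 1 + j))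
    (B₂ := 2 * B * ε ^ (m - 1)) (h := h) (h₀ := h₀) hAε hρε hε.le (by positivity)
    (fun r hr => by
      obtain ⟨hr0, hr'⟩ := (hmem r).1 hr
      have hrε := (hAε hr).2
      exact (hsl r (φ r) hr0 hrε (hφ r hr0 (hrε.trans h2.2.le))).2 hr')
    (fun r hr hr' => by
      have hrε : r ≤ ε := by
        have : 0 ≤ K * ε ^ 4 := by positivity
        linarith
      exact (hmem r).2 ⟨hr, (hsl r (φ r) hr hrε (hφ r hr (hrε.trans h2.2.le))).1 hr'⟩)
    hhi (hh₀c.continuousOn.integrableOn_Icc.mono_set Ioc_subset_Icc_self)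
    (fun r hr => by
      have hr2 := hAε hr
      refine (hh r hr2.1 (hr2.2.trans h2.2.le)).trans ?_
      have := hr2.1.le
      gcongr
      exact hr2.2)
    (fun r hr => by
      have hr0 := hr.1.le
      have e1 : r ^ (m + 1) ≤ r ^ (m - 1) :=
        pow_le_pow_of_le_one hr0 (hr.2.trans hε1) (by lia)
      have e2 : r ^ (m - 1) ≤ ε ^ (m - 1) := by gcongr; exact hr.2
      calc |h₀ r| ≤ |a * r ^ (m - 1)| + |c * r ^ (m + 1)| := abs_add_le _ _
        _ = |a| * r ^ (m - 1) + |c| * r ^ (m + 1) := by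
            rw [abs_mul, abs_mul, abs_of_nonneg (pow_nonneg hr0 _),
              abs_of_nonneg (pow_nonneg hr0 _)]
        _ ≤ B * ε ^ (m - 1) + B * ε ^ (m - 1) := by
            gcongr
            exact e1.trans e2
        _ = _ := by ring)
    (by positivity) (by positivity)
  have hint : ∫ r in Ioc 0 ρ, h₀ r = a * ρ ^ m / m + c * ρ ^ (m + 2) / (m + 2) :=
    integral_Ioc_pow_add_pow hm hρ0 a c
  rw [hint] at key
  -- It remains to expand the powers of `ρ = ε (1 - u)`.
  have hj3 : ∀ s, m + 3 ≤ s → ε ^ s ≤ ε ^ (m + j) := fun s hs =>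
    pow_le_pow_of_le_one hε.le hε1 (by lia)
  have hq4 : q₀ ^ 4 ≤ M ^ 4 := by
    calc q₀ ^ 4 = |q₀| ^ 4 := by rw [← abs_pow, abs_of_nonneg (by positivity)]
      _ ≤ M ^ 4 := by gcongr
  have hq2 : q₀ ^ 2 ≤ M ^ 2 := by
    rw [← sq_abs]; gcongr
  have hu2 : u ^ 2 ≤ ε ^ 4 * M ^ 4 := by
    have : u ^ 2 = ε ^ 4 * q₀ ^ 4 / 4 := by rw [hu]; ring
    have h4 : ε ^ 4 * q₀ ^ 4 ≤ ε ^ 4 * M ^ 4 := by gcongr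
    have : 0 ≤ ε ^ 4 * q₀ ^ 4 := by positivity
    linarith
  have hu' : u ≤ ε ^ 2 * M ^ 2 := by
    have h4 : ε ^ 2 * q₀ ^ 2 ≤ ε ^ 2 * M ^ 2 := by gcongr
    have : 0 ≤ ε ^ 2 * q₀ ^ 2 := by positivity
    rw [hu]; linarith
  have E1 : |a * ρ ^ m / m - (ε ^ m * (a / m) - ε ^ (m + 2) * (a * q₀ ^ 2 / 2))| ≤
      B * m ^ 2 * M ^ 4 / m * ε ^ (m + j) := by
    have : a * ρ ^ m / m - (ε ^ m * (a / m) - ε ^ (m + 2) * (a * q₀ ^ 2 / 2)) =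
        a / m * ε ^ m * ((1 - u) ^ m - (1 - m * u)) := by
      rw [hρ, mul_pow, hu]; field_simp; ring
    rw [this, abs_mul, abs_mul, abs_div, abs_of_pos hm0, abs_of_pos (pow_pos hε m)]
    calc |a| / m * ε ^ m * |(1 - u) ^ m - (1 - m * u)| ≤
          B / m * ε ^ m * (m ^ 2 * (ε ^ 4 * M ^ 4)) := by
          gcongr
          exact (abs_one_sub_pow_sub_le hu0 hu1 m).trans (by gcongr)
      _ = B * m ^ 2 * M ^ 4 / m * ε ^ (m + 4) := by ring
      _ ≤ _ := mul_le_mul_of_nonneg_left (hj3 _ (by lia)) (by positivity)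
  have E2 : |c * ρ ^ (m + 2) / (m + 2) - ε ^ (m + 2) * (c / (m + 2))| ≤
      B * (((m : ℝ) + 2) ^ 2 * M ^ 4 + (m + 2) * M ^ 2) * ε ^ (m + j) := by
    have : c * ρ ^ (m + 2) / (m + 2) - ε ^ (m + 2) * (c / (m + 2)) =
        c / (m + 2) * ε ^ (m + 2) * ((1 - u) ^ (m + 2) - 1) := by
      rw [hρ, mul_pow]; field_simp
    rw [this, abs_mul, abs_mul, abs_div, abs_of_pos (pow_pos hε _),
      abs_of_pos (show (0 : ℝ) < m + 2 by positivity)]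
    have hb : |(1 - u) ^ (m + 2) - 1| ≤ (((m : ℝ) + 2) ^ 2 * M ^ 4 + (m + 2) * M ^ 2) * ε ^ 2 := by
      have h5 := abs_one_sub_pow_sub_le hu0 hu1 (m + 2)
      push_cast at h5
      have h6 : |(1 - u) ^ (m + 2) - 1| ≤
          |(1 - u) ^ (m + 2) - (1 - ((m : ℝ) + 2) * u)| + ((m : ℝ) + 2) * u := by
        have h7 := abs_sub_le ((1 - u) ^ (m + 2)) (1 - ((m : ℝ) + 2) * u) 1
        have h8 : |1 - ((m : ℝ) + 2) * u - 1| = ((m : ℝ) + 2) * u := by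
          rw [show 1 - ((m : ℝ) + 2) * u - 1 = -(((m : ℝ) + 2) * u) by ring, abs_neg,
            abs_of_nonneg (by positivity)]
        rwa [h8] at h7
      have h9 : ε ^ 4 ≤ ε ^ 2 := pow_le_pow_of_le_one hε.le hε1 (by norm_num)
      calc _ ≤ ((m : ℝ) + 2) ^ 2 * u ^ 2 + ((m : ℝ) + 2) * u := h6.trans (by gcongr)
        _ ≤ ((m : ℝ) + 2) ^ 2 * (ε ^ 2 * M ^ 4) + ((m : ℝ) + 2) * (ε ^ 2 * M ^ 2) := by
            gcongr
            exact hu2.trans (by gcongr)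
        _ = _ := by ring
    calc |c| / (m + 2) * ε ^ (m + 2) * |(1 - u) ^ (m + 2) - 1| ≤
          B * ε ^ (m + 2) * ((((m : ℝ) + 2) ^ 2 * M ^ 4 + (m + 2) * M ^ 2) * ε ^ 2) := by
          gcongr
          exact (div_le_self (abs_nonneg _) (by linarith)).trans hc
      _ = B * (((m : ℝ) + 2) ^ 2 * M ^ 4 + (m + 2) * M ^ 2) * ε ^ (m + 4) := by ring
      _ ≤ _ := mul_le_mul_of_nonneg_left (hj3 _ (by lia)) (by positivity)
  have E0 : C' * ε ^ (m - 1 + j) * ε + 4 * (K * ε ^ 4) * (2 * B * ε ^ (m - 1)) ≤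
      (C' + 8 * K * B) * ε ^ (m + j) := by
    have e1 : C' * ε ^ (m - 1 + j) * ε = C' * ε ^ (m + j) := by
      rw [pow_add, pow_add, ← hpm]; ring
    have e2 : 4 * (K * ε ^ 4) * (2 * B * ε ^ (m - 1)) = 8 * K * B * ε ^ (m + 3) := by
      rw [pow_add, ← hpm]; ring
    rw [e1, e2, add_mul]
    exact add_le_add_right (mul_le_mul_of_nonneg_left (hj3 _ le_rfl) (by positivity)) _
  have split : (∫ r in A, h r) -
      (ε ^ m * (a / m) + ε ^ (m + 2) * (c / (m + 2) - a * q₀ ^ 2 / 2)) =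
      ((∫ r in A, h r) - (a * ρ ^ m / m + c * ρ ^ (m + 2) / (m + 2))) +
      (a * ρ ^ m / m - (ε ^ m * (a / m) - ε ^ (m + 2) * (a * q₀ ^ 2 / 2))) +
      (c * ρ ^ (m + 2) / (m + 2) - ε ^ (m + 2) * (c / (m + 2))) := by ring
  rw [split]
  refine (abs_add_three _ _ _).trans ?_
  linarith

/-- Expansion of an integral over the parameter domain of a small patch, for a graph with second
fundamental form `κ` and an integrand `r ^ k a(θ) + r ^ (k + 2) c(θ) + O(r ^ (k + j))`. The term
`-a q² / 2` accounts for the deviation of the domain from a ball. -/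
theorem exists_patchDomain_expansion (hn : 1 ≤ n) {f : Euc n → ℝ} (hf : Continuous f)
    (κ : Fin n → ℝ) {C r₀ : ℝ} (hr₀ : 0 < r₀)
    (hfq : ∀ x : Euc n, ‖x‖ ≤ r₀ → |f x - osculatingQuadric κ x| ≤ C * ‖x‖ ^ 3)
    {g a c : Euc n → ℝ} (hg : Continuous g) (ha : Continuous a) (hc : Continuous c) {k j : ℕ}
    (hj : j ≤ 3) {C' : ℝ}
    (hexp : ∀ θ : Euc n, ‖θ‖ = 1 → ∀ r, 0 < r → r ≤ r₀ →
      |g (r • θ) - (r ^ k * a θ + r ^ (k + 2) * c θ)| ≤ C' * r ^ (k + j)) :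
    ∃ K, ∀ᶠ ε in 𝓝[>] (0 : ℝ), |(∫ x in patchDomain f ε, g x) -
      (ε ^ (n + k) * (sphereIntegral a / (n + k : ℕ)) +
        ε ^ (n + k + 2) * (sphereIntegral c / ((n + k : ℕ) + 2) -
          sphereIntegral (fun x => a x * osculatingQuadric κ x ^ 2) / 2))| ≤
      K * ε ^ (n + k + j) := by
  obtain ⟨M, hM, hMq⟩ := exists_bound_on_sphere (continuous_osculatingQuadric κ)
  obtain ⟨Ba, hBa, hBa'⟩ := exists_bound_on_sphere ha
  obtain ⟨Bc, hBc, hBc'⟩ := exists_bound_on_sphere hc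
  obtain ⟨K, hK⟩ := exists_radial_expansion (m := n + k) (j := j) (by lia) hj hM
    (abs_nonneg C) (le_max_of_le_left hBa : 0 ≤ max Ba Bc) (abs_nonneg C') hr₀
  refine ⟨K * (sphereMeasure n).real univ, ?_⟩
  filter_upwards [hK, self_mem_nhdsWithin] with ε hε hε0
  have hε0 : 0 < ε := hε0
  have hmeas := (isClosed_patchDomain hf ε).measurableSet
  have hgi : Integrable ((patchDomain f ε).indicator g) := by
    rw [integrable_indicator_iff hmeas]
    exact hg.continuousOn.integrableOn_compact (isCompact_patchDomain hf hε0.le)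
  obtain ⟨hI, hpol⟩ := integral_polar hn hgi
  rw [integral_indicator hmeas] at hpol
  set main : Euc n → ℝ := fun x => ε ^ (n + k) * (a x / (n + k : ℕ)) +
    ε ^ (n + k + 2) * (c x / ((n + k : ℕ) + 2) - a x * osculatingQuadric κ x ^ 2 / 2) with hmain
  have hq := continuous_osculatingQuadric κ
  have hmc : Continuous main := by fun_prop
  have hsm : sphereIntegral main = ε ^ (n + k) * (sphereIntegral a / (n + k : ℕ)) +
      ε ^ (n + k + 2) * (sphereIntegral c / ((n + k : ℕ) + 2) -
        sphereIntegral (fun x => a x * osculatingQuadric κ x ^ 2) / 2) := by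
    have i1 := integrable_sphere ha
    have i2 := integrable_sphere hc
    have i3 : Integrable (fun θ : sphere (0 : Euc n) 1 => a θ * osculatingQuadric κ θ ^ 2)
        (sphereMeasure n) := integrable_sphere (ha.mul (hq.pow 2))
    have i23 : Integrable (fun θ : sphere (0 : Euc n) 1 => ε ^ (n + k + 2) *
        (c θ / ((n + k : ℕ) + 2) - a θ * osculatingQuadric κ θ ^ 2 / 2)) (sphereMeasure n) :=
      ((i2.div_const _).sub (i3.div_const _)).const_mul _
    simp only [sphereIntegral, hmain]
    rw [integral_add ((i1.div_const _).const_mul _) i23, integral_const_mul, integral_const_mul,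
      integral_div, integral_sub (i2.div_const _) (i3.div_const _), integral_div, integral_div]
  rw [← hsm, hpol, sphereIntegral, ← integral_sub hI (integrable_sphere hmc)]
  have hpt : ∀ θ : sphere (0 : Euc n) 1, ‖(∫ r in Ioi (0 : ℝ),
      r ^ (n - 1) * (patchDomain f ε).indicator g (r • (θ : Euc n))) - main θ‖ ≤
      K * ε ^ (n + k + j) := by
    intro θ
    have hθ : ‖(θ : Euc n)‖ = 1 := norm_eq_of_mem_sphere θ
    set A : Set ℝ := {r | 0 < r ∧ r ^ 2 + f (r • (θ : Euc n)) ^ 2 ≤ ε ^ 2} with hA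
    have hnorm : ∀ r, 0 < r → ‖r • (θ : Euc n)‖ = r := fun r hr => by
      rw [norm_smul, hθ, mul_one, Real.norm_of_nonneg hr.le]
    have hAm : MeasurableSet A := by
      refine (measurableSet_Ioi (a := (0 : ℝ))).inter (IsClosed.measurableSet ?_)
      exact isClosed_le (f := fun r : ℝ => r ^ 2 + f (r • (θ : Euc n)) ^ 2) (by fun_prop)
        continuous_const
    have hAi : A = Ioi 0 ∩ {r | r • (θ : Euc n) ∈ patchDomain f ε} := by
      ext r
      simp only [hA, mem_ofPred_eq, mem_inter_iff, mem_Ioi, patchDomain]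
      refine and_congr_right fun hr => ?_
      rw [hnorm r hr]
    have hsub : A ⊆ Icc 0 ε := fun r hr => by
      refine ⟨hr.1.le, ?_⟩
      have : r ^ 2 ≤ ε ^ 2 := by nlinarith [sq_nonneg (f (r • (θ : Euc n))), hr.2]
      exact (sq_le_sq₀ hr.1.le hε0.le).1 this
    have hint : ∫ r in Ioi (0 : ℝ), r ^ (n - 1) * (patchDomain f ε).indicator g (r • (θ : Euc n)) =
        ∫ r in A, r ^ (n - 1) * g (r • (θ : Euc n)) := by
      rw [← integral_indicator measurableSet_Ioi, ← integral_indicator hAm]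
      congr 1
      ext r
      by_cases hr : 0 < r <;> by_cases hr' : r • (θ : Euc n) ∈ patchDomain f ε <;>
        simp [indicator, hAi, hr, hr']
    rw [hint, Real.norm_eq_abs]
    have hcont : Continuous fun r : ℝ => r ^ (n - 1) * g (r • (θ : Euc n)) := by fun_prop
    have := hε (osculatingQuadric κ θ) (a θ) (c θ) A (fun r => f (r • (θ : Euc n)))
      (fun r => r ^ (n - 1) * g (r • (θ : Euc n))) (hMq θ hθ)
      ((hBa' θ hθ).trans (le_max_left _ _)) ((hBc' θ hθ).trans (le_max_right _ _)) hAm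
      (hcont.continuousOn.integrableOn_Icc.mono_set hsub) (fun r => Iff.rfl)
      (fun r hr hr' => by
        have := hfq (r • (θ : Euc n)) ((hnorm r hr).le.trans hr')
        rw [hnorm r hr, osculatingQuadric_smul] at this
        refine this.trans ?_
        gcongr
        exact le_abs_self C)
      (fun r hr hr' => by
        have := hexp θ hθ r hr hr'
        have e1 : r ^ (n + k - 1) = r ^ (n - 1) * r ^ k := by rw [← pow_add]; congr 1; lia
        have e2 : r ^ (n + k + 1) = r ^ (n - 1) * r ^ (k + 2) := by rw [← pow_add]; congr 1; lia
        have e3 : r ^ (n + k - 1 + j) = r ^ (n - 1) * r ^ (k + j) := by rw [← pow_add]; congr 1; lia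
        rw [e1, e2, e3, show r ^ (n - 1) * g (r • (θ : Euc n)) -
          (a θ * (r ^ (n - 1) * r ^ k) + c θ * (r ^ (n - 1) * r ^ (k + 2))) =
          r ^ (n - 1) * (g (r • (θ : Euc n)) - (r ^ k * a θ + r ^ (k + 2) * c θ)) by ring,
          abs_mul, abs_of_pos (pow_pos hr _)]
        calc _ ≤ r ^ (n - 1) * (C' * r ^ (k + j)) := by gcongr
          _ ≤ r ^ (n - 1) * (|C'| * r ^ (k + j)) := by gcongr; exact le_abs_self C'
          _ = _ := by ring)
    exact this
  have hfinal := norm_integral_le_of_norm_le_const (μ := sphereMeasure n)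
    (Eventually.of_forall hpt)
  rw [Real.norm_eq_abs] at hfinal
  calc _ ≤ _ := hfinal
    _ = _ := by ring

end DomainExpansion

/-! ### Hypersurfaces as graphs over their tangent space -/

/-- The smooth implicit function theorem for one scalar equation. Smoothness holds on a whole
neighbourhood, because the implicit functions at nearby zeros are all the same function. -/
theorem exists_contDiffAt_implicitFunction {E : Type*} [NormedAddCommGroup E] [NormedSpace ℝ E]
    [CompleteSpace E] {F : E × ℝ → ℝ} {u : E × ℝ} (hF : ∀ᶠ v in 𝓝 u, ContDiffAt ℝ ∞ F v)
    (h0 : F u = 0) (hu : fderiv ℝ F u (0, 1) ≠ 0) :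
    ∃ ψ : E → ℝ, ψ u.1 = u.2 ∧ (∀ᶠ x in 𝓝 u.1, ContDiffAt ℝ ∞ ψ x) ∧
      ∀ᶠ v in 𝓝 u, F v = 0 ↔ ψ v.1 = v.2 := by
  have hne : (∞ : WithTop ℕ∞) ≠ 0 := by simp
  have inv : ∀ v, fderiv ℝ F v (0, 1) ≠ 0 →
      (fderiv ℝ F v ∘L .inr ℝ E ℝ).IsInvertible := by
    intro v hv
    refine ⟨ContinuousLinearEquiv.unitsEquivAut ℝ (Units.mk0 _ hv), ?_⟩
    ext
    simp
  have hFu := hF.self_of_nhds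
  set ψ := hFu.implicitFunction hne (inv u hu) with hψ
  have hψu : ψ u.1 = u.2 := hFu.implicitFunction_apply_self hne (inv u hu)
  have hiff : ∀ᶠ v in 𝓝 u, F v = 0 ↔ ψ v.1 = v.2 := by
    have := hFu.eventually_apply_eq_iff_implicitFunction hne (inv u hu)
    rwa [h0] at this
  have hψc : ContinuousAt ψ u.1 := (hFu.contDiffAt_implicitFunction hne (inv u hu)).continuousAt
  refine ⟨ψ, hψu, ?_, hiff⟩
  have hpar : ∀ᶠ v in 𝓝 u, fderiv ℝ F v (0, 1) ≠ 0 := by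
    have : ContinuousAt (fun v => fderiv ℝ F v (0, 1)) u :=
      (hFu.continuousAt_fderiv hne).clm_apply continuousAt_const
    exact this.eventually_ne hu
  have hcur : Tendsto (fun x => (x, ψ x)) (𝓝 u.1) (𝓝 u) := by
    have : ContinuousAt (fun x => (x, ψ x)) u.1 := continuousAt_id.prodMk hψc
    have h2 : (u.1, ψ u.1) = u := by rw [hψu]
    simpa [ContinuousAt, h2] using this
  filter_upwards [hcur.eventually (hiff.eventually_nhds.and (hF.and hpar))] with x hx
  obtain ⟨hx1, hx2, hx3⟩ := hx
  have hFx : F (x, ψ x) = 0 := hx1.self_of_nhds.mpr rfl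
  have h1 := hx2.eventually_apply_implicitFunction hne (inv _ hx3)
  have h2 := hx2.contDiffAt_implicitFunction hne (inv _ hx3)
  have h3 := hx2.implicitFunction_apply_self hne (inv _ hx3)
  set ψ' := hx2.implicitFunction hne (inv _ hx3)
  simp only at h1 h2 h3
  refine h2.congr_of_eventuallyEq ?_
  have hcur' : Tendsto (fun y => (y, ψ' y)) (𝓝 x) (𝓝 (x, ψ x)) := by
    have : ContinuousAt (fun y => (y, ψ' y)) x := continuousAt_id.prodMk h2.continuousAt
    simpa [ContinuousAt, h3] using this
  filter_upwards [h1, hcur'.eventually hx1] with y hy1 hy2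
  rw [hFx] at hy1
  exact hy2.mp hy1

/-- A function that is smooth near `0` agrees near `0` with a globally smooth one. -/
theorem exists_contDiff_eventuallyEq {E : Type*} [NormedAddCommGroup E] [NormedSpace ℝ E]
    [FiniteDimensional ℝ E] {ψ : E → ℝ} {a : E} (hψ : ∀ᶠ x in 𝓝 a, ContDiffAt ℝ ∞ ψ x) :
    ∃ f : E → ℝ, ContDiff ℝ ∞ f ∧ f =ᶠ[𝓝 a] ψ := by
  obtain ⟨r, hr, hball⟩ := Metric.eventually_nhds_iff_ball.mp hψ
  let χ : ContDiffBump a := ⟨r / 4, r / 2, by positivity, by linarith⟩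
  refine ⟨fun x => χ x * ψ x, contDiff_iff_contDiffAt.mpr fun x => ?_, ?_⟩
  · by_cases hx : x ∈ Metric.ball a r
    · exact χ.contDiffAt.mul (hball x hx)
    · have hx' : x ∉ tsupport χ := by
        rw [χ.tsupport_eq]
        intro h
        refine hx (Metric.closedBall_subset_ball ?_ h)
        change r / 2 < r
        linarith
      have : (fun y => χ y * ψ y) =ᶠ[𝓝 x] fun _ => 0 := by
        filter_upwards [notMem_tsupport_iff_eventuallyEq.mp hx'] with y hy
        simp [hy]
      exact contDiffAt_const.congr_of_eventuallyEq this
  · filter_upwards [χ.eventuallyEq_one] with x hx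
    simp [hx]

/-- The linear isometric embedding of `ℝⁿ` onto the hyperplane spanned by all vectors but the last
of an orthonormal basis of `ℝⁿ⁺¹`. -/
def hyperplaneEmbedding {n : ℕ} (b : OrthonormalBasis (Fin (n + 1)) ℝ (Euc (n + 1))) :
    Euc n →L[ℝ] Euc (n + 1) :=
  ∑ i : Fin n, (EuclideanSpace.proj i : Euc n →L[ℝ] ℝ).smulRight (b i.castSucc)

/-- The parametrization of the graph of `f`, in the coordinate system with origin `p` and
orthonormal axes `b`; the last axis is the vertical one. -/
def graphMap {n : ℕ} (b : OrthonormalBasis (Fin (n + 1)) ℝ (Euc (n + 1))) (p : Euc (n + 1))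
    (f : Euc n → ℝ) (x : Euc n) : Euc (n + 1) :=
  p + (hyperplaneEmbedding b x + f x • b (Fin.last n))

section Frame

variable {n : ℕ} (b : OrthonormalBasis (Fin (n + 1)) ℝ (Euc (n + 1)))

theorem hyperplaneEmbedding_apply (x : Euc n) :
    hyperplaneEmbedding b x = ∑ i : Fin n, x i • b i.castSucc := by
  simp [hyperplaneEmbedding]

theorem inner_castSucc_frame (x : Euc n) (t : ℝ) (i : Fin n) :
    inner ℝ (b i.castSucc) (hyperplaneEmbedding b x + t • b (Fin.last n)) = x i := by
  rw [hyperplaneEmbedding_apply, inner_add_right, inner_sum, inner_smul_right]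
  simp [inner_smul_right, b.inner_eq_ite, Fin.castSucc_ne_last]

theorem inner_last_frame (x : Euc n) (t : ℝ) :
    inner ℝ (b (Fin.last n)) (hyperplaneEmbedding b x + t • b (Fin.last n)) = t := by
  rw [hyperplaneEmbedding_apply, inner_add_right, inner_sum, inner_smul_right]
  simp [inner_smul_right, b.inner_eq_ite, (Fin.castSucc_ne_last _).symm]

theorem norm_frame_sq (x : Euc n) (t : ℝ) :
    ‖hyperplaneEmbedding b x + t • b (Fin.last n)‖ ^ 2 = ‖x‖ ^ 2 + t ^ 2 := by
  rw [← b.sum_sq_norm_inner_right, Fin.sum_univ_castSucc]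
  simp only [inner_castSucc_frame, inner_last_frame, EuclideanSpace.norm_sq_eq, Real.norm_eq_abs,
    sq_abs]

theorem frame_inner_eq (y : Euc (n + 1)) :
    hyperplaneEmbedding b (WithLp.toLp 2 fun i : Fin n => inner ℝ (b i.castSucc) y) +
      (inner ℝ (b (Fin.last n)) y : ℝ) • b (Fin.last n) = y := by
  rw [hyperplaneEmbedding_apply]
  conv_rhs => rw [← b.sum_repr' y, Fin.sum_univ_castSucc]

end Frame

/-- The mean value inequality for functions of polynomial growth: if the derivative of `g` is
`O(‖x‖ ^ k)` on the unit ball and `g 0 = 0`, then `g` is `O(‖x‖ ^ (k + 1))` there. -/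
theorem norm_le_mul_pow_of_norm_fderiv_le {E G : Type*} [NormedAddCommGroup E] [NormedSpace ℝ E]
    [NormedAddCommGroup G] [NormedSpace ℝ G] {g : E → G} {g' : E → E →L[ℝ] G} {C : ℝ} (hC : 0 ≤ C)
    {k : ℕ} (hg : ∀ x, HasFDerivAt g (g' x) x) (h0 : g 0 = 0)
    (hb : ∀ x, ‖x‖ ≤ 1 → ‖g' x‖ ≤ C * ‖x‖ ^ k) {x : E} (hx : ‖x‖ ≤ 1) :
    ‖g x‖ ≤ C * ‖x‖ ^ (k + 1) := by
  have h := (convex_closedBall (0 : E) ‖x‖).norm_image_sub_le_of_norm_hasFDerivWithin_le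
    (f := g) (f' := g') (C := C * ‖x‖ ^ k) (x := 0) (y := x)
    (fun y _ => (hg y).hasFDerivWithinAt) (fun y hy => ?_) (by simp) (by simp)
  · simpa [h0, pow_succ, mul_assoc] using h
  · rw [mem_closedBall_zero_iff] at hy
    exact (hb y (hy.trans hx)).trans (by gcongr)

theorem exists_norm_fderiv_le_on_unit_ball {n : ℕ} {G : Type*} [NormedAddCommGroup G]
    [NormedSpace ℝ G] {g : Euc n → G} (hg : ContDiff ℝ ∞ g) :
    ∃ C, ∀ x, ‖x‖ ≤ 1 → ‖fderiv ℝ g x‖ ≤ C := by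
  obtain ⟨C, hC⟩ := (isCompact_closedBall (0 : Euc n) 1).exists_bound_of_continuousOn
    (hg.continuous_fderiv (by simp)).continuousOn
  exact ⟨C, fun x hx => hC x (by simpa using hx)⟩

/-- Third order Taylor estimate for a function vanishing to first order at `0`, together with the
estimate for its derivative. The bound on the third derivative is integrated three times. -/
theorem exists_taylor_bound {n : ℕ} {f : Euc n → ℝ} (hf : ContDiff ℝ ∞ f) (h0 : f 0 = 0)
    (h1 : fderiv ℝ f 0 = 0) {κ : Fin n → ℝ}
    (h2 : ∀ u v, fderiv ℝ (fderiv ℝ f) 0 u v = ∑ i, κ i * u i * v i) :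
    ∃ C, 0 ≤ C ∧ (∀ x, ‖x‖ ≤ 1 → |f x - osculatingQuadric κ x| ≤ C * ‖x‖ ^ 3) ∧
      ∀ x, ‖x‖ ≤ 1 → ∀ v, |fderiv ℝ f x v - ∑ i, κ i * x i * v i| ≤ C * ‖x‖ ^ 2 * ‖v‖ := by
  set B := fderiv ℝ (fderiv ℝ f) 0 with hB
  have hf1 : ContDiff ℝ ∞ (fderiv ℝ f) := hf.fderiv_right (by simp)
  have hf2 : ContDiff ℝ ∞ (fderiv ℝ (fderiv ℝ f)) := hf1.fderiv_right (by simp)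
  obtain ⟨C, hC⟩ := exists_norm_fderiv_le_on_unit_ball hf2
  have hC0 : 0 ≤ C := (norm_nonneg _).trans (hC 0 (by simp))
  have b2 : ∀ x : Euc n, ‖x‖ ≤ 1 → ‖fderiv ℝ (fderiv ℝ f) x - B‖ ≤ C * ‖x‖ ^ 1 := fun x hx =>
    norm_le_mul_pow_of_norm_fderiv_le (g := fun x => fderiv ℝ (fderiv ℝ f) x - B) (k := 0) hC0
      (fun x => ((hf2.differentiable (by simp)) x).hasFDerivAt.sub_const B) (by simp [hB])
      (fun x hx => by simpa using hC x hx) hx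
  have b1 : ∀ x : Euc n, ‖x‖ ≤ 1 → ‖fderiv ℝ f x - B x‖ ≤ C * ‖x‖ ^ 2 := fun x hx =>
    norm_le_mul_pow_of_norm_fderiv_le (g := fun x => fderiv ℝ f x - B x) (k := 1) hC0
      (fun x => ((hf1.differentiable (by simp)) x).hasFDerivAt.sub B.hasFDerivAt)
      (by simp [h1]) b2 hx
  have hq : ∀ x : Euc n, osculatingQuadric κ x = (B x x) / 2 := fun x => by
    simp only [osculatingQuadric, h2, pow_two, mul_assoc]
  have hqd : ∀ x : Euc n, HasFDerivAt (osculatingQuadric κ) (B x) x := by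
    intro x
    have h := ((B.hasFDerivAt (x := x)).clm_apply (hasFDerivAt_id x)).const_mul (1 / 2 : ℝ)
    refine (h.congr_fderiv ?_).congr_of_eventuallyEq (Eventually.of_forall fun y => ?_)
    · ext v
      have hs : B v x = B x v := by
        rw [h2, h2]; exact Finset.sum_congr rfl fun i _ => by ring
      simp [hs]
      ring
    · simp only [hq, id]; ring
  refine ⟨C, hC0, fun x hx => ?_, fun x hx v => ?_⟩
  · exact norm_le_mul_pow_of_norm_fderiv_le (g := fun x => f x - osculatingQuadric κ x) (k := 2)
      hC0 (fun x => ((hf.differentiable (by simp)) x).hasFDerivAt.sub (hqd x))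
      (by simp [h0, hq]) b1 hx
  · have := (fderiv ℝ f x - B x).le_opNorm v
    rw [← h2]
    exact this.trans (mul_le_mul_of_nonneg_right (b1 x hx) (norm_nonneg _))

section Hypersurface

variable {n : ℕ} {S : Set (Euc (n + 1))} {p : Euc (n + 1)}

/-- The differential of a defining function of a hypersurface annihilates its tangent space. -/
theorem fderiv_eq_zero_of_mem_tangentSpaceAt {d : ℕ} {S U : Set (Euc d)} {p : Euc d} {F : Euc d → ℝ}
    (hU : U ∈ 𝓝 p) (hF : DifferentiableAt ℝ F p) (hS : ∀ x ∈ S ∩ U, F x = 0) {v : Euc d}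
    (hv : v ∈ tangentSpaceAt S p) : fderiv ℝ F p v = 0 := by
  suffices tangentSpaceAt S p ≤ LinearMap.ker (fderiv ℝ F p).toLinearMap from this hv
  refine Submodule.span_le.mpr ?_
  rintro _ ⟨γ, hγ, hγS, hγ0, rfl⟩
  have hγd : HasDerivAt γ (deriv γ 0) 0 := (hγ.differentiableAt (by simp)).hasDerivAt
  have hc : HasDerivAt (F ∘ γ) (fderiv ℝ F p (deriv γ 0)) 0 :=
    HasFDerivAt.comp_hasDerivAt 0 (by rw [hγ0]; exact hF.hasFDerivAt) hγd
  have hz : F ∘ γ =ᶠ[𝓝 0] fun _ => (0 : ℝ) := by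
    have hγU : ∀ᶠ t in 𝓝 (0 : ℝ), γ t ∈ U := by
      have := hγ.continuousAt
      rw [ContinuousAt, hγ0] at this
      exact this hU
    filter_upwards [hγS, hγU] with t h1 h2 using hS _ ⟨h1, h2⟩
  exact hc.unique ((hasDerivAt_const (0 : ℝ) (0 : ℝ)).congr_of_eventuallyEq hz)

/-- Near `p`, a hypersurface is a smooth graph over any tangent hyperplane at `p`. -/
theorem exists_graph_of_isSmoothHypersurface (hS : IsSmoothHypersurface S) (hp : p ∈ S)
    (b : OrthonormalBasis (Fin (n + 1)) ℝ (Euc (n + 1)))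
    (hb : ∀ i : Fin n, b i.castSucc ∈ tangentSpaceAt S p) :
    ∃ f : Euc n → ℝ, ContDiff ℝ ∞ f ∧ f 0 = 0 ∧ ∀ᶠ z : Euc n × ℝ in 𝓝 0,
      (p + (hyperplaneEmbedding b z.1 + z.2 • b (Fin.last n)) ∈ S ↔ f z.1 = z.2) := by
  obtain ⟨U, F, hU, hpU, hF, hF', hSU⟩ := hS p hp
  let L : Euc n × ℝ →L[ℝ] Euc (n + 1) :=
    (hyperplaneEmbedding b).coprod ((ContinuousLinearMap.id ℝ ℝ).smulRight (b (Fin.last n)))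
  have hL : ∀ z, L z = hyperplaneEmbedding b z.1 + z.2 • b (Fin.last n) := fun z => by simp [L]
  have hzero : ∀ x ∈ S ∩ U, F x = 0 := fun x hx => by
    rw [hSU] at hx; exact hx.2
  have hFp : ContDiffAt ℝ ∞ F p := hF.contDiffAt (hU.mem_nhds hpU)
  have hN : fderiv ℝ F p (b (Fin.last n)) ≠ 0 := by
    intro h
    refine hF' p hpU (ContinuousLinearMap.ext fun y => ?_)
    rw [← b.sum_repr' y, map_sum, Fin.sum_univ_castSucc]
    simp only [map_smul, h, smul_zero, add_zero, zero_apply]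
    refine Finset.sum_eq_zero fun i _ => ?_
    rw [fderiv_eq_zero_of_mem_tangentSpaceAt (hU.mem_nhds hpU) (hFp.differentiableAt (by simp))
      hzero (hb i), smul_zero]
  have hLc : Continuous fun z => p + L z := by fun_prop
  have hUz : ∀ᶠ z in 𝓝 (0 : Euc n × ℝ), p + L z ∈ U := by
    have : ContinuousAt (fun z => p + L z) 0 := hLc.continuousAt
    refine this (hU.mem_nhds ?_)
    simpa using hpU
  obtain ⟨ψ, hψ0, hψ, hiff⟩ := exists_contDiffAt_implicitFunction
    (F := fun z : Euc n × ℝ => F (p + L z)) (u := 0)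
    (by
      filter_upwards [hUz] with z hz
      exact ContDiffAt.comp z (hF.contDiffAt (hU.mem_nhds hz)) (by fun_prop))
    (by simpa using hzero p ⟨hp, hpU⟩)
    (by
      have h1 : HasFDerivAt (fun z : Euc n × ℝ => F (p + L z)) (fderiv ℝ F p ∘L L) 0 := by
        refine HasFDerivAt.comp (g := F) 0 ?_ (L.hasFDerivAt.const_add p)
        simpa using (hFp.differentiableAt (by simp)).hasFDerivAt
      rw [h1.fderiv]
      simpa [hL] using hN)
  obtain ⟨f, hf, hfψ⟩ := exists_contDiff_eventuallyEq hψ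
  refine ⟨f, hf, by simpa using hfψ.self_of_nhds.trans hψ0, ?_⟩
  have hfst : Tendsto (Prod.fst : Euc n × ℝ → Euc n) (𝓝 0) (𝓝 0) := continuous_fst.tendsto _
  filter_upwards [hiff, hUz, hfst.eventually hfψ] with z hz1 hz2 hz3
  rw [← hL, hz3, ← hz1]
  constructor
  · exact fun h => hzero _ ⟨h, hz2⟩
  · intro h
    have : p + L z ∈ S ∩ U := by rw [hSU]; exact ⟨hz2, h⟩
    exact this.1

/-- The coordinate axes given by a principal frame and the unit normal. -/
theorem exists_orthonormalBasis_extending {N : Euc (n + 1) → Euc (n + 1)} (hp : p ∈ S)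
    (hN : IsUnitNormalFieldAround S p N) (e : OrthonormalBasis (Fin n) ℝ (tangentSpaceAt S p)) :
    ∃ b : OrthonormalBasis (Fin (n + 1)) ℝ (Euc (n + 1)),
      (∀ i : Fin n, b i.castSucc = e i) ∧ b (Fin.last n) = N p := by
  obtain ⟨U, hU, hpU, -, hNU⟩ := hN
  obtain ⟨hN1, hN2⟩ := hNU p ⟨hp, hpU⟩
  let v : Fin (n + 1) → Euc (n + 1) := Fin.snoc (fun i => (e i : Euc (n + 1))) (N p)
  have hv : Orthonormal ℝ v := by
    rw [orthonormal_iff_ite]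
    intro i j
    have he := orthonormal_iff_ite.mp e.orthonormal
    induction i using Fin.lastCases with
    | last =>
      induction j using Fin.lastCases with
      | last => simp [v, hN1]
      | cast j => simp [v, (Fin.castSucc_ne_last _).symm, hN2 _ (e j).2]
    | cast i =>
      induction j using Fin.lastCases with
      | last =>
        simp [v, Fin.castSucc_ne_last, real_inner_comm, hN2 _ (e i).2]
      | cast j => simpa [v] using he i j
  obtain ⟨b, hb⟩ := Orthonormal.exists_orthonormalBasis_extension_of_card_eq (v := v)
    (s := Set.univ) (by simp) (hv.comp _ Subtype.val_injective)
  exact ⟨b, fun i => by simp [hb, v], by simp [hb, v]⟩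

theorem contDiff_graphMap (b : OrthonormalBasis (Fin (n + 1)) ℝ (Euc (n + 1))) {f : Euc n → ℝ}
    (hf : ContDiff ℝ ∞ f) : ContDiff ℝ ∞ (graphMap b p f) := by
  unfold graphMap
  fun_prop

theorem hasFDerivAt_graphMap (b : OrthonormalBasis (Fin (n + 1)) ℝ (Euc (n + 1))) {f : Euc n → ℝ}
    (hf : ContDiff ℝ ∞ f) (x : Euc n) : HasFDerivAt (graphMap b p f)
      (hyperplaneEmbedding b + (fderiv ℝ f x).smulRight (b (Fin.last n))) x :=
  ((hyperplaneEmbedding b).hasFDerivAt.add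
    (((hf.differentiable (by simp)) x).hasFDerivAt.smul_const _)).const_add p

/-- The normal field is orthogonal to the graph near `p`. -/
theorem inner_normal_fderiv_graphMap_eq_zero {N : Euc (n + 1) → Euc (n + 1)}
    (hN : IsUnitNormalFieldAround S p N) (b : OrthonormalBasis (Fin (n + 1)) ℝ (Euc (n + 1)))
    {f : Euc n → ℝ} (hf : ContDiff ℝ ∞ f) (h0 : f 0 = 0) (hS : ∀ᶠ z : Euc n × ℝ in 𝓝 0,
      (p + (hyperplaneEmbedding b z.1 + z.2 • b (Fin.last n)) ∈ S ↔ f z.1 = z.2)) :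
    ∀ᶠ x in 𝓝 (0 : Euc n), ∀ v, inner ℝ (N (graphMap b p f x))
      (hyperplaneEmbedding b v + fderiv ℝ f x v • b (Fin.last n)) = 0 := by
  obtain ⟨U, hU, hpU, -, hNU⟩ := hN
  have hcur : Tendsto (fun x => (x, f x)) (𝓝 (0 : Euc n)) (𝓝 0) := by
    have : Continuous fun x => (x, f x) := continuous_id.prodMk hf.continuous
    simpa [h0, Prod.mk_zero_zero] using this.tendsto 0
  have hmem : ∀ᶠ x in 𝓝 (0 : Euc n), graphMap b p f x ∈ S := by
    filter_upwards [hcur.eventually hS] with x hx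
    exact hx.mpr rfl
  have hmemU : ∀ᶠ x in 𝓝 (0 : Euc n), graphMap b p f x ∈ U := by
    refine (contDiff_graphMap (p := p) b hf).continuous.continuousAt (hU.mem_nhds ?_)
    simpa [graphMap, h0] using hpU
  filter_upwards [hmem.eventually_nhds, hmemU] with x hx hxU v
  refine (hNU _ ⟨hx.self_of_nhds, hxU⟩).2 _ (Submodule.subset_span ?_)
  have hline : HasDerivAt (fun t : ℝ => x + t • v) v 0 := by
    simpa using ((hasDerivAt_id (0 : ℝ)).smul_const v).const_add x
  refine ⟨fun t => graphMap b p f (x + t • v), ?_, ?_, by simp, ?_⟩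
  · exact ((contDiff_graphMap b hf).comp (by fun_prop)).contDiffAt
  · have : Tendsto (fun t : ℝ => x + t • v) (𝓝 0) (𝓝 x) := by
      simpa using hline.continuousAt.tendsto
    exact this.eventually hx
  · have h := HasFDerivAt.comp_hasDerivAt (l := graphMap b p f) 0
      (by simpa using hasFDerivAt_graphMap (p := p) b hf x) hline
    simpa [Function.comp_def] using h.deriv

/-- In the frame of the principal directions and the normal, the graph function is critical at `0`
and its Hessian is the second fundamental form, hence diagonal with the principal curvatures as
entries. The Hessian is found by differentiating the orthogonality of the normal field to the
graph. -/
theorem fderiv_graph_eq_zero_and_hessian {N : Euc (n + 1) → Euc (n + 1)}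
    (hN : IsUnitNormalFieldAround S p N) {κ : Fin n → ℝ}
    {e : OrthonormalBasis (Fin n) ℝ (tangentSpaceAt S p)} (he : IsPrincipalFrame S p N κ e)
    {b : OrthonormalBasis (Fin (n + 1)) ℝ (Euc (n + 1))} (hbe : ∀ i : Fin n, b i.castSucc = e i)
    (hbN : b (Fin.last n) = N p) {f : Euc n → ℝ} (hf : ContDiff ℝ ∞ f) (h0 : f 0 = 0)
    (hS : ∀ᶠ z : Euc n × ℝ in 𝓝 0,
      (p + (hyperplaneEmbedding b z.1 + z.2 • b (Fin.last n)) ∈ S ↔ f z.1 = z.2)) :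
    fderiv ℝ f 0 = 0 ∧ ∀ u v, fderiv ℝ (fderiv ℝ f) 0 u v = ∑ i, κ i * u i * v i := by
  have hperp := inner_normal_fderiv_graphMap_eq_zero hN b hf h0 hS
  have hΦ0 : graphMap b p f 0 = p := by simp [graphMap, h0]
  have h1 : fderiv ℝ f 0 = 0 := by
    ext v
    have := hperp.self_of_nhds v
    rwa [hΦ0, ← hbN, inner_last_frame] at this
  refine ⟨h1, fun u v => ?_⟩
  obtain ⟨U, hU, hpU, hNs, -⟩ := hN
  have hNd : HasFDerivAt N (fderiv ℝ N p) (graphMap b p f 0) := by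
    rw [hΦ0]
    exact ((hNs.contDiffAt (hU.mem_nhds hpU)).differentiableAt (by simp)).hasFDerivAt
  have hA := hNd.comp 0 (hasFDerivAt_graphMap (p := p) b hf 0)
  have hB : HasFDerivAt (fun x => hyperplaneEmbedding b v + fderiv ℝ f x v • b (Fin.last n))
      (((fderiv ℝ (fderiv ℝ f) 0).flip v).smulRight (b (Fin.last n))) 0 := by
    have hf1 : ContDiff ℝ ∞ (fderiv ℝ f) := hf.fderiv_right (by simp)
    have h := (((hf1.differentiable (by simp)) 0).hasFDerivAt.clm_apply
      (hasFDerivAt_const v (0 : Euc n))).smul_const (b (Fin.last n))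
    refine (h.const_add (hyperplaneEmbedding b v)).congr_fderiv ?_
    ext w
    simp
  have hAB := (hA.inner ℝ hB).unique ((hasFDerivAt_const (0 : ℝ) (0 : Euc n)).congr_of_eventuallyEq
    (hperp.mono fun x hx => hx v))
  have hu := congrArg (fun l : Euc n →L[ℝ] ℝ => l u) hAB
  have hW : fderiv ℝ N p (hyperplaneEmbedding b u) = -∑ i, (κ i * u i) • b i.castSucc := by
    rw [hyperplaneEmbedding_apply, map_sum, ← Finset.sum_neg_distrib]
    refine Finset.sum_congr rfl fun i _ => ?_
    have := he i
    rw [weingartenMap, neg_apply, ← hbe] at this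
    rw [map_smul, ← neg_neg (fderiv ℝ N p _), this, smul_neg, smul_smul, mul_comm]
  have hin : inner ℝ (fderiv ℝ N p (hyperplaneEmbedding b u)) (hyperplaneEmbedding b v) =
      -∑ i, κ i * u i * v i := by
    rw [hW, inner_neg_left, sum_inner]
    congr 1
    refine Finset.sum_congr rfl fun i _ => ?_
    have := inner_castSucc_frame b v 0 i
    rw [zero_smul, add_zero] at this
    rw [inner_smul_left, this]
    simp
  simp [h1, hΦ0, ← hbN, inner_smul_right, hin] at hu
  linarith

end Hypersurface

/-- Small patches of the hypersurface are the images, under the graph parametrization, of the sets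
cut out by the ball. -/
theorem eventually_patch_eq_image {n : ℕ} {S : Set (Euc (n + 1))} {p : Euc (n + 1)}
    {b : OrthonormalBasis (Fin (n + 1)) ℝ (Euc (n + 1))} {f : Euc n → ℝ}
    (hS : ∀ᶠ z : Euc n × ℝ in 𝓝 0,
      (p + (hyperplaneEmbedding b z.1 + z.2 • b (Fin.last n)) ∈ S ↔ f z.1 = z.2)) :
    ∀ᶠ ε in 𝓝[>] (0 : ℝ), patch S p ε = graphMap b p f '' patchDomain f ε := by
  obtain ⟨δ, hδ, hball⟩ := Metric.eventually_nhds_iff_ball.mp hS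
  filter_upwards [Ioo_mem_nhdsGT hδ] with ε ⟨hε, hεδ⟩
  have hz : ∀ (x : Euc n) (t : ℝ), ‖x‖ ^ 2 + t ^ 2 ≤ ε ^ 2 →
      (p + (hyperplaneEmbedding b x + t • b (Fin.last n)) ∈ S ↔ f x = t) := by
    intro x t h
    refine hball (x, t) ?_
    rw [mem_ball_zero_iff, Prod.norm_def, max_lt_iff]
    constructor
    · exact (abs_le_of_sq_le_sq' (by nlinarith [sq_nonneg t]) hε.le).2.trans_lt hεδ
    · exact (abs_le_of_sq_le_sq (by nlinarith [sq_nonneg ‖x‖]) hε.le).trans_lt hεδ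
  ext y
  constructor
  · rintro ⟨hyS, hy⟩
    set x : Euc n := WithLp.toLp 2 fun i : Fin n => inner ℝ (b i.castSucc) (y - p) with hx
    set t : ℝ := inner ℝ (b (Fin.last n)) (y - p) with ht
    have hxy : hyperplaneEmbedding b x + t • b (Fin.last n) = y - p := frame_inner_eq b (y - p)
    have hle : ‖x‖ ^ 2 + t ^ 2 ≤ ε ^ 2 := by
      rw [← norm_frame_sq b, hxy]
      rw [mem_closedBall_iff_norm] at hy
      gcongr
    have hft : f x = t := (hz x t hle).mp (by rw [hxy]; simpa using hyS)
    refine ⟨x, ?_, ?_⟩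
    · change ‖x‖ ^ 2 + f x ^ 2 ≤ ε ^ 2
      rwa [hft]
    · rw [graphMap, hft, hxy]
      simp
  · rintro ⟨x, hx, rfl⟩
    have hx' : ‖x‖ ^ 2 + f x ^ 2 ≤ ε ^ 2 := hx
    refine ⟨(hz x (f x) hx').mpr rfl, ?_⟩
    rw [mem_closedBall_iff_norm, graphMap, add_sub_cancel_left]
    rw [← norm_frame_sq b] at hx'
    exact (abs_le_of_sq_le_sq' hx' hε.le).2

theorem inner_frame {n : ℕ} (b : OrthonormalBasis (Fin (n + 1)) ℝ (Euc (n + 1))) (x y : Euc n)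
    (s t : ℝ) : inner ℝ (hyperplaneEmbedding b x + s • b (Fin.last n))
      (hyperplaneEmbedding b y + t • b (Fin.last n)) = ∑ i, x i * y i + s * t := by
  rw [← b.sum_inner_mul_inner, Fin.sum_univ_castSucc]
  simp only [inner_castSucc_frame, inner_last_frame, real_inner_comm (b _)]

/-- The area density `√(1 + |∇f|²)` of the graph of `f`. -/
def graphDensity {n : ℕ} (f : Euc n → ℝ) (x : Euc n) : ℝ :=
  √(1 + ∑ i, (fderiv ℝ f x (EuclideanSpace.single i 1)) ^ 2)

theorem one_le_graphDensity {n : ℕ} (f : Euc n → ℝ) (x : Euc n) : 1 ≤ graphDensity f x := by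
  rw [graphDensity, Real.one_le_sqrt]
  have : 0 ≤ ∑ i, (fderiv ℝ f x (EuclideanSpace.single i 1)) ^ 2 :=
    Finset.sum_nonneg fun i _ => sq_nonneg _
  linarith

theorem continuous_graphDensity {n : ℕ} {f : Euc n → ℝ} (hf : ContDiff ℝ ∞ f) :
    Continuous (graphDensity f) := by
  have : Continuous (fderiv ℝ f) := hf.continuous_fderiv (by simp)
  unfold graphDensity
  fun_prop

theorem normDet_graph {n : ℕ} (b : OrthonormalBasis (Fin (n + 1)) ℝ (Euc (n + 1)))
    (l : Euc n →L[ℝ] ℝ) :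
    (hyperplaneEmbedding b + l.smulRight (b (Fin.last n))).toLinearMap.normDet =
      √(1 + ∑ i, (l (EuclideanSpace.single i 1)) ^ 2) := by
  rw [eq_comm, Real.sqrt_eq_iff_eq_sq (by positivity) (LinearMap.normDet_nonneg _)]
  have h := LinearMap.normDet_sq_eq_det_gram
    (hyperplaneEmbedding b + l.smulRight (b (Fin.last n))).toLinearMap
    (EuclideanSpace.basisFun (Fin n) ℝ)
  have hgram : Matrix.gram ℝ (fun i =>
      (hyperplaneEmbedding b + l.smulRight (b (Fin.last n))).toLinearMap
        (EuclideanSpace.basisFun (Fin n) ℝ i)) =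
      1 + Matrix.replicateCol Unit (fun i => l (EuclideanSpace.single i 1)) *
        Matrix.replicateRow Unit (fun i => l (EuclideanSpace.single i 1)) := by
    ext i j
    simp only [Matrix.gram_apply, EuclideanSpace.basisFun_apply, ContinuousLinearMap.coe_coe,
      add_apply, ContinuousLinearMap.smulRight_apply, inner_frame, Matrix.one_apply,
      Matrix.mul_apply, Finset.univ_unique, Finset.sum_singleton, Matrix.replicateCol_apply,
      Matrix.replicateRow_apply, Matrix.add_apply]
    congr 1
    simp [eq_comm]
  rw [hgram, Matrix.det_one_add_replicateCol_mul_replicateRow] at h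
  have h' : (hyperplaneEmbedding b + l.smulRight (b (Fin.last n))).toLinearMap.normDet ^ 2 =
    1 + (fun i => l (EuclideanSpace.single i 1)) ⬝ᵥ fun i => l (EuclideanSpace.single i 1) := h
  rw [h', dotProduct]
  simp only [pow_two]

section Area

variable {n : ℕ} (b : OrthonormalBasis (Fin (n + 1)) ℝ (Euc (n + 1))) (p : Euc (n + 1))
  {f : Euc n → ℝ}

theorem injective_graph_derivative (l : Euc n →L[ℝ] ℝ) :
    Function.Injective (hyperplaneEmbedding b + l.smulRight (b (Fin.last n))) := by
  intro x y h
  ext i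
  rw [← inner_castSucc_frame b x (l x) i, ← inner_castSucc_frame b y (l y) i]
  exact congrArg (inner ℝ (b i.castSucc)) h

theorem measurableEmbedding_graphMap (hf : Continuous f) :
    MeasurableEmbedding (graphMap b p f) := by
  refine Continuous.measurableEmbedding (by unfold graphMap; fun_prop) fun x y h => ?_
  ext i
  rw [← inner_castSucc_frame b x (f x) i, ← inner_castSucc_frame b y (f y) i]
  exact congrArg (inner ℝ (b i.castSucc)) (add_left_cancel h)

/-- Surface integrals over a graph. -/
theorem setIntegral_graph (hf : ContDiff ℝ ∞ f) {D : Set (Euc n)} (hD : MeasurableSet D)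
    {G : Type*} [NormedAddCommGroup G] [NormedSpace ℝ G] (g : Euc (n + 1) → G) :
    ∫ y in graphMap b p f '' D, g y ∂(μHE[n]) =
      ∫ x in D, graphDensity f x • g (graphMap b p f x) := by
  have h := setIntegral_image_euclideanHausdorffMeasure (measurableEmbedding_graphMap b p
    hf.continuous) (fun x => (contDiff_graphMap b hf).contDiffAt.hasStrictFDerivAt'
      (hasFDerivAt_graphMap b hf x) (by simp)) (fun x => injective_graph_derivative b _)
    (by
      simp only [normDet_graph]
      exact (continuous_graphDensity hf).measurable) hD g
  simp only [normDet_graph] at h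
  exact h

/-- The area of a graph. -/
theorem euclideanHausdorffMeasure_graph (hf : ContDiff ℝ ∞ f) {D : Set (Euc n)}
    (hD : MeasurableSet D) :
    μHE[n] (graphMap b p f '' D) = ∫⁻ x in D, ENNReal.ofReal (graphDensity f x) := by
  have h := euclideanHausdorffMeasure_image_eq_lintegral (measurableEmbedding_graphMap b p
    hf.continuous) (fun x => (contDiff_graphMap b hf).contDiffAt.hasStrictFDerivAt'
      (hasFDerivAt_graphMap b hf x) (by simp)) (fun x => injective_graph_derivative b _) hD
  simp only [normDet_graph] at h
  exact h

end Area

/-! ### Expansion of the moments of a small patch -/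

/-- The second order expansion `√(1 + |∇f|²) = 1 + ½ ∑ κᵢ² xᵢ² + O(‖x‖³)` of the area density. -/
theorem exists_graphDensity_bound {n : ℕ} {f : Euc n → ℝ} {κ : Fin n → ℝ} {C : ℝ} (hC : 0 ≤ C)
    (h : ∀ x, ‖x‖ ≤ 1 → ∀ v, |fderiv ℝ f x v - ∑ i, κ i * x i * v i| ≤ C * ‖x‖ ^ 2 * ‖v‖) :
    ∃ C', ∀ x, ‖x‖ ≤ 1 →
      |graphDensity f x - (1 + (∑ i, κ i ^ 2 * x i ^ 2) / 2)| ≤ C' * ‖x‖ ^ 3 := by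
  refine ⟨(∑ i, (C + |κ i|) ^ 2) ^ 2 / 8 + (∑ i, C * (C + 2 * |κ i|)) / 2, fun x hx => ?_⟩
  set r := ‖x‖ with hr
  have hr0 : 0 ≤ r := norm_nonneg x
  set D : Fin n → ℝ := fun i => fderiv ℝ f x (EuclideanSpace.single i 1) with hD
  have hxi : ∀ i, |x i| ≤ r := fun i => by simpa using PiLp.norm_apply_le x i
  have hDi : ∀ i, |D i - κ i * x i| ≤ C * r ^ 2 := fun i => by
    have := h x hx (EuclideanSpace.single i 1)
    simpa [Pi.single_apply] using this
  have hκx : ∀ i, |κ i * x i| ≤ |κ i| * r := fun i => by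
    rw [abs_mul]; exact mul_le_mul_of_nonneg_left (hxi i) (abs_nonneg _)
  have hr2 : r ^ 2 ≤ r := by nlinarith
  have hDr : ∀ i, |D i| ≤ (C + |κ i|) * r := fun i => by
    have := abs_add_le (D i - κ i * x i) (κ i * x i)
    rw [sub_add_cancel] at this
    nlinarith [hDi i, hκx i, mul_le_mul_of_nonneg_left hr2 hC]
  have hs0 : 0 ≤ ∑ i, D i ^ 2 := Finset.sum_nonneg fun i _ => sq_nonneg _
  have hs2 : ∑ i, D i ^ 2 ≤ (∑ i, (C + |κ i|) ^ 2) * r ^ 2 := by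
    rw [Finset.sum_mul]
    refine Finset.sum_le_sum fun i _ => ?_
    rw [← mul_pow, ← sq_abs (D i)]
    exact pow_le_pow_left₀ (abs_nonneg _) (hDr i) 2
  have hs1 : |∑ i, D i ^ 2 - ∑ i, κ i ^ 2 * x i ^ 2| ≤ (∑ i, C * (C + 2 * |κ i|)) * r ^ 3 := by
    rw [← Finset.sum_sub_distrib, Finset.sum_mul]
    refine (Finset.abs_sum_le_sum_abs _ _).trans (Finset.sum_le_sum fun i _ => ?_)
    have e : D i ^ 2 - κ i ^ 2 * x i ^ 2 = (D i - κ i * x i) * (D i + κ i * x i) := by ring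
    have h2 : |D i + κ i * x i| ≤ (C + 2 * |κ i|) * r := by
      refine (abs_add_le _ _).trans ?_
      linarith [hDr i, hκx i]
    rw [e, abs_mul]
    calc _ ≤ C * r ^ 2 * ((C + 2 * |κ i|) * r) :=
          mul_le_mul (hDi i) h2 (abs_nonneg _) (by positivity)
      _ = _ := by ring
  set s := ∑ i, D i ^ 2 with hs
  have hJ : graphDensity f x = √(1 + s) := rfl
  have hw : √(1 + s) ^ 2 = 1 + s := Real.sq_sqrt (by linarith)
  have hw1 : 1 ≤ √(1 + s) := Real.one_le_sqrt.mpr (by linarith)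
  set w := √(1 + s)
  have h3 : |w - (1 + s / 2)| ≤ s ^ 2 / 8 := by
    rw [abs_le]
    have : w - (1 + s / 2) = -((w - 1) ^ 2 / 2) := by nlinarith
    have h4 : w - 1 ≤ s / 2 := by nlinarith
    have h5 : (w - 1) ^ 2 ≤ (s / 2) ^ 2 := pow_le_pow_left₀ (by linarith) h4 2
    constructor <;> nlinarith
  have h6 : s ^ 2 ≤ (∑ i, (C + |κ i|) ^ 2) ^ 2 * r ^ 3 := by
    calc s ^ 2 ≤ ((∑ i, (C + |κ i|) ^ 2) * r ^ 2) ^ 2 := pow_le_pow_left₀ hs0 hs2 2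
      _ = (∑ i, (C + |κ i|) ^ 2) ^ 2 * r ^ 4 := by ring
      _ ≤ _ := mul_le_mul_of_nonneg_left (pow_le_pow_of_le_one hr0 hx (by norm_num)) (sq_nonneg _)
  rw [hJ]
  have h7 : w - (1 + (∑ i, κ i ^ 2 * x i ^ 2) / 2) =
      (w - (1 + s / 2)) + (s - ∑ i, κ i ^ 2 * x i ^ 2) / 2 := by ring
  rw [h7]
  refine (abs_add_le _ _).trans ?_
  rw [abs_div, abs_two]
  linarith

/-- The leading term of an integral over the parameter domain of a small patch. -/
theorem exists_patchDomain_leading_term {n : ℕ} (hn : 1 ≤ n) {f : Euc n → ℝ} (hf : Continuous f)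
    (κ : Fin n → ℝ) {C : ℝ}
    (hfq : ∀ x : Euc n, ‖x‖ ≤ 1 → |f x - osculatingQuadric κ x| ≤ C * ‖x‖ ^ 3)
    {g a : Euc n → ℝ} (hg : Continuous g) (ha : Continuous a) {k j : ℕ} (hj : j ≤ 2) {C' : ℝ}
    (hexp : ∀ θ : Euc n, ‖θ‖ = 1 → ∀ r, 0 < r → r ≤ 1 →
      |g (r • θ) - r ^ k * a θ| ≤ C' * r ^ (k + j)) :
    ∃ K, ∀ᶠ ε in 𝓝[>] (0 : ℝ), |(∫ x in patchDomain f ε, g x) -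
      ε ^ (n + k) * (sphereIntegral a / (n + k : ℕ))| ≤ K * ε ^ (n + k + j) := by
  obtain ⟨K, hK⟩ := exists_patchDomain_expansion hn hf κ one_pos hfq hg ha
    (continuous_const (y := (0 : ℝ))) (hj.trans (by norm_num))
    (fun θ hθ r hr hr1 => by simpa using hexp θ hθ r hr hr1)
  set m := sphereIntegral (fun _ : Euc n => 0) / ((n + k : ℕ) + 2) -
    sphereIntegral (fun x => a x * osculatingQuadric κ x ^ 2) / 2
  refine ⟨K + |m|, ?_⟩
  filter_upwards [hK, Ioo_mem_nhdsGT one_pos] with ε h ⟨hε, hε1⟩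
  have h1 : ε ^ (n + k + 2) ≤ ε ^ (n + k + j) := pow_le_pow_of_le_one hε.le hε1.le (by lia)
  have h2 : |ε ^ (n + k + 2) * m| ≤ |m| * ε ^ (n + k + j) := by
    rw [abs_mul, abs_of_pos (pow_pos hε _), mul_comm]
    exact mul_le_mul_of_nonneg_left h1 (abs_nonneg _)
  calc _ = |((∫ x in patchDomain f ε, g x) - (ε ^ (n + k) * (sphereIntegral a / (n + k : ℕ)) +
          ε ^ (n + k + 2) * m)) + ε ^ (n + k + 2) * m| := by congr 1; ring
    _ ≤ K * ε ^ (n + k + j) + |m| * ε ^ (n + k + j) := (abs_add_le _ _).trans (add_le_add h h2)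
    _ = _ := by ring

/-- The moments of a small patch up to second order, in the coordinates given by the tangent
directions and by the height `f`. Only the tangential second moments are needed beyond their leading
term; there the expansion of the area density and the deviation of the domain from a ball enter. -/
theorem exists_moment_bounds {n : ℕ} (hn : 1 ≤ n) {f : Euc n → ℝ} (hf : ContDiff ℝ ∞ f)
    {κ : Fin n → ℝ} {C : ℝ} (hC : 0 ≤ C)
    (hfq : ∀ x : Euc n, ‖x‖ ≤ 1 → |f x - osculatingQuadric κ x| ≤ C * ‖x‖ ^ 3)
    (hdf : ∀ x, ‖x‖ ≤ 1 → ∀ v, |fderiv ℝ f x v - ∑ i, κ i * x i * v i| ≤ C * ‖x‖ ^ 2 * ‖v‖) :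
    (∃ K, ∀ᶠ ε in 𝓝[>] (0 : ℝ), |(∫ x in patchDomain f ε, graphDensity f x) -
      unitBallVolume n * ε ^ n| ≤ K * ε ^ (n + 1)) ∧
    (∃ K, ∀ᶠ ε in 𝓝[>] (0 : ℝ), |(∫ x in patchDomain f ε, graphDensity f x * f x) -
      unitBallVolume n * meanCurvature κ / (2 * (n + 2)) * ε ^ (n + 2)| ≤ K * ε ^ (n + 3)) ∧
    (∃ K, ∀ᶠ ε in 𝓝[>] (0 : ℝ), |(∫ x in patchDomain f ε, graphDensity f x * f x ^ 2) -
      unitBallVolume n * (meanCurvature κ ^ 2 + 2 * ∑ k, κ k ^ 2) / (4 * (n + 2) * (n + 4)) *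
        ε ^ (n + 4)| ≤ K * ε ^ (n + 5)) ∧
    (∀ i, ∃ K, ∀ᶠ ε in 𝓝[>] (0 : ℝ), |∫ x in patchDomain f ε, graphDensity f x * x i| ≤
      K * ε ^ (n + 3)) ∧
    (∀ i, ∃ K, ∀ᶠ ε in 𝓝[>] (0 : ℝ), |∫ x in patchDomain f ε, graphDensity f x * (x i * f x)| ≤
      K * ε ^ (n + 4)) ∧
    ∀ i j, ∃ K, ∀ᶠ ε in 𝓝[>] (0 : ℝ),
      |(∫ x in patchDomain f ε, graphDensity f x * (x i * x j)) -
        if i = j then unitBallVolume n * ε ^ n * (ε ^ 2 / (n + 2) +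
          ε ^ 4 / (8 * (n + 2) * (n + 4)) *
            (meanCurvature κ ^ 2 - 2 * scalarCurvature κ - 4 * meanCurvature κ * κ i)) else 0| ≤
        K * ε ^ (n + 5) := by
  have hn0 : (n : ℝ) ≠ 0 := by positivity
  have hfc := hf.continuous
  have hJc := continuous_graphDensity hf
  have hqc := continuous_osculatingQuadric κ
  obtain ⟨A, hA⟩ := exists_graphDensity_bound hC hdf
  set Q : Euc n → ℝ := fun x => ∑ k, κ k ^ 2 * x k ^ 2 with hQ
  have hQc : Continuous Q := by fun_prop
  obtain ⟨M, hM, hMq⟩ := exists_bound_on_sphere hqc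
  obtain ⟨B, hB, hBQ⟩ := exists_bound_on_sphere hQc
  have hnorm : ∀ θ : Euc n, ‖θ‖ = 1 → ∀ r : ℝ, 0 < r → ‖r • θ‖ = r := fun θ hθ r hr => by
    rw [norm_smul, hθ, mul_one, Real.norm_eq_abs, abs_of_pos hr]
  have hcoord : ∀ θ : Euc n, ‖θ‖ = 1 → ∀ i, |θ i| ≤ 1 := fun θ hθ i => by
    simpa [hθ] using PiLp.norm_apply_le θ i
  have hJ3 : ∀ θ : Euc n, ‖θ‖ = 1 → ∀ r, 0 < r → r ≤ 1 →
      |graphDensity f (r • θ) - 1 - r ^ 2 * Q θ / 2| ≤ |A| * r ^ 3 := fun θ hθ r hr hr1 => by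
    have h := hA (r • θ) (by rw [hnorm θ hθ r hr]; exact hr1)
    rw [hnorm θ hθ r hr] at h
    have e : ∑ i, κ i ^ 2 * (r • θ) i ^ 2 = r ^ 2 * Q θ := by
      simp only [hQ, Finset.mul_sum, PiLp.smul_apply, smul_eq_mul]
      exact Finset.sum_congr rfl fun i _ => by ring
    rw [e, ← sub_sub] at h
    exact h.trans (mul_le_mul_of_nonneg_right (le_abs_self A) (by positivity))
  have hJ1 : ∀ θ : Euc n, ‖θ‖ = 1 → ∀ r, 0 < r → r ≤ 1 →
      |graphDensity f (r • θ) - 1| ≤ (|A| + B) * r ^ 2 := fun θ hθ r hr hr1 => by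
    have h := hJ3 θ hθ r hr hr1
    have h2 : |r ^ 2 * Q θ / 2| ≤ B * r ^ 2 := by
      rw [abs_div, abs_mul, abs_two, abs_of_pos (pow_pos hr 2)]
      nlinarith [hBQ θ hθ, pow_pos hr 2, abs_nonneg (Q θ),
        mul_le_mul_of_nonneg_left (hBQ θ hθ) (pow_pos hr 2).le]
    have h3 : r ^ 3 ≤ r ^ 2 := pow_le_pow_of_le_one hr.le hr1 (by norm_num)
    have h4 := abs_add_le (graphDensity f (r • θ) - 1 - r ^ 2 * Q θ / 2) (r ^ 2 * Q θ / 2)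
    rw [sub_add_cancel] at h4
    nlinarith [mul_le_mul_of_nonneg_left h3 (abs_nonneg A)]
  have hf3 : ∀ θ : Euc n, ‖θ‖ = 1 → ∀ r, 0 < r → r ≤ 1 →
      |f (r • θ) - r ^ 2 * osculatingQuadric κ θ| ≤ C * r ^ 3 := fun θ hθ r hr hr1 => by
    have h := hfq (r • θ) (by rw [hnorm θ hθ r hr]; exact hr1)
    rwa [hnorm θ hθ r hr, osculatingQuadric_smul] at h
  have hf2 : ∀ θ : Euc n, ‖θ‖ = 1 → ∀ r, 0 < r → r ≤ 1 →
      |f (r • θ)| ≤ (C + M) * r ^ 2 := fun θ hθ r hr hr1 => by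
    have h3 : r ^ 3 ≤ r ^ 2 := pow_le_pow_of_le_one hr.le hr1 (by norm_num)
    have h2 : |r ^ 2 * osculatingQuadric κ θ| ≤ M * r ^ 2 := by
      rw [abs_mul, abs_of_pos (pow_pos hr 2), mul_comm]
      exact mul_le_mul_of_nonneg_right (hMq θ hθ) (pow_pos hr 2).le
    have h4 := abs_add_le (f (r • θ) - r ^ 2 * osculatingQuadric κ θ)
      (r ^ 2 * osculatingQuadric κ θ)
    rw [sub_add_cancel] at h4
    nlinarith [hf3 θ hθ r hr hr1, mul_le_mul_of_nonneg_left h3 hC]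
  have hJf : ∀ θ : Euc n, ‖θ‖ = 1 → ∀ r, 0 < r → r ≤ 1 →
      |graphDensity f (r • θ) * f (r • θ) - r ^ 2 * osculatingQuadric κ θ| ≤
        ((|A| + B) * (C + M) + C) * r ^ 3 := fun θ hθ r hr hr1 => by
    have e : graphDensity f (r • θ) * f (r • θ) - r ^ 2 * osculatingQuadric κ θ =
      (graphDensity f (r • θ) - 1) * f (r • θ) + (f (r • θ) - r ^ 2 * osculatingQuadric κ θ) := by
      ring
    rw [e]
    have h5 : |(graphDensity f (r • θ) - 1) * f (r • θ)| ≤ (|A| + B) * (C + M) * r ^ 3 := by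
      rw [abs_mul]
      calc _ ≤ (|A| + B) * r ^ 2 * ((C + M) * r ^ 2) :=
            mul_le_mul (hJ1 θ hθ r hr hr1) (hf2 θ hθ r hr hr1) (abs_nonneg _) (by positivity)
        _ = (|A| + B) * (C + M) * r ^ 4 := by ring
        _ ≤ _ := mul_le_mul_of_nonneg_left (pow_le_pow_of_le_one hr.le hr1 (by norm_num))
            (by positivity)
    linarith [abs_add_le ((graphDensity f (r • θ) - 1) * f (r • θ))
      (f (r • θ) - r ^ 2 * osculatingQuadric κ θ), hf3 θ hθ r hr hr1]
  refine ⟨?_, ?_, ?_, fun i => ?_, fun i => ?_, fun i j => ?_⟩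
  · obtain ⟨K, hK⟩ := exists_patchDomain_leading_term hn hfc κ hfq hJc
      (continuous_const (y := (1 : ℝ))) (k := 0) (j := 1) (by norm_num) (C' := |A| + B)
      (fun θ hθ r hr hr1 => by
        have h3 : r ^ 2 ≤ r := by nlinarith
        have := hJ1 θ hθ r hr hr1
        simp only [pow_zero, one_mul, zero_add, pow_one]
        exact this.trans (mul_le_mul_of_nonneg_left h3 (by positivity)))
    refine ⟨K, hK.mono fun ε h => ?_⟩
    rw [sphereIntegral_one] at h
    convert h using 3
    simp only [add_zero]
    field_simp
  · obtain ⟨K, hK⟩ := exists_patchDomain_leading_term hn hfc κ hfq (g := fun x =>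
      graphDensity f x * f x) (a := osculatingQuadric κ) (by fun_prop) hqc (k := 2)
      (j := 1) (by norm_num) hJf
    refine ⟨K, hK.mono fun ε h => ?_⟩
    rw [sphereIntegral_quadric κ hn] at h
    convert h using 3
    push_cast
    field_simp
  · obtain ⟨K, hK⟩ := exists_patchDomain_leading_term hn hfc κ hfq (g := fun x =>
      graphDensity f x * f x ^ 2) (a := fun x => osculatingQuadric κ x ^ 2) (by fun_prop)
      (by fun_prop) (k := 4) (j := 1) (by norm_num)
      (C' := ((|A| + B) * (C + M) + C) * (C + M) + M * C)
      (fun θ hθ r hr hr1 => by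
        have e : graphDensity f (r • θ) * f (r • θ) ^ 2 - r ^ 4 * osculatingQuadric κ θ ^ 2 =
            (graphDensity f (r • θ) * f (r • θ) - r ^ 2 * osculatingQuadric κ θ) * f (r • θ) +
              r ^ 2 * osculatingQuadric κ θ * (f (r • θ) - r ^ 2 * osculatingQuadric κ θ) := by ring
        rw [e]
        refine (abs_add_le _ _).trans ?_
        have h1 : |(graphDensity f (r • θ) * f (r • θ) - r ^ 2 * osculatingQuadric κ θ) * f (r • θ)|
            ≤ ((|A| + B) * (C + M) + C) * r ^ 3 * ((C + M) * r ^ 2) := by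
          rw [abs_mul]
          exact mul_le_mul (hJf θ hθ r hr hr1) (hf2 θ hθ r hr hr1) (abs_nonneg _) (by positivity)
        have h2 : |r ^ 2 * osculatingQuadric κ θ * (f (r • θ) - r ^ 2 * osculatingQuadric κ θ)| ≤
            r ^ 2 * M * (C * r ^ 3) := by
          rw [abs_mul, abs_mul, abs_of_pos (pow_pos hr 2)]
          exact mul_le_mul (mul_le_mul_of_nonneg_left (hMq θ hθ) (by positivity))
            (hf3 θ hθ r hr hr1) (abs_nonneg _) (by positivity)
        calc _ ≤ _ := add_le_add h1 h2
          _ = _ := by ring)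
    refine ⟨K, hK.mono fun ε h => ?_⟩
    rw [sphereIntegral_quadric_sq κ hn] at h
    convert h using 3
    push_cast
    field_simp
  · obtain ⟨K, hK⟩ := exists_patchDomain_leading_term hn hfc κ hfq (g := fun x =>
      graphDensity f x * x i) (a := fun x => x i) (by fun_prop) (by fun_prop)
      (k := 1) (j := 2) le_rfl (C' := |A| + B)
      (fun θ hθ r hr hr1 => by
        have e : graphDensity f (r • θ) * (r • θ) i - r ^ 1 * θ i =
            (graphDensity f (r • θ) - 1) * (r * θ i) := by
          simp only [PiLp.smul_apply, smul_eq_mul]; ring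
        rw [e, abs_mul, abs_mul, abs_of_pos hr]
        calc _ ≤ (|A| + B) * r ^ 2 * (r * 1) :=
              mul_le_mul (hJ1 θ hθ r hr hr1) (mul_le_mul_of_nonneg_left (hcoord θ hθ i) hr.le)
                (by positivity) (by positivity)
          _ = _ := by ring)
    refine ⟨K, hK.mono fun ε h => ?_⟩
    simpa [sphereIntegral_coord hn] using h
  · obtain ⟨K, hK⟩ := exists_patchDomain_leading_term hn hfc κ hfq (g := fun x =>
      graphDensity f x * (x i * f x)) (a := fun x => x i * osculatingQuadric κ x) (by fun_prop)
      (by fun_prop) (k := 3) (j := 1) (by norm_num) (C' := (|A| + B) * (C + M) + C)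
      (fun θ hθ r hr hr1 => by
        have e : graphDensity f (r • θ) * ((r • θ) i * f (r • θ)) -
            r ^ 3 * (θ i * osculatingQuadric κ θ) =
            (graphDensity f (r • θ) * f (r • θ) - r ^ 2 * osculatingQuadric κ θ) * (r * θ i) := by
          simp only [PiLp.smul_apply, smul_eq_mul]; ring
        rw [e, abs_mul, abs_mul r, abs_of_pos hr]
        calc _ ≤ ((|A| + B) * (C + M) + C) * r ^ 3 * (r * 1) :=
              mul_le_mul (hJf θ hθ r hr hr1) (mul_le_mul_of_nonneg_left (hcoord θ hθ i) hr.le)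
                (by positivity) (by positivity)
          _ = _ := by ring)
    refine ⟨K, hK.mono fun ε h => ?_⟩
    simpa [sphereIntegral_coord_mul_quadric κ hn] using h
  · obtain ⟨K, hK⟩ := exists_patchDomain_expansion hn hfc κ one_pos hfq (g := fun x =>
      graphDensity f x * (x i * x j)) (a := fun x => x i * x j)
      (c := fun x => 1 / 2 * (x i * x j * Q x)) (by fun_prop)
      (by fun_prop) (by fun_prop) (k := 2) (j := 3) le_rfl (C' := |A|)
      (fun θ hθ r hr hr1 => by
        have e : graphDensity f (r • θ) * ((r • θ) i * (r • θ) j) -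
            (r ^ 2 * (θ i * θ j) + r ^ (2 + 2) * (1 / 2 * (θ i * θ j * Q θ))) =
            (graphDensity f (r • θ) - 1 - r ^ 2 * Q θ / 2) * (r ^ 2 * (θ i * θ j)) := by
          simp only [PiLp.smul_apply, smul_eq_mul]; ring
        rw [e, abs_mul, abs_mul, abs_mul (θ i), abs_of_pos (pow_pos hr 2)]
        calc _ ≤ |A| * r ^ 3 * (r ^ 2 * (1 * 1)) :=
              mul_le_mul (hJ3 θ hθ r hr hr1) (mul_le_mul_of_nonneg_left (mul_le_mul (hcoord θ hθ i)
                (hcoord θ hθ j) (abs_nonneg _) zero_le_one) (by positivity))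
                (by positivity) (by positivity)
          _ = _ := by ring)
    refine ⟨K, hK.mono fun ε h => ?_⟩
    rw [sphereIntegral_const_mul, sphereIntegral_coord_mul_coord_mul_grad κ hn,
      sphereIntegral_coord_mul_coord_mul_quadric_sq κ hn] at h
    by_cases hij : i = j
    · subst hij
      have e : sphereIntegral (fun x : Euc n => x i * x i) = unitBallVolume n := by
        simpa [pow_two] using sphereIntegral_sq hn i
      simp only [if_true, e] at h ⊢
      convert h using 3
      rw [scalarCurvature_eq]
      push_cast
      field_simp
      ring
    · simpa [hij, sphereIntegral_coord_mul_coord_of_ne hn hij] using h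

/-! ### The covariance matrix of a small patch -/

section Covariance

variable {n : ℕ} (b : OrthonormalBasis (Fin (n + 1)) ℝ (Euc (n + 1))) (p : Euc (n + 1))
  {f : Euc n → ℝ}

theorem integrableOn_patchDomain (hf : Continuous f) {ε : ℝ} {G : Type*} [NormedAddCommGroup G]
    {g : Euc n → G} (hg : Continuous g) : IntegrableOn g (patchDomain f ε) := by
  have h : patchDomain f ε = patchDomain f |ε| := by simp only [patchDomain, sq_abs]
  rw [h]
  exact hg.continuousOn.integrableOn_compact (isCompact_patchDomain hf (abs_nonneg ε))

theorem toReal_area_patch (hf : ContDiff ℝ ∞ f) (ε : ℝ) :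
    (μHE[n] (graphMap b p f '' patchDomain f ε)).toReal =
      ∫ x in patchDomain f ε, graphDensity f x := by
  rw [euclideanHausdorffMeasure_graph b p hf (isClosed_patchDomain hf.continuous ε).measurableSet,
    integral_eq_lintegral_of_nonneg_ae (Eventually.of_forall fun x =>
      zero_le_one.trans (one_le_graphDensity f x))
      (continuous_graphDensity hf).aestronglyMeasurable]

/-- The coordinates of the barycenter of a patch. -/
theorem inner_barycenter_graph (hf : ContDiff ℝ ∞ f) {ε : ℝ}
    (hV : (∫ x in patchDomain f ε, graphDensity f x) ≠ 0) (u : Euc (n + 1)) :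
    inner ℝ u (barycenter n (graphMap b p f '' patchDomain f ε) - p) =
      (∫ x in patchDomain f ε, graphDensity f x * inner ℝ u (graphMap b p f x - p)) /
        ∫ x in patchDomain f ε, graphDensity f x := by
  have hΦ := (contDiff_graphMap (p := p) b hf).continuous
  have hJ := continuous_graphDensity hf
  set V := ∫ x in patchDomain f ε, graphDensity f x with hVdef
  have h1 : barycenter n (graphMap b p f '' patchDomain f ε) - p =
      V⁻¹ • ∫ x in patchDomain f ε, graphDensity f x • (graphMap b p f x - p) := by
    have h2 : (∫ x in patchDomain f ε, graphDensity f x • (graphMap b p f x - p)) =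
        (∫ x in patchDomain f ε, graphDensity f x • graphMap b p f x) - V • p := by
      simp only [smul_sub]
      rw [integral_sub (integrableOn_patchDomain hf.continuous (by fun_prop))
        (integrableOn_patchDomain hf.continuous (by fun_prop)), integral_smul_const]
    rw [h2, smul_sub, smul_smul, inv_mul_cancel₀ hV, one_smul, barycenter,
      toReal_area_patch b p hf, setIntegral_graph b p hf
        (isClosed_patchDomain hf.continuous ε).measurableSet]
  rw [h1, inner_smul_right, ← integral_inner
    (integrableOn_patchDomain hf.continuous (by fun_prop)), inv_mul_eq_div]
  simp only [inner_smul_right]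

/-- The entries of the covariance matrix of a patch in any directions `u`, `w`. -/
theorem inner_covarianceMatrix_graph (hf : ContDiff ℝ ∞ f) {ε : ℝ}
    (hV : (∫ x in patchDomain f ε, graphDensity f x) ≠ 0) (u w : Euc (n + 1)) :
    inner ℝ u (Matrix.toEuclideanLin
      (covarianceMatrix n (graphMap b p f '' patchDomain f ε)) w) =
      (∫ x in patchDomain f ε, graphDensity f x *
        (inner ℝ u (graphMap b p f x - p) * inner ℝ w (graphMap b p f x - p))) -
      (∫ x in patchDomain f ε, graphDensity f x * inner ℝ u (graphMap b p f x - p)) *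
        (∫ x in patchDomain f ε, graphDensity f x * inner ℝ w (graphMap b p f x - p)) /
        ∫ x in patchDomain f ε, graphDensity f x := by
  have hΦ := (contDiff_graphMap (p := p) b hf).continuous
  have hJ := continuous_graphDensity hf
  set D := graphMap b p f '' patchDomain f ε with hD
  set s := barycenter n D with hs
  have hint : ∀ {g : Euc n → ℝ}, Continuous g → IntegrableOn g (patchDomain f ε) :=
    fun hg => integrableOn_patchDomain hf.continuous hg
  have hA : ∀ k l, covarianceMatrix n D k l = ∫ x in patchDomain f ε, graphDensity f x *
      ((graphMap b p f x k - s k) * (graphMap b p f x l - s l)) := by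
    intro k l
    rw [covarianceMatrix, Matrix.of_apply, hD, setIntegral_graph b p hf
      (isClosed_patchDomain hf.continuous ε).measurableSet]
    simp only [smul_eq_mul, ← hD, ← hs]
  have h1 : inner ℝ u (Matrix.toEuclideanLin (covarianceMatrix n D) w) =
      ∫ x in patchDomain f ε, graphDensity f x *
        (inner ℝ u (graphMap b p f x - s) * inner ℝ w (graphMap b p f x - s)) := by
    have e1 : inner ℝ u (Matrix.toEuclideanLin (covarianceMatrix n D) w) =
        ∑ k, ∑ l, u k * w l * covarianceMatrix n D k l := by
      simp only [PiLp.inner_apply, Matrix.toLpLin_apply, Matrix.mulVec, dotProduct,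
        RCLike.inner_apply, conj_trivial, Finset.sum_mul]
      refine Finset.sum_congr rfl fun k _ => Finset.sum_congr rfl fun l _ => by ring
    have e2 : ∀ x, graphDensity f x *
        (inner ℝ u (graphMap b p f x - s) * inner ℝ w (graphMap b p f x - s)) =
        ∑ k, ∑ l, u k * w l * (graphDensity f x *
          ((graphMap b p f x k - s k) * (graphMap b p f x l - s l))) := by
      intro x
      simp only [PiLp.inner_apply, RCLike.inner_apply, conj_trivial, PiLp.sub_apply]
      rw [Finset.sum_mul_sum, Finset.mul_sum]
      simp only [Finset.mul_sum]
      refine Finset.sum_congr rfl fun k _ => Finset.sum_congr rfl fun l _ => by ring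
    rw [e1]
    simp only [e2]
    rw [integral_finsetSum _ fun k _ => hint (by fun_prop)]
    refine Finset.sum_congr rfl fun k _ => ?_
    rw [integral_finsetSum _ fun l _ => hint (by fun_prop)]
    refine Finset.sum_congr rfl fun l _ => ?_
    rw [integral_const_mul, hA]
  set V := ∫ x in patchDomain f ε, graphDensity f x with hVdef
  set a := ∫ x in patchDomain f ε, graphDensity f x * inner ℝ u (graphMap b p f x - p) with ha
  set c := ∫ x in patchDomain f ε, graphDensity f x * inner ℝ w (graphMap b p f x - p) with hc
  have hu : inner ℝ u (s - p) = a / V := inner_barycenter_graph b p hf hV u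
  have hw : inner ℝ w (s - p) = c / V := inner_barycenter_graph b p hf hV w
  have hsub : ∀ v x, inner ℝ v (graphMap b p f x - s) =
      inner ℝ v (graphMap b p f x - p) - inner ℝ v (s - p) := fun v x => by
    rw [← inner_sub_right, sub_sub_sub_cancel_right]
  have e3 : ∀ x, graphDensity f x *
      (inner ℝ u (graphMap b p f x - s) * inner ℝ w (graphMap b p f x - s)) =
      graphDensity f x * (inner ℝ u (graphMap b p f x - p) * inner ℝ w (graphMap b p f x - p)) -
        c / V * (graphDensity f x * inner ℝ u (graphMap b p f x - p)) -
        a / V * (graphDensity f x * inner ℝ w (graphMap b p f x - p)) +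
        a / V * (c / V) * graphDensity f x := by
    intro x
    rw [hsub, hsub, hu, hw]
    ring
  rw [h1]
  simp only [e3]
  rw [integral_add (hint (by fun_prop)) (hint (by fun_prop)),
    integral_sub (hint (by fun_prop)) (hint (by fun_prop)),
    integral_sub (hint (by fun_prop)) (hint (by fun_prop)),
    integral_const_mul, integral_const_mul, integral_const_mul, ← hVdef, ← ha, ← hc]
  field_simp
  ring

theorem isSymm_covarianceMatrix {d : ℕ} (D : Set (Euc d)) : (covarianceMatrix n D).IsSymm := by
  ext i j
  simp only [Matrix.transpose_apply, covarianceMatrix, Matrix.of_apply, mul_comm]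

end Covariance

/-- The expansion of the product of two first moments divided by the area. -/
theorem exists_bound_mul_div {n : ℕ} {P R V : ℝ → ℝ} {a c σ : ℝ} (hσ : 0 < σ)
    (hP : ∃ K, ∀ᶠ ε in 𝓝[>] (0 : ℝ), |P ε - a * ε ^ (n + 2)| ≤ K * ε ^ (n + 3))
    (hR : ∃ K, ∀ᶠ ε in 𝓝[>] (0 : ℝ), |R ε - c * ε ^ (n + 2)| ≤ K * ε ^ (n + 3))
    (hV : ∃ K, ∀ᶠ ε in 𝓝[>] (0 : ℝ), |V ε - σ * ε ^ n| ≤ K * ε ^ (n + 1)) :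
    ∃ K', ∀ᶠ ε in 𝓝[>] (0 : ℝ), 0 < V ε ∧
      |P ε * R ε / V ε - a * c / σ * ε ^ (n + 4)| ≤ K' * ε ^ (n + 5) := by
  obtain ⟨K₁, hP⟩ := hP
  obtain ⟨K₂, hR⟩ := hR
  obtain ⟨K₃, hV⟩ := hV
  set L := |K₁| + |K₂| + |K₃| + 1 with hL
  have hL0 : 0 < L := by positivity
  refine ⟨(σ * (|c| + L) * L + σ * |a| * L + |a * c| * L) / (σ * (σ / 2)), ?_⟩
  filter_upwards [hP, hR, hV, Ioo_mem_nhdsGT (show 0 < min 1 (σ / (2 * L)) by positivity)]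
    with ε h1 h2 h3 ⟨hε, hε1⟩
  have hε2 : ε < 1 := hε1.trans_le (min_le_left _ _)
  have hε3 : L * ε ≤ σ / 2 := by
    have := (hε1.trans_le (min_le_right _ _)).le
    rw [le_div_iff₀ (by positivity)] at this
    linarith
  -- After division by the powers of `ε`, numerators and denominator are constants up to `O(ε)`.
  have key : ∀ {X x K : ℝ} {m : ℕ}, K ≤ L → |X - x * ε ^ m| ≤ K * ε ^ (m + 1) →
      |X / ε ^ m - x| ≤ L * ε := by
    intro X x K m hKL h
    have hm : 0 < ε ^ m := pow_pos hε m
    have e : X / ε ^ m - x = (X - x * ε ^ m) / ε ^ m := by field_simp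
    rw [e, abs_div, abs_of_pos hm, div_le_iff₀ hm]
    calc _ ≤ _ := h
      _ ≤ L * ε ^ (m + 1) := mul_le_mul_of_nonneg_right hKL (by positivity)
      _ = _ := by ring
  have k1 := key (by
    linarith [le_abs_self K₁, le_abs_self K₂, le_abs_self K₃, abs_nonneg K₁, abs_nonneg K₂,
      abs_nonneg K₃]) h1
  have k2 := key (by
    linarith [le_abs_self K₁, le_abs_self K₂, le_abs_self K₃, abs_nonneg K₁, abs_nonneg K₂,
      abs_nonneg K₃]) h2
  have k3 := key (by
    linarith [le_abs_self K₁, le_abs_self K₂, le_abs_self K₃, abs_nonneg K₁, abs_nonneg K₂,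
      abs_nonneg K₃]) h3
  set P' := P ε / ε ^ (n + 2) with hP'
  set R' := R ε / ε ^ (n + 2) with hR'
  set V' := V ε / ε ^ n with hV'
  have hV2 : σ / 2 ≤ V' := by linarith [(abs_le.mp k3).1]
  have hV'0 : 0 < V' := by linarith
  have hVe : V ε = V' * ε ^ n := by rw [hV']; field_simp
  have hPe : P ε = P' * ε ^ (n + 2) := by rw [hP']; field_simp
  have hRe : R ε = R' * ε ^ (n + 2) := by rw [hR']; field_simp
  refine ⟨by rw [hVe]; positivity, ?_⟩
  have hRb : |R'| ≤ |c| + L := by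
    have := abs_add_le (R' - c) c
    rw [sub_add_cancel] at this
    nlinarith
  have hnum : |σ * (P' * R') - a * c * V'| ≤
      (σ * (|c| + L) * L + σ * |a| * L + |a * c| * L) * ε := by
    have e : σ * (P' * R') - a * c * V' =
      σ * ((P' - a) * R') + σ * (a * (R' - c)) + -(a * c * (V' - σ)) := by ring
    rw [e]
    refine (abs_add_three _ _ _).trans ?_
    rw [abs_neg, abs_mul, abs_mul, abs_mul σ, abs_mul a (R' - c), abs_mul (a * c),
      abs_of_pos hσ]
    have t1 : |P' - a| * |R'| ≤ L * ε * (|c| + L) :=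
      mul_le_mul k1 hRb (abs_nonneg _) (by positivity)
    have t2 : |a| * |R' - c| ≤ |a| * (L * ε) := mul_le_mul_of_nonneg_left k2 (abs_nonneg _)
    have t3 : |a * c| * |V' - σ| ≤ |a * c| * (L * ε) := mul_le_mul_of_nonneg_left k3 (abs_nonneg _)
    have t1' := mul_le_mul_of_nonneg_left t1 hσ.le
    have t2' := mul_le_mul_of_nonneg_left t2 hσ.le
    linarith
  have e : P ε * R ε / V ε - a * c / σ * ε ^ (n + 4) =
      (σ * (P' * R') - a * c * V') / (σ * V') * ε ^ (n + 4) := by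
    rw [hVe, hPe, hRe]
    field_simp
    ring
  rw [e, abs_mul, abs_div, abs_of_pos (mul_pos hσ hV'0), abs_of_pos (pow_pos hε _)]
  calc _ ≤ ((σ * (|c| + L) * L + σ * |a| * L + |a * c| * L) * ε) / (σ * (σ / 2)) * ε ^ (n + 4) := by
        gcongr
    _ = _ := by ring

/-- The expansion of the eigenvalue of the covariance matrix in the principal direction `μ`. -/
def tangentEigenvalueExpansion {n : ℕ} (κ : Fin n → ℝ) (μ : Fin n) (ε : ℝ) : ℝ :=
  ballVolume n ε * (ε ^ 2 / ((n : ℝ) + 2) + ε ^ 4 / (8 * ((n : ℝ) + 2) * ((n : ℝ) + 4)) *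
    (meanCurvature κ ^ 2 - 2 * scalarCurvature κ - 4 * meanCurvature κ * κ μ))

/-- The expansion of the eigenvalue of the covariance matrix in the normal direction. -/
def normalEigenvalueExpansion {n : ℕ} (κ : Fin n → ℝ) (ε : ℝ) : ℝ :=
  ballVolume n ε * (ε ^ 4 / (2 * ((n : ℝ) + 2) * ((n : ℝ) + 4))) *
    (((n : ℝ) + 1) / ((n : ℝ) + 2) * meanCurvature κ ^ 2 - scalarCurvature κ)

/-- The entries of the covariance matrix of a small patch, in the frame of the principal directions
and the normal. -/
theorem exists_frame_entry_bounds {n : ℕ} (hn : 1 ≤ n) {S : Set (Euc (n + 1))}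
    (hS : IsSmoothHypersurface S) {p : Euc (n + 1)} (hp : p ∈ S) {N : Euc (n + 1) → Euc (n + 1)}
    (hN : IsUnitNormalFieldAround S p N) {κ : Fin n → ℝ}
    {e : OrthonormalBasis (Fin n) ℝ (tangentSpaceAt S p)} (he : IsPrincipalFrame S p N κ e) :
    (∀ᶠ ε in 𝓝[>] (0 : ℝ), 0 < μHE[n] (patch S p ε) ∧ μHE[n] (patch S p ε) < ⊤) ∧
    ∃ b : OrthonormalBasis (Fin (n + 1)) ℝ (Euc (n + 1)),
      (∀ i : Fin n, b i.castSucc = e i) ∧ b (Fin.last n) = N p ∧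
      (∀ i j : Fin n, ∃ K, ∀ᶠ ε in 𝓝[>] (0 : ℝ), |inner ℝ (b i.castSucc) (Matrix.toEuclideanLin
        (covarianceMatrix n (patch S p ε)) (b j.castSucc)) -
        if i = j then tangentEigenvalueExpansion κ i ε else 0| ≤ K * ε ^ (n + 5)) ∧
      (∃ K, ∀ᶠ ε in 𝓝[>] (0 : ℝ), |inner ℝ (b (Fin.last n)) (Matrix.toEuclideanLin
        (covarianceMatrix n (patch S p ε)) (b (Fin.last n))) - normalEigenvalueExpansion κ ε| ≤
          K * ε ^ (n + 5)) ∧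
      ∀ i : Fin n, ∃ K, ∀ᶠ ε in 𝓝[>] (0 : ℝ), |inner ℝ (b i.castSucc) (Matrix.toEuclideanLin
        (covarianceMatrix n (patch S p ε)) (b (Fin.last n)))| ≤ K * ε ^ (n + 4) := by
  obtain ⟨b, hbe, hbN⟩ := exists_orthonormalBasis_extending hp hN e
  obtain ⟨f, hf, h0, hfS⟩ := exists_graph_of_isSmoothHypersurface hS hp b
    fun i => by rw [hbe]; exact (e i).2
  obtain ⟨hf1, hf2⟩ := fderiv_graph_eq_zero_and_hessian hN he hbe hbN hf h0 hfS
  obtain ⟨C, hC, hfq, hdf⟩ := exists_taylor_bound hf h0 hf1 hf2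
  obtain ⟨hV, hIf, hIff, hIx, hIxf, hIxx⟩ := exists_moment_bounds hn hf hC hfq hdf
  have hω := unitBallVolume_pos n
  have hpatch := eventually_patch_eq_image (b := b) hfS
  have hIx' : ∀ i, ∃ K, ∀ᶠ ε in 𝓝[>] (0 : ℝ),
      |(∫ x in patchDomain f ε, graphDensity f x * x i) - 0 * ε ^ (n + 2)| ≤ K * ε ^ (n + 3) :=
    fun i => by simpa only [zero_mul, sub_zero] using hIx i
  have hT : ∀ (i : Fin n) x, inner ℝ (b i.castSucc) (graphMap b p f x - p) = x i := fun i x => by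
    rw [graphMap, add_sub_cancel_left, inner_castSucc_frame]
  have hL : ∀ x, inner ℝ (b (Fin.last n)) (graphMap b p f x - p) = f x := fun x => by
    rw [graphMap, add_sub_cancel_left, inner_last_frame]
  obtain ⟨K₀, hff⟩ := exists_bound_mul_div hω hIf hIf hV
  refine ⟨?_, b, hbe, hbN, fun i j => ?_, ?_, fun i => ?_⟩
  · filter_upwards [hpatch, hff] with ε h1 h2
    have h3 := h2.1
    rw [h1]
    rw [← toReal_area_patch b p hf] at h3
    exact ENNReal.toReal_pos_iff.mp h3
  · obtain ⟨K₁, h1⟩ := hIxx i j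
    obtain ⟨K₂, h2⟩ := exists_bound_mul_div hω (hIx' i) (hIx' j) hV
    refine ⟨K₁ + K₂, ?_⟩
    filter_upwards [hpatch, h1, h2, self_mem_nhdsWithin] with ε e1 e2 ⟨e3, e4⟩ (hε : 0 < ε)
    rw [e1, inner_covarianceMatrix_graph b p hf e3.ne']
    simp only [hT, tangentEigenvalueExpansion, ballVolume_eq hε]
    simp only [zero_mul, zero_div, sub_zero] at e4
    rw [sub_right_comm]
    exact (abs_sub _ _).trans (by linarith)
  · obtain ⟨K₁, h1⟩ := hIff
    refine ⟨K₁ + K₀, ?_⟩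
    filter_upwards [hpatch, h1, hff, self_mem_nhdsWithin] with ε e1 e2 ⟨e3, e4⟩ (hε : 0 < ε)
    rw [e1, inner_covarianceMatrix_graph b p hf e3.ne']
    simp only [hL, normalEigenvalueExpansion, ballVolume_eq hε, ← pow_two (f _)]
    set X := ∫ x in patchDomain f ε, graphDensity f x * f x ^ 2
    set Y := (∫ x in patchDomain f ε, graphDensity f x * f x) *
      (∫ x in patchDomain f ε, graphDensity f x * f x) / ∫ x in patchDomain f ε, graphDensity f x
    have e : ∀ a c d : ℝ, d = a - c → X - Y - d = (X - a) - (Y - c) := fun a c d h => by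
      rw [h]; ring
    rw [e _ _ _ ?_]
    · exact (abs_sub _ _).trans ((add_le_add e2 e4).trans_eq (by ring))
    · rw [scalarCurvature_eq]
      field_simp
      ring
  · obtain ⟨K₁, h1⟩ := hIxf i
    obtain ⟨K₂, h2⟩ := exists_bound_mul_div hω (hIx' i) hIf hV
    refine ⟨K₁ + |K₂|, ?_⟩
    filter_upwards [hpatch, h1, h2, Ioo_mem_nhdsGT one_pos] with ε e1 e2 ⟨e3, e4⟩ ⟨hε, hε1⟩
    rw [e1, inner_covarianceMatrix_graph b p hf e3.ne']
    simp only [hT, hL]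
    simp only [zero_mul, zero_div, sub_zero] at e4
    have h5 : K₂ * ε ^ (n + 5) ≤ |K₂| * ε ^ (n + 4) :=
      mul_le_mul (le_abs_self _) (pow_le_pow_of_le_one hε.le hε1.le (by lia)) (by positivity)
        (abs_nonneg _)
    exact (abs_sub _ _).trans (by linarith)

/-- Finitely many bounds of the form `O(ε ^ m)` hold with a common constant, and with any larger
one. -/
theorem exists_common_bound {ι : Type*} [Fintype ι] {m : ℕ} {F : ι → ℝ → ℝ}
    (h : ∀ i, ∃ K, ∀ᶠ ε in 𝓝[>] (0 : ℝ), |F i ε| ≤ K * ε ^ m) :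
    ∃ K₀, ∀ K, K₀ ≤ K → ∀ i, ∀ᶠ ε in 𝓝[>] (0 : ℝ), |F i ε| ≤ K * ε ^ m := by
  choose k hk using h
  refine ⟨∑ i, |k i|, fun K hK i => ?_⟩
  filter_upwards [hk i, self_mem_nhdsWithin] with ε h1 (hε : 0 < ε)
  refine h1.trans (mul_le_mul_of_nonneg_right ?_ (by positivity))
  exact (le_abs_self _).trans
    ((Finset.single_le_sum (fun i _ => abs_nonneg (k i)) (Finset.mem_univ i)).trans hK)

/-- The normal eigenvalue is smaller than the tangential ones by a multiple of `ε ^ (n + 2)`. -/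
theorem eventually_normal_add_le_tangent {n : ℕ} (κ : Fin n → ℝ) (i : Fin n) :
    ∀ᶠ ε in 𝓝[>] (0 : ℝ), normalEigenvalueExpansion κ ε +
      unitBallVolume n / (2 * ((n : ℝ) + 2)) * ε ^ (n + 2) ≤ tangentEigenvalueExpansion κ i ε := by
  have hω := unitBallVolume_pos n
  set α := (meanCurvature κ ^ 2 - 2 * scalarCurvature κ - 4 * meanCurvature κ * κ i) /
    (8 * ((n : ℝ) + 2) * ((n : ℝ) + 4)) with hα
  set β := (((n : ℝ) + 1) / ((n : ℝ) + 2) * meanCurvature κ ^ 2 - scalarCurvature κ) /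
    (2 * ((n : ℝ) + 2) * ((n : ℝ) + 4)) with hβ
  have ht : Tendsto (fun ε : ℝ => (β - α) * ε ^ 2) (𝓝[>] 0) (𝓝 0) := by
    have : Continuous fun ε : ℝ => (β - α) * ε ^ 2 := by fun_prop
    simpa using (this.tendsto 0).mono_left nhdsWithin_le_nhds
  filter_upwards [ht.eventually_le_const (show (0 : ℝ) < 1 / (2 * ((n : ℝ) + 2)) by positivity),
    self_mem_nhdsWithin] with ε h (hε : 0 < ε)
  have e1 : normalEigenvalueExpansion κ ε = unitBallVolume n * ε ^ (n + 2) * (β * ε ^ 2) := by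
    rw [normalEigenvalueExpansion, ballVolume_eq hε, hβ]
    ring
  have e2 : tangentEigenvalueExpansion κ i ε =
      unitBallVolume n * ε ^ (n + 2) * (1 / ((n : ℝ) + 2) + α * ε ^ 2) := by
    rw [tangentEigenvalueExpansion, ballVolume_eq hε, hα]
    ring
  have e3 : unitBallVolume n / (2 * ((n : ℝ) + 2)) * ε ^ (n + 2) =
      unitBallVolume n * ε ^ (n + 2) * (1 / (2 * ((n : ℝ) + 2))) := by ring
  have e4 : 1 / ((n : ℝ) + 2) = 1 / (2 * ((n : ℝ) + 2)) + 1 / (2 * ((n : ℝ) + 2)) := by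
    field_simp
    norm_num
  rw [e1, e2, e3, ← mul_add]
  refine mul_le_mul_of_nonneg_left ?_ (by positivity)
  linarith

theorem abs_tangent_sub_tangent {n : ℕ} (κ : Fin n → ℝ) (i j : Fin n) {ε : ℝ} (hε : 0 < ε) :
    |tangentEigenvalueExpansion κ i ε - tangentEigenvalueExpansion κ j ε| =
      unitBallVolume n * |meanCurvature κ * (κ i - κ j)| / (2 * ((n : ℝ) + 2) * ((n : ℝ) + 4)) *
        ε ^ (n + 4) := by
  have hω := unitBallVolume_pos n
  have e : tangentEigenvalueExpansion κ i ε - tangentEigenvalueExpansion κ j ε =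
      -(unitBallVolume n / (2 * ((n : ℝ) + 2) * ((n : ℝ) + 4)) * ε ^ (n + 4) *
        (meanCurvature κ * (κ i - κ j))) := by
    simp only [tangentEigenvalueExpansion, ballVolume_eq hε]
    field_simp
    ring
  rw [e, abs_neg, abs_mul, abs_of_pos (by positivity)]
  ring

end

theorem mainTheorem2 (n : ℕ) (hn : 1 ≤ n)
    (S : Set (Euc (n + 1))) (hS : IsSmoothHypersurface S)
    (p : Euc (n + 1)) (hp : p ∈ S)
    (N : Euc (n + 1) → Euc (n + 1)) (hN : IsUnitNormalFieldAround S p N)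
    (κ : Fin n → ℝ) (e : OrthonormalBasis (Fin n) ℝ (tangentSpaceAt S p))
    (he : IsPrincipalFrame S p N κ e) :
    (∀ᶠ ε in 𝓝[>] (0 : ℝ), 0 < μHE[n] (patch S p ε) ∧ μHE[n] (patch S p ε) < ⊤) ∧
    ∃ l : Fin (n + 1) → ℝ → ℝ,
      (∀ᶠ ε in 𝓝[>] (0 : ℝ), (covarianceMatrix n (patch S p ε)).charpoly =
        ∏ i, (Polynomial.X - Polynomial.C (l i ε))) ∧
      (∀ μ : Fin n,
        (fun ε => l μ.castSucc ε - ballVolume n ε * (ε ^ 2 / ((n : ℝ) + 2) +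
          ε ^ 4 / (8 * ((n : ℝ) + 2) * ((n : ℝ) + 4)) *
            (meanCurvature κ ^ 2 - 2 * scalarCurvature κ - 4 * meanCurvature κ * κ μ)))
          =O[𝓝[>] 0] fun ε => ε ^ (n + 5)) ∧
      ((fun ε => l (Fin.last n) ε - ballVolume n ε *
          (ε ^ 4 / (2 * ((n : ℝ) + 2) * ((n : ℝ) + 4))) *
            (((n : ℝ) + 1) / ((n : ℝ) + 2) * meanCurvature κ ^ 2 - scalarCurvature κ))
          =O[𝓝[>] 0] fun ε => ε ^ (n + 5)) ∧
      (Function.Injective κ →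
        (∀ v : ℝ → Euc (n + 1),
          IsUnitEigenvectorFamily (fun ε => covarianceMatrix n (patch S p ε)) (l (Fin.last n)) v →
            ConvergesUpToSign v (N p)) ∧
        ((2 ≤ n → meanCurvature κ ≠ 0) →
          ∀ (μ : Fin n) (v : ℝ → Euc (n + 1)),
            IsUnitEigenvectorFamily (fun ε => covarianceMatrix n (patch S p ε))
                (l μ.castSucc) v →
              ConvergesUpToSign v (e μ : Euc (n + 1)))) := by
  obtain ⟨hV, b, hbe, hbN, htt, hnn, htn⟩ := exists_frame_entry_bounds hn hS hp hN he
  refine ⟨hV, ?_⟩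
  obtain ⟨K₁, h1⟩ := exists_common_bound
    (F := fun (q : Fin n × Fin n) ε => inner ℝ (b q.1.castSucc) (Matrix.toEuclideanLin
      (covarianceMatrix n (patch S p ε)) (b q.2.castSucc)) -
      if q.1 = q.2 then tangentEigenvalueExpansion κ q.1 ε else 0) fun q => htt q.1 q.2
  obtain ⟨K₂, h2⟩ := exists_common_bound
    (F := fun (_ : Unit) ε => inner ℝ (b (Fin.last n)) (Matrix.toEuclideanLin
      (covarianceMatrix n (patch S p ε)) (b (Fin.last n))) - normalEigenvalueExpansion κ ε)
      fun _ => hnn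
  obtain ⟨K₃, h3⟩ := exists_common_bound htn
  set K := max K₁ (max K₂ K₃)
  let d : Fin (n + 1) → ℝ → ℝ :=
    Fin.snoc (tangentEigenvalueExpansion κ) (normalEigenvalueExpansion κ)
  have hd : ∀ i : Fin n, d i.castSucc = tangentEigenvalueExpansion κ i := fun i => by simp [d]
  have hdl : d (Fin.last n) = normalEigenvalueExpansion κ := by simp [d]
  have hω := unitBallVolume_pos n
  obtain ⟨l, hl, ⟨K', hK'⟩, hvn, hvt⟩ := exists_eigenvalue_asymptotics hn
    (fun ε => covarianceMatrix n (patch S p ε)) (fun ε => isSymm_covarianceMatrix _) b d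
    (K := K) (c := unitBallVolume n / (2 * ((n : ℝ) + 2))) (by positivity)
    (fun i j => by simpa only [hd] using h1 K (le_max_left _ _) (i, j))
    (by simpa only [hdl] using h2 K ((le_max_left _ _).trans (le_max_right _ _)) ())
    (h3 K ((le_max_right _ _).trans (le_max_right _ _)))
    (fun i => by simpa only [hd, hdl] using eventually_normal_add_le_tangent κ i)
  have hO : ∀ i, (fun ε => l i ε - d i ε) =O[𝓝[>] 0] fun ε => ε ^ (n + 5) := fun i => by
    refine Asymptotics.IsBigO.of_bound K' ?_
    filter_upwards [hK', self_mem_nhdsWithin] with ε h (hε : 0 < ε)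
    rw [Real.norm_eq_abs, Real.norm_eq_abs, abs_of_pos (pow_pos hε _)]
    exact h i
  refine ⟨l, hl, fun μ => ?_, ?_, fun hκ => ⟨?_, fun hH μ => ?_⟩⟩
  · simpa only [hd, tangentEigenvalueExpansion] using hO μ.castSucc
  · simpa only [hdl, normalEigenvalueExpansion] using hO (Fin.last n)
  · rw [← hbN]
    exact hvn
  · rw [← hbe]
    refine hvt μ fun ν hν => ?_
    -- The tangential eigenvalues separate at order `ε ^ (n + 4)`, with coefficient `H (κ_ν - κ_μ)`.
    have hn2 : 2 ≤ n := by
      have := Fin.val_ne_of_ne hν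
      have := μ.isLt
      have := ν.isLt
      lia
    have hne : 0 < |meanCurvature κ * (κ μ - κ ν)| :=
      abs_pos.mpr (mul_ne_zero (hH hn2) (sub_ne_zero.mpr (hκ.ne hν.symm)))
    refine ⟨unitBallVolume n * |meanCurvature κ * (κ μ - κ ν)| /
      (2 * ((n : ℝ) + 2) * ((n : ℝ) + 4)), by positivity, ?_⟩
    filter_upwards [self_mem_nhdsWithin] with ε (hε : 0 < ε)
    rw [hd, hd, abs_tangent_sub_tangent κ μ ν hε]
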